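/- All algebras are associative unital $\mathbf C$-algebras. For an algebra $R$ let $R^{\mathrm{Lie}}_1=R$ and $R^{\mathrm{Lie}}_{m+1}=[R,R^{\mathrm{Lie}}_m]$ (span of commutators), and let $F^dR=\sum_m\sum_{i_1+\dots+i_m-m=d}R\cdot R^{\mathrm{Lie}}_{i_1}\cdot R\cdots R\cdot R^{\mathrm{Lie}}_{i_m}\cdot R$ be the NC-filtration. Then $R_{ab}=R/F^1R$ is commutative, and $\mathrm{gr}_F(R)=\bigoplus_{i\ge 0}F^iR/F^{i+1}R$ is a graded Poisson algebra with product and bracket induced by $xy$ and by $xy-yx\in F^{i+j+1}R$ for $x\in F^iR$, $y\in F^jR$. Let $\mathcal N_d$ be the category of algebras with $F^{d+1}=0$. The algebra $R$ is called $d$-smooth if it is finitely generated, lies in $\mathcal N_d$, and for every surjection $\Lambda'\to\Lambda$ in $\mathcal N_d$ with nilpotent kernel the map $\mathrm{Hom}(R,\Lambda')\to\mathrm{Hom}(R,\Lambda)$ is surjective. For a commutative algebra $A$ let $P(A)$ be its Poisson envelope, i.e. the value at $A$ of the left adjoint of the forgetful functor from Poisson algebras to commutative algebras; let $P^i(A)\subset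 P(A)$ be the span of the expressions in elements of $A$, built by products and Poisson brackets, with exactly $i$ instances of the bracket, and let $P^{\ge n}(A)=\sum_{i\ge n}P^i(A)$, which is a Poisson ideal. For an $A$-module $M$ let $\mathrm{Lie}_A(M)=\bigoplus_{k\ge1}\mathrm{Lie}^k_A(M)$ be the free Lie algebra over $A$ generated by $M$, and let $Q^i_A(M)$ be the degree $i$ part of the symmetric algebra over $A$ of $\bigoplus_{k\ge 2}\mathrm{Lie}^k_A(M)$, where $\mathrm{Lie}^k_A(M)$ is given degree $k-1$. **Theorem.** Let $d\ge 0$, let $R$ be a $d$-smooth algebra and $A=R_{ab}$. Then there is a unique isomorphism of Poisson algebras $P(A)/P^{\ge d+1}(A)\to\mathrm{gr}_F(R)$ which is compatible with the canonical maps from $A$ (the map $A\to P(A)$ and the identification $A=\mathrm{gr}^0_F(R)$). It respects the gradings: it maps the image of $P^i(A)$ onto $\mathrm{gr}^i_F(R)$ for every $i\ge 0$. Moreover, for every $0\le i\le d$ there is an isomorphism of $A$-modules $\mathrm{gr}^i_F(R)\simeq Q^i_A(\Omega^1_A)$. -/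

import Mathlib

universe u

namespace NCGeom

/-! ## Poisson algebras -/

/-- A Poisson algebra over `ℂ`: a commutative algebra with an anticommutative bilinear bracket
which satisfies the Jacobi identity and is a derivation in each argument. -/
class PoissonAlgebra (P : Type u) [CommRing P] [Algebra ℂ P] where
  bracket : P →ₗ[ℂ] P →ₗ[ℂ] P
  antisymm : ∀ x y : P, bracket x y = -bracket y x
  jacobi : ∀ x y z : P,
    bracket x (bracket y z) + bracket y (bracket z x) + bracket z (bracket x y) = 0
  leibniz : ∀ x y z : P, bracket x (y * z) = bracket x y * z + y * bracket x z

/-- The Poisson bracket. -/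
def pb {P : Type u} [CommRing P] [Algebra ℂ P] [PoissonAlgebra P] (x y : P) : P :=
  PoissonAlgebra.bracket x y

/-- A Poisson ideal of a Poisson algebra: an ideal stable under bracketing with any element. -/
def IsPoissonIdeal {P : Type u} [CommRing P] [Algebra ℂ P] [PoissonAlgebra P]
    (I : Ideal P) : Prop :=
  ∀ x y : P, y ∈ I → pb x y ∈ I

/-- The bracket on the quotient by a Poisson ideal: `{x mod I, y mod I} = {x, y} mod I`. -/
def quotientBracket {P : Type u} [CommRing P] [Algebra ℂ P] [PoissonAlgebra P]
    (I : Ideal P) (hI : IsPoissonIdeal I) (x y : P ⧸ I) : P ⧸ I :=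
  Quotient.liftOn₂ x y (fun x y => Ideal.Quotient.mk I (pb x y)) (by
    intro x y x' y' hx hy
    have hx : x - x' ∈ I := (Submodule.quotientRel_def I).1 hx
    have hy : y - y' ∈ I := (Submodule.quotientRel_def I).1 hy
    refine Ideal.Quotient.eq.2 ?_
    have h : pb x y - pb x' y' = pb x (y - y') - pb y' (x - x') := by
      simp only [pb, map_sub]
      rw [PoissonAlgebra.antisymm y' x, PoissonAlgebra.antisymm y' x']
      abel
    rw [h]
    exact I.sub_mem (hI _ _ hy) (hI _ _ hx))

/-- The Poisson algebra structure on the quotient by a Poisson ideal. -/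
@[reducible] def PoissonAlgebra.quotient {P : Type u} [CommRing P] [Algebra ℂ P]
    [PoissonAlgebra P] (I : Ideal P) (hI : IsPoissonIdeal I) : PoissonAlgebra (P ⧸ I) where
  bracket := LinearMap.mk₂ ℂ (quotientBracket I hI)
    (fun x y z => by
      obtain ⟨x, rfl⟩ := Ideal.Quotient.mk_surjective x
      obtain ⟨y, rfl⟩ := Ideal.Quotient.mk_surjective y
      obtain ⟨z, rfl⟩ := Ideal.Quotient.mk_surjective z
      exact congrArg (Ideal.Quotient.mk I) (LinearMap.map_add₂ (PoissonAlgebra.bracket) x y z))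
    (fun c x y => by
      obtain ⟨x, rfl⟩ := Ideal.Quotient.mk_surjective x
      obtain ⟨y, rfl⟩ := Ideal.Quotient.mk_surjective y
      exact congrArg (Ideal.Quotient.mk I) (LinearMap.map_smul₂ (PoissonAlgebra.bracket) c x y))
    (fun x y z => by
      obtain ⟨x, rfl⟩ := Ideal.Quotient.mk_surjective x
      obtain ⟨y, rfl⟩ := Ideal.Quotient.mk_surjective y
      obtain ⟨z, rfl⟩ := Ideal.Quotient.mk_surjective z
      exact congrArg (Ideal.Quotient.mk I) (map_add (PoissonAlgebra.bracket x) y z))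
    (fun c x y => by
      obtain ⟨x, rfl⟩ := Ideal.Quotient.mk_surjective x
      obtain ⟨y, rfl⟩ := Ideal.Quotient.mk_surjective y
      exact congrArg (Ideal.Quotient.mk I) (map_smul (PoissonAlgebra.bracket x) c y))
  antisymm x y := by
    obtain ⟨x, rfl⟩ := Ideal.Quotient.mk_surjective x
    obtain ⟨y, rfl⟩ := Ideal.Quotient.mk_surjective y
    exact congrArg (Ideal.Quotient.mk I) (PoissonAlgebra.antisymm x y)
  jacobi x y z := by
    obtain ⟨x, rfl⟩ := Ideal.Quotient.mk_surjective x
    obtain ⟨y, rfl⟩ := Ideal.Quotient.mk_surjective y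
    obtain ⟨z, rfl⟩ := Ideal.Quotient.mk_surjective z
    exact congrArg (Ideal.Quotient.mk I) (PoissonAlgebra.jacobi x y z)
  leibniz x y z := by
    obtain ⟨x, rfl⟩ := Ideal.Quotient.mk_surjective x
    obtain ⟨y, rfl⟩ := Ideal.Quotient.mk_surjective y
    obtain ⟨z, rfl⟩ := Ideal.Quotient.mk_surjective z
    exact congrArg (Ideal.Quotient.mk I) (PoissonAlgebra.leibniz x y z)

/-! ## The Poisson envelope of a commutative algebra -/

/-- Formal expressions in the elements of `A`: sums, products and Poisson brackets. -/
inductive EnvTerm (A : Type u) : Type u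
  | of (a : A)
  | add (x y : EnvTerm A)
  | mul (x y : EnvTerm A)
  | bracket (x y : EnvTerm A)

/-- The identities imposed on formal expressions: those of a commutative Poisson `ℂ`-algebra, and
those saying that `A` maps to it by a homomorphism of `ℂ`-algebras. (The scalar `c : ℂ` acts as
multiplication by `of (algebraMap ℂ A c)`, the additive inverse of `x` is `of (-1) * x`.) -/
inductive EnvRel (A : Type u) [CommRing A] [Algebra ℂ A] : EnvTerm A → EnvTerm A → Prop
  | of_add (a b : A) : EnvRel A (.of (a + b)) (.add (.of a) (.of b))
  | of_mul (a b : A) : EnvRel A (.of (a * b)) (.mul (.of a) (.of b))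
  | add_assoc (x y z : EnvTerm A) : EnvRel A (.add (.add x y) z) (.add x (.add y z))
  | add_comm (x y : EnvTerm A) : EnvRel A (.add x y) (.add y x)
  | zero_add (x : EnvTerm A) : EnvRel A (.add (.of 0) x) x
  | zero_mul (x : EnvTerm A) : EnvRel A (.mul (.of 0) x) (.of 0)
  | one_mul (x : EnvTerm A) : EnvRel A (.mul (.of 1) x) x
  | mul_assoc (x y z : EnvTerm A) : EnvRel A (.mul (.mul x y) z) (.mul x (.mul y z))
  | mul_comm (x y : EnvTerm A) : EnvRel A (.mul x y) (.mul y x)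
  | add_mul (x y z : EnvTerm A) : EnvRel A (.mul (.add x y) z) (.add (.mul x z) (.mul y z))
  | bracket_add (x y z : EnvTerm A) :
      EnvRel A (.bracket x (.add y z)) (.add (.bracket x y) (.bracket x z))
  | bracket_smul (c : ℂ) (x y : EnvTerm A) :
      EnvRel A (.bracket x (.mul (.of (algebraMap ℂ A c)) y))
        (.mul (.of (algebraMap ℂ A c)) (.bracket x y))
  | antisymm (x y : EnvTerm A) : EnvRel A (.bracket x y) (.mul (.of (-1)) (.bracket y x))
  | jacobi (x y z : EnvTerm A) :
      EnvRel A (.add (.add (.bracket x (.bracket y z)) (.bracket y (.bracket z x)))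
        (.bracket z (.bracket x y))) (.of 0)
  | leibniz (x y z : EnvTerm A) :
      EnvRel A (.bracket x (.mul y z)) (.add (.mul (.bracket x y) z) (.mul y (.bracket x z)))
  | add_left {x x' : EnvTerm A} (y : EnvTerm A) (h : EnvRel A x x') :
      EnvRel A (.add x y) (.add x' y)
  | add_right (x : EnvTerm A) {y y' : EnvTerm A} (h : EnvRel A y y') :
      EnvRel A (.add x y) (.add x y')
  | mul_left {x x' : EnvTerm A} (y : EnvTerm A) (h : EnvRel A x x') :
      EnvRel A (.mul x y) (.mul x' y)
  | mul_right (x : EnvTerm A) {y y' : EnvTerm A} (h : EnvRel A y y') :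
      EnvRel A (.mul x y) (.mul x y')
  | bracket_left {x x' : EnvTerm A} (y : EnvTerm A) (h : EnvRel A x x') :
      EnvRel A (.bracket x y) (.bracket x' y)
  | bracket_right (x : EnvTerm A) {y y' : EnvTerm A} (h : EnvRel A y y') :
      EnvRel A (.bracket x y) (.bracket x y')

/-- The Poisson envelope `P(A)` of a commutative `ℂ`-algebra `A`: the universal Poisson algebra
with a homomorphism of commutative algebras from `A`. -/
def Env (A : Type u) [CommRing A] [Algebra ℂ A] : Type u := Quot (EnvRel A)

namespace Env

section

variable {A : Type u} [CommRing A] [Algebra ℂ A]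

/-- The class of an expression. -/
def mk (t : EnvTerm A) : Env A := Quot.mk _ t

/-- The class of an element of `A`. -/
def of (a : A) : Env A := mk (.of a)

instance : Add (Env A) := ⟨Quot.map₂ .add (fun x _ _ h => .add_right x h) fun _ _ y h => .add_left y h⟩
instance : Mul (Env A) := ⟨Quot.map₂ .mul (fun x _ _ h => .mul_right x h) fun _ _ y h => .mul_left y h⟩

/-- The bracket of two classes. -/
def br : Env A → Env A → Env A :=
  Quot.map₂ .bracket (fun x _ _ h => .bracket_right x h) fun _ _ y h => .bracket_left y h

theorem of_add (a b : A) : of (a + b) = of a + of b := Quot.sound (.of_add a b)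
theorem of_mul (a b : A) : of (a * b) = of a * of b := Quot.sound (.of_mul a b)

protected theorem add_assoc' (x y z : Env A) : x + y + z = x + (y + z) := by
  induction x using Quot.ind; induction y using Quot.ind; induction z using Quot.ind
  exact Quot.sound (.add_assoc _ _ _)
protected theorem add_comm' (x y : Env A) : x + y = y + x := by
  induction x using Quot.ind; induction y using Quot.ind
  exact Quot.sound (.add_comm _ _)
protected theorem zero_add' (x : Env A) : of 0 + x = x := by
  induction x using Quot.ind
  exact Quot.sound (.zero_add _)
protected theorem zero_mul' (x : Env A) : of 0 * x = of 0 := by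
  induction x using Quot.ind
  exact Quot.sound (.zero_mul _)
protected theorem one_mul' (x : Env A) : of 1 * x = x := by
  induction x using Quot.ind
  exact Quot.sound (.one_mul _)
protected theorem mul_assoc' (x y z : Env A) : x * y * z = x * (y * z) := by
  induction x using Quot.ind; induction y using Quot.ind; induction z using Quot.ind
  exact Quot.sound (.mul_assoc _ _ _)
protected theorem mul_comm' (x y : Env A) : x * y = y * x := by
  induction x using Quot.ind; induction y using Quot.ind
  exact Quot.sound (.mul_comm _ _)
protected theorem add_mul' (x y z : Env A) : (x + y) * z = x * z + y * z := by
  induction x using Quot.ind; induction y using Quot.ind; induction z using Quot.ind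
  exact Quot.sound (.add_mul _ _ _)

theorem br_add (x y z : Env A) : br x (y + z) = br x y + br x z := by
  induction x using Quot.ind; induction y using Quot.ind; induction z using Quot.ind
  exact Quot.sound (.bracket_add _ _ _)
theorem br_smul (c : ℂ) (x y : Env A) :
    br x (of (algebraMap ℂ A c) * y) = of (algebraMap ℂ A c) * br x y := by
  induction x using Quot.ind; induction y using Quot.ind
  exact Quot.sound (.bracket_smul _ _ _)
theorem br_antisymm (x y : Env A) : br x y = of (-1) * br y x := by
  induction x using Quot.ind; induction y using Quot.ind
  exact Quot.sound (.antisymm _ _)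
theorem br_jacobi (x y z : Env A) : br x (br y z) + br y (br z x) + br z (br x y) = of 0 := by
  induction x using Quot.ind; induction y using Quot.ind; induction z using Quot.ind
  exact Quot.sound (.jacobi _ _ _)
theorem br_leibniz (x y z : Env A) : br x (y * z) = br x y * z + y * br x z := by
  induction x using Quot.ind; induction y using Quot.ind; induction z using Quot.ind
  exact Quot.sound (.leibniz _ _ _)

instance : Zero (Env A) := ⟨of 0⟩
instance : One (Env A) := ⟨of 1⟩
instance : Neg (Env A) := ⟨fun x => of (-1) * x⟩

instance : CommRing (Env A) where
  nsmul := nsmulRec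
  zsmul := zsmulRec
  add_assoc := Env.add_assoc'
  add_comm := Env.add_comm'
  zero_add := Env.zero_add'
  add_zero x := (Env.add_comm' x _).trans (Env.zero_add' x)
  neg_add_cancel x := by
    have h : of (-1) * x + of 1 * x = of 0 := by
      rw [← Env.add_mul', ← of_add, neg_add_cancel, Env.zero_mul']
    rwa [Env.one_mul'] at h
  mul_assoc := Env.mul_assoc'
  mul_comm := Env.mul_comm'
  one_mul := Env.one_mul'
  mul_one x := (Env.mul_comm' x _).trans (Env.one_mul' x)
  zero_mul := Env.zero_mul'
  mul_zero x := (Env.mul_comm' x _).trans (Env.zero_mul' x)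
  right_distrib := Env.add_mul'
  left_distrib x y z := by
    rw [Env.mul_comm', Env.add_mul', Env.mul_comm' y, Env.mul_comm' z]

instance : Algebra ℂ (Env A) :=
  RingHom.toAlgebra
    { toFun := fun c => of (algebraMap ℂ A c)
      map_one' := by rw [map_one]; rfl
      map_zero' := by rw [map_zero]; rfl
      map_mul' := fun x y => by rw [map_mul, of_mul]
      map_add' := fun x y => by rw [map_add, of_add] }

theorem smul_eq (c : ℂ) (x : Env A) : c • x = of (algebraMap ℂ A c) * x := rfl

theorem of_neg_one_mul (x : Env A) : of (-1) * x = -x := rfl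

/-- The canonical homomorphism `A → P(A)`. -/
def ι (A : Type u) [CommRing A] [Algebra ℂ A] : A →ₐ[ℂ] Env A where
  toFun := of
  map_one' := rfl
  map_zero' := rfl
  map_mul' := of_mul
  map_add' := of_add
  commutes' _ := rfl

instance : PoissonAlgebra (Env A) where
  bracket := LinearMap.mk₂ ℂ br
    (fun x y z => by
      rw [br_antisymm, br_add, br_antisymm x, br_antisymm y]
      exact mul_add _ _ _)
    (fun c x y => by
      rw [br_antisymm, smul_eq, br_smul, br_antisymm x, smul_eq]
      exact mul_left_comm _ _ _)
    br_add
    (fun c x y => by rw [smul_eq, br_smul, smul_eq])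
  antisymm := br_antisymm
  jacobi := br_jacobi
  leibniz := br_leibniz

/-- `IsExpr d x`: the element `x` of `P(A)` is (the image of) a monomial expression, built from
elements of `A` by products and Poisson brackets, with exactly `d` instances of the bracket. -/
inductive IsExpr : ℕ → Env A → Prop
  | of (a : A) : IsExpr 0 (ι A a)
  | mul {i j : ℕ} {x y : Env A} (hx : IsExpr i x) (hy : IsExpr j y) : IsExpr (i + j) (x * y)
  | pb {i j : ℕ} {x y : Env A} (hx : IsExpr i x) (hy : IsExpr j y) :
      IsExpr (i + j + 1) (pb x y)

end

section

variable (A : Type u) [CommRing A] [Algebra ℂ A]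

/-- The graded component `P^d(A)`, spanned by the expressions with `d` brackets. -/
def deg (d : ℕ) : Submodule ℂ (Env A) := Submodule.span ℂ {x | IsExpr d x}

/-- `P^{≥ n}(A)`, the sum of the components `P^i(A)` with `i ≥ n`, as a subspace. -/
def geSpace (n : ℕ) : Submodule ℂ (Env A) := ⨆ (i : ℕ) (_ : n ≤ i), deg A i

variable {A}

theorem geSpace_eq_span (n : ℕ) :
    geSpace A n = Submodule.span ℂ {x | ∃ i, n ≤ i ∧ IsExpr i x} := by
  refine le_antisymm (iSup₂_le fun i hi => Submodule.span_mono fun x hx => ⟨i, hi, hx⟩)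
    (Submodule.span_le.2 ?_)
  rintro x ⟨i, hi, hx⟩
  exact (le_iSup₂_of_le (f := fun i (_ : n ≤ i) => deg A i) i hi le_rfl) (Submodule.subset_span hx)

theorem bilin_span {S T : Set (Env A)} {K : Submodule ℂ (Env A)}
    (f : Env A →ₗ[ℂ] Env A →ₗ[ℂ] Env A) (h : ∀ s ∈ S, ∀ t ∈ T, f s t ∈ K)
    {x y : Env A} (hx : x ∈ Submodule.span ℂ S) (hy : y ∈ Submodule.span ℂ T) : f x y ∈ K := by
  have hle : Submodule.map₂ f (Submodule.span ℂ S) (Submodule.span ℂ T) ≤ K := by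
    rw [Submodule.map₂_span_span, Submodule.span_le]
    rintro _ ⟨s, hs, t, ht, rfl⟩
    exact h s hs t ht
  exact hle (Submodule.apply_mem_map₂ f hx hy)

theorem mul_mem_geSpace {m n : ℕ} {x y : Env A} (hx : x ∈ geSpace A m) (hy : y ∈ geSpace A n) :
    x * y ∈ geSpace A (m + n) := by
  rw [geSpace_eq_span] at hx hy ⊢
  refine bilin_span (LinearMap.mul ℂ (Env A)) ?_ hx hy
  rintro s ⟨i, hi, hs⟩ t ⟨j, hj, ht⟩
  exact Submodule.subset_span ⟨i + j, by omega, hs.mul ht⟩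

theorem pb_mem_geSpace {m n : ℕ} {x y : Env A} (hx : x ∈ geSpace A m) (hy : y ∈ geSpace A n) :
    pb x y ∈ geSpace A (m + n + 1) := by
  rw [geSpace_eq_span] at hx hy ⊢
  refine bilin_span PoissonAlgebra.bracket ?_ hx hy
  rintro s ⟨i, hi, hs⟩ t ⟨j, hj, ht⟩
  exact Submodule.subset_span ⟨i + j + 1, by omega, hs.pb ht⟩

theorem geSpace_antitone {m n : ℕ} (h : m ≤ n) : geSpace A n ≤ geSpace A m :=
  iSup₂_le fun i hi => le_iSup₂_of_le (f := fun i (_ : m ≤ i) => deg A i) i (h.trans hi) le_rfl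

theorem mk_mem_geSpace_zero (t : EnvTerm A) : mk t ∈ geSpace A 0 := by
  induction t with
  | of a =>
    rw [geSpace_eq_span]
    exact Submodule.subset_span ⟨0, le_rfl, IsExpr.of a⟩
  | add x y hx hy =>
    change mk x + mk y ∈ geSpace A 0
    exact add_mem hx hy
  | mul x y hx hy =>
    change mk x * mk y ∈ geSpace A (0 + 0)
    exact mul_mem_geSpace hx hy
  | bracket x y hx hy =>
    change pb (mk x) (mk y) ∈ geSpace A 0
    exact geSpace_antitone (Nat.zero_le _) (pb_mem_geSpace hx hy)

theorem mem_geSpace_zero (x : Env A) : x ∈ geSpace A 0 :=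
  Quot.ind (β := fun x : Env A => x ∈ geSpace A 0) mk_mem_geSpace_zero x

variable (A)

/-- `P^{≥ n}(A)` as an ideal of `P(A)`. -/
def ge (n : ℕ) : Ideal (Env A) where
  carrier := geSpace A n
  add_mem' := add_mem
  zero_mem' := zero_mem _
  smul_mem' x y hy := by
    have h := mul_mem_geSpace (mem_geSpace_zero x) hy
    rwa [Nat.zero_add] at h

theorem isPoissonIdeal_ge (n : ℕ) : IsPoissonIdeal (ge A n) := fun x y hy =>
  geSpace_antitone (by omega) (pb_mem_geSpace (mem_geSpace_zero x) (show y ∈ geSpace A n from hy))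

instance (n : ℕ) : PoissonAlgebra (Env A ⧸ ge A n) :=
  PoissonAlgebra.quotient (ge A n) (isPoissonIdeal_ge A n)

end

end Env

/-! ## The NC-filtration -/

section

attribute [local instance] LieRing.ofAssociativeRing LieAlgebra.ofAssociativeAlgebra

/-- The term `L_{k+1}` of the lower central series `L_1 = L`, `L_{m+1} = [L, L_m]` of the Lie
algebra `L = R^Lie`, that is, of `R` with the commutator bracket. -/
def lieTerm (R : Type u) [Ring R] [Algebra ℂ R] (k : ℕ) : Submodule ℂ R :=
  (LieModule.lowerCentralSeries ℂ R R k).toSubmodule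

theorem lieTerm_zero (R : Type u) [Ring R] [Algebra ℂ R] : lieTerm R 0 = ⊤ := rfl

theorem lieTerm_succ (R : Type u) [Ring R] [Algebra ℂ R] (k : ℕ) : lieTerm R (k + 1) =
    Submodule.span ℂ {z | ∃ x : R, ∃ y ∈ lieTerm R k, x * y - y * x = z} := by
  rw [lieTerm, LieModule.lowerCentralSeries_succ, LieSubmodule.lieIdeal_oper_eq_linear_span']
  congr 1
  ext z
  simp [lieTerm, LieRing.of_associative_ring_bracket]

end

section

variable (R : Type u) [Ring R] [Algebra ℂ R]

/-- The NC-filtration: `F^d R` is the sum of all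
`R · L_{i_1} · R · ⋯ · R · L_{i_m} · R` with `i_1 + ⋯ + i_m - m = d`. The list `l` consists of the
numbers `i_1 - 1, …, i_m - 1`. -/
def ncFil (d : ℕ) : Submodule ℂ R :=
  ⨆ (l : List ℕ) (_ : l.sum = d), ⊤ * (l.map fun k => lieTerm R k * ⊤).prod

variable {R}

theorem comm_mem_lieTerm_succ (k : ℕ) (x : R) {y : R} (hy : y ∈ lieTerm R k) :
    x * y - y * x ∈ lieTerm R (k + 1) := by
  rw [lieTerm_succ]
  exact Submodule.subset_span ⟨x, y, hy, rfl⟩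

theorem lieTerm_succ_le (k : ℕ) : lieTerm R (k + 1) ≤ lieTerm R k := by
  induction k with
  | zero => exact le_top
  | succ k ih =>
    rw [lieTerm_succ R (k + 1), Submodule.span_le]
    rintro _ ⟨x, y, hy, rfl⟩
    exact comm_mem_lieTerm_succ k x (ih hy)

theorem comm_lieTerm (j k : ℕ) {x y : R} (hx : x ∈ lieTerm R j) (hy : y ∈ lieTerm R k) :
    x * y - y * x ∈ lieTerm R (j + k + 1) := by
  induction j generalizing x y k with
  | zero =>
    rw [Nat.zero_add]
    exact comm_mem_lieTerm_succ k x hy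
  | succ j ih =>
    rw [lieTerm_succ] at hx
    induction hx using Submodule.span_induction with
    | mem z hz =>
      obtain ⟨a, b, hb, rfl⟩ := hz
      have h1 := comm_mem_lieTerm_succ _ a (ih k hb hy)
      have h2 := ih (k + 1) hb (comm_mem_lieTerm_succ k a hy)
      have e : (a * b - b * a) * y - y * (a * b - b * a) =
          (a * (b * y - y * b) - (b * y - y * b) * a)
            - (b * (a * y - y * a) - (a * y - y * a) * b) := by noncomm_ring
      rw [e]
      refine sub_mem ?_ ?_
      · convert h1 using 2; omega
      · convert h2 using 2; omega
    | zero => simp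
    | add a b _ _ ha hb =>
      have e : (a + b) * y - y * (a + b) = (a * y - y * a) + (b * y - y * b) := by noncomm_ring
      rw [e]
      exact add_mem ha hb
    | smul c a _ ha =>
      have e : (c • a) * y - y * (c • a) = c • (a * y - y * a) := by
        rw [smul_mul_assoc, mul_smul_comm, smul_sub]
      rw [e]
      exact Submodule.smul_mem _ _ ha

theorem top_mul_top' : (⊤ : Submodule ℂ R) * ⊤ = ⊤ := by
  refine top_le_iff.1 fun x _ => ?_
  have h := Submodule.mul_mem_mul (Submodule.mem_top (R := ℂ) (x := x))
    (Submodule.mem_top (R := ℂ) (x := (1 : R)))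
  rwa [mul_one] at h

/-- `F` is the smallest multiplicative family of subspaces with `L_{k+1} ≤ F^k`. -/
theorem ncFil_le (N : ℕ → Submodule ℂ R) (hL : ∀ k, lieTerm R k ≤ N k)
    (hN : ∀ i j, N i * N j ≤ N (i + j)) (d : ℕ) : ncFil R d ≤ N d := by
  have h0 : ⊤ ≤ N 0 := hL 0
  have key : ∀ l : List ℕ, (l.map fun k => lieTerm R k * ⊤).prod ≤ N l.sum := by
    intro l
    induction l with
    | nil => exact le_top.trans h0
    | cons k l ih =>
      rw [List.map_cons, List.prod_cons, List.sum_cons]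
      exact (mul_le_mul' ((mul_le_mul' (hL k) h0).trans (hN k 0)) ih).trans
        (hN _ _)
  refine iSup₂_le ?_
  rintro l rfl
  have h := (mul_le_mul' h0 (key l)).trans (hN 0 l.sum)
  rwa [Nat.zero_add] at h

theorem lieTerm_le_ncFil (k : ℕ) : lieTerm R k ≤ ncFil R k := by
  refine le_trans ?_ (le_iSup₂_of_le
    (f := fun (l : List ℕ) (_ : l.sum = k) => ⊤ * (l.map fun k => lieTerm R k * ⊤).prod)
    [k] (by simp) le_rfl)
  intro x hx
  have h := Submodule.mul_mem_mul (Submodule.mem_top (R := ℂ) (x := (1 : R)))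
    (Submodule.mul_mem_mul hx (Submodule.mem_top (R := ℂ) (x := (1 : R))))
  simpa using h

theorem ncFil_zero : ncFil R 0 = ⊤ := top_le_iff.1 (lieTerm_le_ncFil 0)

theorem ncFil_mul_le (i j : ℕ) : ncFil R i * ncFil R j ≤ ncFil R (i + j) := by
  have key : ∀ l : List ℕ, ⊤ * (l.map fun k => lieTerm R k * ⊤).prod * ⊤ =
      ⊤ * (l.map fun k => lieTerm R k * ⊤).prod := by
    intro l
    induction l with
    | nil => simp [top_mul_top']
    | cons k l ih =>
      rw [List.map_cons, List.prod_cons]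
      rw [mul_assoc, mul_assoc, mul_assoc, ← mul_assoc ⊤ _ ⊤, ih]
      simp only [mul_assoc]
  simp only [ncFil, Submodule.iSup_mul, Submodule.mul_iSup]
  refine iSup₂_le fun l hl => iSup₂_le fun l' hl' => ?_
  refine le_iSup₂_of_le (f := fun (l : List ℕ) (_ : l.sum = i + j) =>
    ⊤ * (l.map fun k => lieTerm R k * ⊤).prod) (l' ++ l) (by simp; omega) ?_
  rw [← mul_assoc, key, List.map_append, List.prod_append, ← mul_assoc]

theorem mul_mem_ncFil {i j : ℕ} {x y : R} (hx : x ∈ ncFil R i) (hy : y ∈ ncFil R j) :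
    x * y ∈ ncFil R (i + j) := ncFil_mul_le i j (Submodule.mul_mem_mul hx hy)

theorem ncFil_succ_le (d : ℕ) : ncFil R (d + 1) ≤ ncFil R d := by
  refine (ncFil_le (fun n => ncFil R n ⊓ ncFil R (n - 1)) (fun k => ?_) (fun i j => ?_) _).trans
    inf_le_right
  · refine le_inf (lieTerm_le_ncFil k) ?_
    cases k with
    | zero => exact lieTerm_le_ncFil 0
    | succ k => exact (lieTerm_succ_le k).trans (lieTerm_le_ncFil k)
  · refine Submodule.mul_le.2 fun x hx y hy => ⟨mul_mem_ncFil hx.1 hy.1, ?_⟩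
    cases j with
    | zero =>
      have h := mul_mem_ncFil hx.2 hy.1
      exact h
    | succ j =>
      have h := mul_mem_ncFil hx.1 hy.2
      exact h

theorem ncFil_antitone : Antitone (ncFil R) := antitone_nat_of_succ_le ncFil_succ_le

/-- The elements `x` of `F^a` with `[x, y] ∈ F^{a+b+1}` for all `y` in the given subspaces `G b`. -/
def commSub (G : ℕ → Submodule ℂ R) (a : ℕ) : Submodule ℂ R where
  carrier := {x | x ∈ ncFil R a ∧ ∀ b, ∀ y ∈ G b, x * y - y * x ∈ ncFil R (a + b + 1)}
  zero_mem' := ⟨zero_mem _, fun b y _ => by simp⟩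
  add_mem' := by
    rintro x x' ⟨hx, h⟩ ⟨hx', h'⟩
    refine ⟨add_mem hx hx', fun b y hy => ?_⟩
    have e : (x + x') * y - y * (x + x') = (x * y - y * x) + (x' * y - y * x') := by noncomm_ring
    rw [e]
    exact add_mem (h b y hy) (h' b y hy)
  smul_mem' := by
    rintro c x ⟨hx, h⟩
    refine ⟨Submodule.smul_mem _ _ hx, fun b y hy => ?_⟩
    rw [smul_mul_assoc, mul_smul_comm, ← smul_sub]
    exact Submodule.smul_mem _ _ (h b y hy)

theorem commSub_mul_le (G : ℕ → Submodule ℂ R) (i j : ℕ) :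
    commSub G i * commSub G j ≤ commSub G (i + j) := by
  refine Submodule.mul_le.2 ?_
  rintro x ⟨hx, h⟩ x' ⟨hx', h'⟩
  refine ⟨mul_mem_ncFil hx hx', fun b y hy => ?_⟩
  have e : x * x' * y - y * (x * x') = x * (x' * y - y * x') + (x * y - y * x) * x' := by
    noncomm_ring
  rw [e]
  refine add_mem ?_ ?_
  · have := mul_mem_ncFil hx (h' b y hy)
    convert this using 2; omega
  · have := mul_mem_ncFil (h b y hy) hx'
    convert this using 2; omega

theorem comm_mem_ncFil {i j : ℕ} {x y : R} (hx : x ∈ ncFil R i) (hy : y ∈ ncFil R j) :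
    x * y - y * x ∈ ncFil R (i + j + 1) := by
  have h1 : ∀ a, ncFil R a ≤ commSub (lieTerm R) a :=
    ncFil_le _ (fun k x hx => ⟨lieTerm_le_ncFil k hx,
      fun b y hy => lieTerm_le_ncFil _ (comm_lieTerm k b hx hy)⟩) (commSub_mul_le _)
  have h2 : ∀ a, ncFil R a ≤ commSub (ncFil R) a := by
    refine ncFil_le _ (fun k x hx => ⟨lieTerm_le_ncFil k hx, fun b y hy => ?_⟩) (commSub_mul_le _)
    have h := neg_mem ((h1 b hy).2 k x hx)
    rw [neg_sub] at h
    convert h using 2; omega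
  exact (h2 i hx).2 j y hy

/-- `F^d R` as a (left) ideal; it is two-sided. -/
def ncIdeal (R : Type u) [Ring R] [Algebra ℂ R] (d : ℕ) : Ideal R where
  carrier := ncFil R d
  add_mem' := add_mem
  zero_mem' := zero_mem _
  smul_mem' x y hy := by
    have h := mul_mem_ncFil (i := 0) (x := x) (by rw [ncFil_zero]; trivial) hy
    rwa [Nat.zero_add] at h

instance (d : ℕ) : (ncIdeal R d).IsTwoSided where
  mul_mem_of_left {x} y hx := mul_mem_ncFil (j := 0) (y := y) hx (by rw [ncFil_zero]; trivial)

variable (R)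

/-- The commutativization `R_ab = R / F^1 R`, where `F^1 R` is the two-sided ideal generated by all
commutators. -/
abbrev Rab : Type u := R ⧸ ncIdeal R 1

noncomputable instance : CommRing (Rab R) where
  mul_comm x y := by
    obtain ⟨x, rfl⟩ := Ideal.Quotient.mk_surjective x
    obtain ⟨y, rfl⟩ := Ideal.Quotient.mk_surjective y
    rw [← map_mul, ← map_mul]
    refine Ideal.Quotient.eq.2 (comm_mem_ncFil (i := 0) (j := 0) ?_ ?_) <;>
    · rw [ncFil_zero]; trivial

/-! ## The associated graded Poisson algebra -/

/-- The graded piece `gr^i_F(R) = F^i R / F^{i+1} R`. -/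
def GrPiece (i : ℕ) : Type u := ncFil R i ⧸ (ncFil R (i + 1)).submoduleOf (ncFil R i)

instance (i : ℕ) : AddCommGroup (GrPiece R i) :=
  Submodule.Quotient.addCommGroup ((ncFil R (i + 1)).submoduleOf (ncFil R i))
instance (i : ℕ) : Module ℂ (GrPiece R i) :=
  Submodule.Quotient.module ((ncFil R (i + 1)).submoduleOf (ncFil R i))

/-- The projection `F^i R → gr^i_F(R)`. -/
def GrPiece.mk (i : ℕ) : ncFil R i →ₗ[ℂ] GrPiece R i :=
  ((ncFil R (i + 1)).submoduleOf (ncFil R i)).mkQ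

/-- The associated graded space `gr_F(R) = ⨁ F^i R / F^{i+1} R`. -/
def Gr : Type u := DirectSum ℕ fun i => GrPiece R i

noncomputable instance : AddCommGroup (Gr R) :=
  inferInstanceAs (AddCommGroup (DirectSum ℕ fun i => GrPiece R i))
noncomputable instance : Module ℂ (Gr R) :=
  inferInstanceAs (Module ℂ (DirectSum ℕ fun i => GrPiece R i))

namespace Gr

/-- The inclusion of the graded piece of degree `i`. -/
noncomputable def incl (i : ℕ) : GrPiece R i →ₗ[ℂ] Gr R := DirectSum.lof ℂ ℕ (fun i => GrPiece R i) i

/-- The symbol of degree `i` of an element of `F^i R`. -/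
noncomputable def symb (i : ℕ) : ncFil R i →ₗ[ℂ] Gr R := incl R i ∘ₗ GrPiece.mk R i

variable {R}

theorem symb_congr {i j : ℕ} (h : i = j) {x y : R} (hx : x ∈ ncFil R i) (hy : y ∈ ncFil R j)
    (e : x = y) : symb R i ⟨x, hx⟩ = symb R j ⟨y, hy⟩ := by
  subst h; subst e; rfl

theorem symb_eq_zero {i : ℕ} {x : ncFil R i} (h : (x : R) ∈ ncFil R (i + 1)) : symb R i x = 0 := by
  have : GrPiece.mk R i x = 0 := (Submodule.Quotient.mk_eq_zero _).2 h
  exact (congrArg (incl R i) this).trans (map_zero _)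

@[elab_as_elim]
theorem induct {p : Gr R → Prop} (x : Gr R)
    (h : ∀ i (x : R) (hx : x ∈ ncFil R i), p (symb R i ⟨x, hx⟩))
    (hadd : ∀ x y, p x → p y → p (x + y)) : p x := by
  refine DirectSum.induction_on (motive := p) x ?_ ?_ hadd
  · have := h 0 0 (zero_mem _)
    rwa [show (⟨0, zero_mem _⟩ : ncFil R 0) = 0 from rfl, map_zero] at this
  · intro i y
    obtain ⟨⟨y, hy⟩, rfl⟩ : ∃ z, GrPiece.mk R i z = y := Submodule.Quotient.mk_surjective _ y
    exact h i y hy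

/-- Descend a bilinear map in its second argument from the `F^j R` to `gr_F(R)`. -/
noncomputable def liftRight {N : Type u} [AddCommGroup N] [Module ℂ N]
    (B : ∀ j, N →ₗ[ℂ] ncFil R j →ₗ[ℂ] Gr R)
    (h : ∀ j (x : N) (y : ncFil R j), (y : R) ∈ ncFil R (j + 1) → B j x y = 0) :
    N →ₗ[ℂ] Gr R →ₗ[ℂ] Gr R :=
  LinearMap.flip (DirectSum.toModule ℂ ℕ (N →ₗ[ℂ] Gr R) fun j =>
    Submodule.liftQ ((ncFil R (j + 1)).submoduleOf (ncFil R j)) (B j).flip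
      (fun y hy => LinearMap.ext fun x => h j x y hy) :
    (DirectSum ℕ fun i => GrPiece R i) →ₗ[ℂ] N →ₗ[ℂ] Gr R)

theorem liftRight_symb {N : Type u} [AddCommGroup N] [Module ℂ N]
    (B : ∀ j, N →ₗ[ℂ] ncFil R j →ₗ[ℂ] Gr R) (h) (j : ℕ) (x : N) (y : ncFil R j) :
    liftRight B h x (symb R j y) = B j x y := by
  have e := DirectSum.toModule_lof ℂ (ι := ℕ) (M := fun i => GrPiece R i) (N := N →ₗ[ℂ] Gr R)
    (φ := fun j => Submodule.liftQ ((ncFil R (j + 1)).submoduleOf (ncFil R j)) (B j).flip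
      (fun y hy => LinearMap.ext fun x => h j x y hy)) j (GrPiece.mk R j y)
  exact congrArg (fun f : N →ₗ[ℂ] Gr R => f x) e

/-- The bilinear operation on `gr_F(R)` which is induced by operations `B i j` on representatives
of homogeneous elements. -/
noncomputable def lift₂ (B : ∀ i j, ncFil R i →ₗ[ℂ] ncFil R j →ₗ[ℂ] Gr R)
    (h₁ : ∀ i j (x : ncFil R i) (y : ncFil R j), (x : R) ∈ ncFil R (i + 1) → B i j x y = 0)
    (h₂ : ∀ i j (x : ncFil R i) (y : ncFil R j), (y : R) ∈ ncFil R (j + 1) → B i j x y = 0) :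
    Gr R →ₗ[ℂ] Gr R →ₗ[ℂ] Gr R :=
  LinearMap.flip (liftRight (N := Gr R)
    (fun i => (liftRight (fun j => B i j) (h₂ i)).flip)
    (fun i z x hx => by
      rw [LinearMap.flip_apply]
      refine induct z (fun j y hy => ?_) (fun y z hy hz => by rw [map_add, hy, hz, add_zero])
      rw [liftRight_symb]
      exact h₁ i j x _ hx))

theorem lift₂_symb (B : ∀ i j, ncFil R i →ₗ[ℂ] ncFil R j →ₗ[ℂ] Gr R) (h₁) (h₂) (i j : ℕ)
    (x : ncFil R i) (y : ncFil R j) : lift₂ B h₁ h₂ (symb R i x) (symb R j y) = B i j x y := by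
  rw [lift₂, LinearMap.flip_apply, liftRight_symb, LinearMap.flip_apply, liftRight_symb]

/-- Multiplication: the product of the symbols of `x ∈ F^i` and `y ∈ F^j` is the symbol of `x * y`
in degree `i + j`. -/
noncomputable def mulMap : Gr R →ₗ[ℂ] Gr R →ₗ[ℂ] Gr R :=
  lift₂
    (fun i j => LinearMap.mk₂ ℂ (fun x y => symb R (i + j) ⟨x * y, mul_mem_ncFil x.2 y.2⟩)
      (fun x x' y => by rw [← map_add]; exact symb_congr rfl _ _ (add_mul _ _ _))
      (fun c x y => by rw [← map_smul]; exact symb_congr rfl _ _ (smul_mul_assoc _ _ _))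
      (fun x y y' => by rw [← map_add]; exact symb_congr rfl _ _ (mul_add _ _ _))
      (fun c x y => by rw [← map_smul]; exact symb_congr rfl _ _ (mul_smul_comm _ _ _)))
    (fun i j x y hx => symb_eq_zero (by
      exact ncFil_antitone (by omega) (mul_mem_ncFil hx y.2)))
    (fun i j x y hy => symb_eq_zero (by
      exact ncFil_antitone (by omega) (mul_mem_ncFil x.2 hy)))

/-- The bracket: the bracket of the symbols of `x ∈ F^i` and `y ∈ F^j` is the symbol of
`x * y - y * x` in degree `i + j + 1`. -/
noncomputable def bracketMap : Gr R →ₗ[ℂ] Gr R →ₗ[ℂ] Gr R :=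
  lift₂
    (fun i j => LinearMap.mk₂ ℂ
      (fun x y => symb R (i + j + 1) ⟨x * y - y * x, comm_mem_ncFil x.2 y.2⟩)
      (fun x x' y => by
        rw [← map_add]
        refine symb_congr rfl _ _ ?_
        simp only [Submodule.coe_add]
        noncomm_ring)
      (fun c x y => by
        rw [← map_smul]
        refine symb_congr rfl _ _ ?_
        simp only [Submodule.coe_smul]
        rw [smul_mul_assoc, mul_smul_comm, smul_sub])
      (fun x y y' => by
        rw [← map_add]
        refine symb_congr rfl _ _ ?_
        simp only [Submodule.coe_add]
        noncomm_ring)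
      (fun c x y => by
        rw [← map_smul]
        refine symb_congr rfl _ _ ?_
        simp only [Submodule.coe_smul]
        rw [smul_mul_assoc, mul_smul_comm, smul_sub]))
    (fun i j x y hx => symb_eq_zero (by
      exact ncFil_antitone (by omega) (comm_mem_ncFil hx y.2)))
    (fun i j x y hy => symb_eq_zero (by
      exact ncFil_antitone (by omega) (comm_mem_ncFil x.2 hy)))

noncomputable instance : Mul (Gr R) := ⟨fun x y => mulMap x y⟩
noncomputable instance : One (Gr R) := ⟨symb R 0 ⟨1, by rw [ncFil_zero]; trivial⟩⟩

theorem symb_mul (i j : ℕ) {x y : R} (hx : x ∈ ncFil R i) (hy : y ∈ ncFil R j) :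
    symb R i ⟨x, hx⟩ * symb R j ⟨y, hy⟩ = symb R (i + j) ⟨x * y, mul_mem_ncFil hx hy⟩ :=
  lift₂_symb _ _ _ i j _ _

theorem bracket_symb (i j : ℕ) {x y : R} (hx : x ∈ ncFil R i) (hy : y ∈ ncFil R j) :
    bracketMap (symb R i ⟨x, hx⟩) (symb R j ⟨y, hy⟩) =
      symb R (i + j + 1) ⟨x * y - y * x, comm_mem_ncFil hx hy⟩ :=
  lift₂_symb _ _ _ i j _ _

protected theorem add_mul' (x y z : Gr R) : (x + y) * z = x * z + y * z :=
  LinearMap.map_add₂ mulMap x y z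
protected theorem mul_add' (x y z : Gr R) : x * (y + z) = x * y + x * z := map_add (mulMap x) y z

protected theorem mul_comm' (x y : Gr R) : x * y = y * x := by
  refine induct x (fun i x hx => ?_) (fun x x' h h' => by rw [Gr.add_mul', Gr.mul_add', h, h'])
  refine induct y (fun j y hy => ?_) (fun x x' h h' => by rw [Gr.add_mul', Gr.mul_add', h, h'])
  rw [symb_mul, symb_mul, symb_congr (Nat.add_comm j i) _
    (by rw [Nat.add_comm]; exact mul_mem_ncFil hy hx) rfl, ← sub_eq_zero, ← map_sub]
  exact symb_eq_zero (comm_mem_ncFil hx hy)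

protected theorem mul_assoc' (x y z : Gr R) : x * y * z = x * (y * z) := by
  refine induct x (fun i x hx => ?_) (fun x x' h h' => by simp only [Gr.add_mul', h, h'])
  refine induct y (fun j y hy => ?_)
    (fun x x' h h' => by simp only [Gr.add_mul', Gr.mul_add', h, h'])
  refine induct z (fun k z hz => ?_) (fun x x' h h' => by simp only [Gr.mul_add', h, h'])
  simp only [symb_mul]
  exact symb_congr (Nat.add_assoc _ _ _) _ _ (mul_assoc _ _ _)

protected theorem one_mul' (x : Gr R) : 1 * x = x := by
  refine induct x (fun i x hx => ?_) (fun x x' h h' => by rw [Gr.mul_add', h, h'])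
  exact (symb_mul _ _ _ _).trans (symb_congr (Nat.zero_add i) _ _ (one_mul x))

noncomputable instance : CommRing (Gr R) where
  zero_mul x := LinearMap.map_zero₂ mulMap x
  mul_zero x := map_zero (mulMap x)
  left_distrib := Gr.mul_add'
  right_distrib := Gr.add_mul'
  mul_assoc := Gr.mul_assoc'
  mul_comm := Gr.mul_comm'
  one_mul := Gr.one_mul'
  mul_one x := (Gr.mul_comm' x 1).trans (Gr.one_mul' x)
  neg_add_cancel := neg_add_cancel
  sub_eq_add_neg := sub_eq_add_neg
  zsmul := fun n x => n • x
  zsmul_zero' := zero_zsmul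
  zsmul_succ' := SubNegMonoid.zsmul_succ'
  zsmul_neg' := SubNegMonoid.zsmul_neg'

noncomputable instance : Algebra ℂ (Gr R) :=
  Algebra.ofModule (fun c x y => LinearMap.map_smul₂ mulMap c x y)
    (fun c x y => map_smul (mulMap x) c y)

noncomputable instance : PoissonAlgebra (Gr R) where
  bracket := bracketMap
  antisymm x y := by
    refine induct x (fun i x hx => ?_)
      (fun x x' h h' => by simp only [map_add, LinearMap.add_apply, h, h', neg_add])
    refine induct y (fun j y hy => ?_)
      (fun x x' h h' => by simp only [map_add, LinearMap.add_apply, h, h', neg_add])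
    rw [bracket_symb, bracket_symb, ← map_neg]
    exact symb_congr (by omega) _ _ (by simp)
  jacobi x y z := by
    refine induct x (fun i x hx => ?_) (fun x x' h h' => by
      simp only [map_add, LinearMap.add_apply]
      rw [← add_zero (0 : Gr R)]
      nth_rw 1 [← h]
      rw [← h']
      abel)
    refine induct y (fun j y hy => ?_) (fun x x' h h' => by
      simp only [map_add, LinearMap.add_apply]
      rw [← add_zero (0 : Gr R)]
      nth_rw 1 [← h]
      rw [← h']
      abel)
    refine induct z (fun k z hz => ?_) (fun x x' h h' => by
      simp only [map_add, LinearMap.add_apply]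
      rw [← add_zero (0 : Gr R)]
      nth_rw 1 [← h]
      rw [← h']
      abel)
    simp only [bracket_symb]
    have hm : ∀ {n : ℕ} {w : R}, n = i + j + k + 2 → w ∈ ncFil R n → w ∈ ncFil R (i + j + k + 2) := by
      rintro n w rfl h
      exact h
    rw [symb_congr (j := i + j + k + 2) (by omega) _ (hm (by omega)
        (comm_mem_ncFil hx (comm_mem_ncFil hy hz))) rfl,
      symb_congr (j := i + j + k + 2) (by omega) _ (hm (by omega)
        (comm_mem_ncFil hy (comm_mem_ncFil hz hx))) rfl,
      symb_congr (j := i + j + k + 2) (by omega) _ (hm (by omega)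
        (comm_mem_ncFil hz (comm_mem_ncFil hx hy))) rfl,
      ← map_add, ← map_add, ← map_zero (symb R (i + j + k + 2))]
    refine symb_congr rfl _ _ ?_
    simp only [Submodule.coe_add]
    noncomm_ring
  leibniz x y z := by
    refine induct x (fun i x hx => ?_) (fun x x' h h' => by
      simp only [map_add, LinearMap.add_apply, h, h']
      ring)
    refine induct y (fun j y hy => ?_) (fun x x' h h' => by
      simp only [map_add, add_mul, h, h']
      ring)
    refine induct z (fun k z hz => ?_) (fun x x' h h' => by
      simp only [map_add, mul_add, h, h']
      ring)
    simp only [bracket_symb, symb_mul]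
    have hm : ∀ {n : ℕ} {w : R}, n = i + j + k + 1 → w ∈ ncFil R n → w ∈ ncFil R (i + j + k + 1) := by
      rintro n w rfl h
      exact h
    rw [symb_congr (j := i + j + k + 1) (by omega) _ (hm (by omega)
        (comm_mem_ncFil hx (mul_mem_ncFil hy hz))) rfl,
      symb_congr (j := i + j + k + 1) (by omega) _ (hm (by omega)
        (mul_mem_ncFil (comm_mem_ncFil hx hy) hz)) rfl,
      symb_congr (j := i + j + k + 1) (by omega) _ (hm (by omega)
        (mul_mem_ncFil hy (comm_mem_ncFil hx hz))) rfl,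
      ← map_add]
    refine symb_congr rfl _ _ ?_
    simp only
    noncomm_ring

variable (R)

/-- The map `R → gr_F(R)` sending `r` to its symbol in degree `0`. -/
noncomputable def ofR : R →ₐ[ℂ] Gr R :=
  AlgHom.ofLinearMap (symb R 0 ∘ₗ LinearMap.codRestrict (ncFil R 0) LinearMap.id
      (fun x => by rw [ncFil_zero]; trivial)) rfl
    (fun x y => (symb_mul 0 0 _ _).symm)

/-- The canonical homomorphism `R_ab = gr^0_F(R) → gr_F(R)`, `r mod F^1 ↦` the symbol of `r` in
degree `0`. -/
noncomputable def ofRab : Rab R →ₐ[ℂ] Gr R :=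
  Ideal.Quotient.liftₐ (ncIdeal R 1) (ofR R) (fun _ ha => symb_eq_zero ha)

/-- `gr_F(R)` as an algebra over `R_ab = gr^0_F(R)`. -/
noncomputable instance : Algebra (Rab R) (Gr R) := (ofRab R).toRingHom.toAlgebra

/-- The graded component `gr^i_F(R)` of `gr_F(R)`, as an `R_ab`-submodule. -/
noncomputable def deg (i : ℕ) : Submodule (Rab R) (Gr R) where
  carrier := Set.range (incl R i)
  zero_mem' := ⟨0, map_zero _⟩
  add_mem' := by
    rintro _ _ ⟨x, rfl⟩ ⟨y, rfl⟩
    exact ⟨x + y, map_add _ _ _⟩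
  smul_mem' := by
    rintro a _ ⟨x, rfl⟩
    obtain ⟨a, rfl⟩ := Ideal.Quotient.mk_surjective a
    obtain ⟨⟨x, hx⟩, rfl⟩ : ∃ z, GrPiece.mk R i z = x := Submodule.Quotient.mk_surjective _ x
    have h0 : a ∈ ncFil R 0 := by rw [ncFil_zero]; trivial
    have hax : a * x ∈ ncFil R i := by
      have h := mul_mem_ncFil h0 hx
      rwa [Nat.zero_add] at h
    refine ⟨GrPiece.mk R i ⟨a * x, hax⟩, ?_⟩
    exact ((symb_mul 0 i h0 hx).trans (symb_congr (Nat.zero_add i) _ hax rfl)).symm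

end Gr

end

/-! ## `d`-smooth algebras -/

/-- `R` is NC-nilpotent of degree `d`, i.e. an object of the category `N_d`: `F^{d+1} R = 0`. -/
def IsNCNilpotent (d : ℕ) (R : Type u) [Ring R] [Algebra ℂ R] : Prop := ncFil R (d + 1) = ⊥

/-- `R` is `d`-smooth: it is a finitely generated algebra in `N_d`, and the functor
`Hom(R, -)` on `N_d` is formally smooth, i.e. takes each surjection in `N_d` whose kernel is a
nilpotent ideal to a surjection. -/
structure IsDSmooth (d : ℕ) (R : Type u) [Ring R] [Algebra ℂ R] : Prop where
  finiteType : Algebra.FiniteType ℂ R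
  ncNilpotent : IsNCNilpotent d R
  formallySmooth : ∀ (S T : Type u) [Ring S] [Algebra ℂ S] [Ring T] [Algebra ℂ T],
    IsNCNilpotent d S → IsNCNilpotent d T → ∀ p : S →ₐ[ℂ] T, Function.Surjective p →
    IsNilpotent (LinearMap.ker p.toLinearMap : Submodule ℂ S) →
    ∀ f : R →ₐ[ℂ] T, ∃ g : R →ₐ[ℂ] S, p.comp g = f

/-! ## The functors `Q^d_A` -/

section

variable (A M : Type u) [CommRing A] [AddCommGroup M] [Module A M]

/-- The ideal of linear relations in the free Lie algebra on the set `M`. -/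
noncomputable def freeLieRel : LieIdeal A (FreeLieAlgebra A M) :=
  LieSubmodule.lieSpan A (FreeLieAlgebra A M)
    ({z | ∃ m n : M, FreeLieAlgebra.of A (m + n) - (FreeLieAlgebra.of A m + FreeLieAlgebra.of A n)
        = z} ∪
     {z | ∃ (a : A) (m : M), FreeLieAlgebra.of A (a • m) - a • FreeLieAlgebra.of A m = z})

/-- The free Lie algebra `Lie_A(M)` over `A` generated by the `A`-module `M`. -/
abbrev FreeLie : Type u := FreeLieAlgebra A M ⧸ freeLieRel A M

/-- The class of a generator `m ∈ M`. -/
noncomputable def FreeLie.of (m : M) : FreeLie A M := LieSubmodule.Quotient.mk (FreeLieAlgebra.of A m)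

/-- The component of degree `k + 1` of `Lie_A(M)`: the span of the brackets
`[m_0, [m_1, …, [m_{k-1}, m_k]…]]` with all `m_j` in `M`. -/
noncomputable def FreeLie.deg : ℕ → Submodule A (FreeLie A M)
  | 0 => Submodule.span A {z | ∃ m : M, FreeLie.of A M m = z}
  | k + 1 => Submodule.span A {z | ∃ m : M, ∃ y ∈ FreeLie.deg k, ⁅FreeLie.of A M m, y⁆ = z}

/-- `Lie_+(M)`, the direct sum of the components of degrees `≥ 2` of `Lie_A(M)`; the summand with
index `k` is the component of degree `k + 2`, and it is given the new degree `k + 1`. -/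
abbrev LiePlus : Type u := DirectSum ℕ fun k => FreeLie.deg A M (k + 1)

/-- The summand of `Lie_+(M)` with index `k`, inside the symmetric algebra of `Lie_+(M)`. -/
noncomputable def symGen (k : ℕ) : Submodule A (SymmetricAlgebra A (LiePlus A M)) :=
  LinearMap.range (SymmetricAlgebra.ι A (LiePlus A M) ∘ₗ
    DirectSum.lof A ℕ (fun k => FreeLie.deg A M (k + 1)) k)

/-- `Q^d_A(M)`, the homogeneous part of degree `d` of the symmetric algebra of `Lie_+(M)`: the span
of the products of homogeneous elements of `Lie_+(M)` whose degrees add up to `d`. -/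
noncomputable def Q (d : ℕ) : Submodule A (SymmetricAlgebra A (LiePlus A M)) :=
  ⨆ (l : List ℕ) (_ : (l.map fun k => k + 1).sum = d), (l.map fun k => symGen A M k).prod

end

end NCGeom

/-! Write `A = R_ab` and `Ω = Ω¹_A`. The map `A = gr^0 → gr_F(R)` extends to `envHom : P(A) →
gr_F(R)`. It sends `P^i(A)` onto `gr^i`, because `F` is the smallest multiplicative family
containing the Lie terms (`exists_envHom_eq`), and it kills `P^{≥ d+1}` because `F^{d+1} R = 0`.
Uniqueness holds since `A` generates `P(A)`. What remains is injectivity on `P^i` for `i ≤ d`.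

Tested on commutative algebras, `d`-smoothness makes `A` formally smooth, so `Ω` is projective and
`a ⊗ b ↦ a db` has an `A`-linear section `σ`. The bracket of `P(A)` is not `A`-bilinear, but that of
`A ⊗_ℂ P(A)` is, so `σ` induces a Lie homomorphism `Lie_A(Ω) → A ⊗ P(A)`. Contracting to `P(A)` and
extending multiplicatively gives `symToEnv : Sym(Lie_+(Ω)) → P(A)`. By Leibniz and Jacobi, every
element of `P^i` is, up to products of elements of positive degree, an `A`-combination of
right-normed words in `A`; hence every element of `P^i` comes from `Q^i` (`exists_symToEnv_eq`). So
both assertions follow once the composite `Q^i → gr^i` is injective.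

For this, `d`-smoothness is used again to lift `a ↦ a + da` to a homomorphism from `R` to the
truncation of `T_A(Ω)` by weight `≥ n` and by `F^{d+1}` (`IsDSmooth.exists_jet`). Constants are
central in `T_A(Ω)`, so a product of `s` Lie elements of total degree `i` has a representative in
`F^i R` whose image starts in weight `i + s` with the corresponding product of Lie elements of
`T_A(Ω)`. If the class in `gr^i` vanishes, that image lies in `F^{i+1}`, whose part of weight `i +
s` comes from products of fewer than `s` Lie elements.

The two are separated without a basis and without a PBW theorem: `T_A(Ω)` acts on `Sym(Lie_A(Ω) ⊕ A
ξ)` with `Ω` acting by derivations. Fewer than `s` Lie elements send `ξ^s` into the ideal of `ξ`,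
while exactly `s` of them give `s!` times the product of the `u_j · ξ` modulo `ξ`, and `u · ξ = (deg
u) u` by Dynkin–Specht–Wever (`opSymbol_eq_zero`, `opSymbol_genPair`). Integers being invertible,
this recovers the part of `q ∈ Q^i` with exactly `s` factors modulo products of more factors.
Starting at `s = 0` and using that there are at most `i` factors, one gets `q = 0`. -/

namespace NCGeom

/-! ### Identities in Poisson algebras -/

section Poisson

variable {P : Type u} [CommRing P] [Algebra ℂ P] [PoissonAlgebra P]

theorem pb_add (x y z : P) : pb x (y + z) = pb x y + pb x z := map_add _ _ _

theorem add_pb (x y z : P) : pb (x + y) z = pb x z + pb y z := LinearMap.map_add₂ _ _ _ _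

theorem pb_smul (c : ℂ) (x y : P) : pb x (c • y) = c • pb x y := map_smul _ _ _

theorem pb_antisymm (x y : P) : pb x y = -pb y x := PoissonAlgebra.antisymm x y

theorem pb_mul (x y z : P) : pb x (y * z) = pb x y * z + y * pb x z :=
  PoissonAlgebra.leibniz x y z

theorem mul_pb (x y z : P) : pb (x * y) z = x * pb y z + pb x z * y := by
  rw [pb_antisymm, pb_mul, pb_antisymm z x, pb_antisymm z y]
  ring

theorem pb_self (x : P) : pb x x = 0 := by
  have h : (2 : ℂ) • pb x x = 0 := by
    rw [two_smul]
    nth_rw 1 [pb_antisymm]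
    exact neg_add_cancel _
  exact (smul_eq_zero.1 h).resolve_left two_ne_zero

theorem pb_leibniz_lie (x y z : P) : pb x (pb y z) = pb (pb x y) z + pb y (pb x z) := by
  have h : pb x (pb y z) + pb y (pb z x) + pb z (pb x y) = 0 := PoissonAlgebra.jacobi x y z
  have e : pb y (pb z x) = -pb y (pb x z) := by
    rw [pb_antisymm z x]
    exact map_neg (PoissonAlgebra.bracket y) _
  rw [e, pb_antisymm z] at h
  linear_combination h

end Poisson

/-! ### The universal property of the Poisson envelope -/

namespace Env

variable {A : Type u} [CommRing A] [Algebra ℂ A]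

section Lift

variable {P : Type u} [CommRing P] [Algebra ℂ P] [PoissonAlgebra P] (f : A →ₐ[ℂ] P)

/-- The value of a formal expression in a Poisson algebra. -/
def interpret : EnvTerm A → P
  | .of a => f a
  | .add x y => interpret x + interpret y
  | .mul x y => interpret x * interpret y
  | .bracket x y => pb (interpret x) (interpret y)

theorem interpret_eq {s t : EnvTerm A} (h : EnvRel A s t) : interpret f s = interpret f t := by
  induction h with
  | of_add a b => simp [interpret]
  | of_mul a b => simp [interpret]
  | add_assoc x y z => simp [interpret, add_assoc]
  | add_comm x y => simp [interpret, add_comm]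
  | zero_add x => simp [interpret]
  | zero_mul x => simp [interpret]
  | one_mul x => simp [interpret]
  | mul_assoc x y z => simp [interpret, mul_assoc]
  | mul_comm x y => simp [interpret, mul_comm]
  | add_mul x y z => simp [interpret, add_mul]
  | bracket_add x y z => simp [interpret, pb_add]
  | bracket_smul c x y => simp [interpret, ← Algebra.smul_def, pb_smul]
  | antisymm x y => simpa [interpret] using pb_antisymm _ _
  | jacobi x y z =>
    rw [show interpret f (.of (0 : A)) = 0 from map_zero f]
    exact PoissonAlgebra.jacobi _ _ _
  | leibniz x y z => simp [interpret, pb_mul]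
  | add_left y _ ih => simp [interpret, ih]
  | add_right x _ ih => simp [interpret, ih]
  | mul_left y _ ih => simp [interpret, ih]
  | mul_right x _ ih => simp [interpret, ih]
  | bracket_left y _ ih => simp [interpret, ih]
  | bracket_right x _ ih => simp [interpret, ih]

/-- The homomorphism of Poisson algebras `P(A) → P` which extends `f : A → P`. -/
def lift : Env A →ₐ[ℂ] P where
  toFun := Quot.lift (interpret f) fun _ _ h => interpret_eq f h
  map_one' := map_one f
  map_zero' := map_zero f
  map_mul' x y := by
    induction x using Quot.ind; induction y using Quot.ind
    rfl
  map_add' x y := by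
    induction x using Quot.ind; induction y using Quot.ind
    rfl
  commutes' c := f.commutes c

theorem lift_pb (x y : Env A) : lift f (pb x y) = pb (lift f x) (lift f y) := by
  induction x using Quot.ind; induction y using Quot.ind
  rfl

/-- Two maps on `P(A)` which respect the operations and agree on `A` are equal. -/
theorem hom_ext {P : Type u} [CommRing P] [Algebra ℂ P] [PoissonAlgebra P] {g h : Env A →ₐ[ℂ] P}
    (hg : ∀ x y, g (pb x y) = pb (g x) (g y)) (hh : ∀ x y, h (pb x y) = pb (h x) (h y))
    (e : ∀ a, g (ι A a) = h (ι A a)) (x : Env A) : g x = h x := by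
  obtain ⟨t, rfl⟩ : ∃ t, mk t = x := Quot.exists_rep x
  induction t with
  | of a => exact e a
  | add x y hx hy =>
    change g (mk x + mk y) = h (mk x + mk y)
    rw [map_add, map_add, hx, hy]
  | mul x y hx hy =>
    change g (mk x * mk y) = h (mk x * mk y)
    rw [map_mul, map_mul, hx, hy]
  | bracket x y hx hy =>
    change g (pb (mk x) (mk y)) = h (pb (mk x) (mk y))
    rw [hg, hh, hx, hy]

end Lift

/-! ### Generation of the Poisson envelope by Lie words, modulo decomposable elements -/

theorem mul_mem_deg {i j : ℕ} {x y : Env A} (hx : x ∈ deg A i) (hy : y ∈ deg A j) :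
    x * y ∈ deg A (i + j) :=
  bilin_span (LinearMap.mul ℂ (Env A)) (fun _ hs _ ht => Submodule.subset_span (hs.mul ht)) hx hy

theorem pb_mem_deg {i j : ℕ} {x y : Env A} (hx : x ∈ deg A i) (hy : y ∈ deg A j) :
    pb x y ∈ deg A (i + j + 1) :=
  bilin_span PoissonAlgebra.bracket (fun _ hs _ ht => Submodule.subset_span (hs.pb ht)) hx hy

theorem mul_mem_deg_of_eq {i j k : ℕ} (h : i + j = k) {x y : Env A} (hx : x ∈ deg A i)
    (hy : y ∈ deg A j) : x * y ∈ deg A k := h ▸ mul_mem_deg hx hy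

theorem pb_mem_deg_of_eq {i j k : ℕ} (h : i + j + 1 = k) {x y : Env A} (hx : x ∈ deg A i)
    (hy : y ∈ deg A j) : pb x y ∈ deg A k := h ▸ pb_mem_deg hx hy

theorem ι_mem_deg (a : A) : ι A a ∈ deg A 0 := Submodule.subset_span (.of a)

theorem ι_mul_mem_deg {i : ℕ} (a : A) {x : Env A} (hx : x ∈ deg A i) : ι A a * x ∈ deg A i := by
  simpa using mul_mem_deg (ι_mem_deg a) hx

theorem IsExpr.exists_eq_ι {x : Env A} (hx : IsExpr 0 x) : ∃ a, ι A a = x := by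
  -- The degree must be a variable for the induction. A bracket adds `1` to it, so that case cannot
  -- occur.
  obtain ⟨n, hn⟩ : ∃ n, n = 0 := ⟨0, rfl⟩
  rw [← hn] at hx
  induction hx with
  | of a => exact ⟨a, rfl⟩
  | mul hx hy ihx ihy =>
    obtain ⟨a, rfl⟩ := ihx (by omega)
    obtain ⟨b, rfl⟩ := ihy (by omega)
    exact ⟨a * b, map_mul _ _ _⟩
  | pb hx hy => omega

/-- The decomposable elements of degree `k`: sums of products of two elements of positive
degrees. -/
def dec (A : Type u) [CommRing A] [Algebra ℂ A] (k : ℕ) : Submodule ℂ (Env A) :=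
  Submodule.span ℂ {z | ∃ i j, i + 1 + (j + 1) = k ∧ ∃ x ∈ deg A (i + 1), ∃ y ∈ deg A (j + 1),
    x * y = z}

theorem mul_mem_dec {i j k : ℕ} (h : i + 1 + (j + 1) = k) {x y : Env A} (hx : x ∈ deg A (i + 1))
    (hy : y ∈ deg A (j + 1)) : x * y ∈ dec A k :=
  Submodule.subset_span ⟨i, j, h, x, hx, y, hy, rfl⟩

theorem dec_le_deg (k : ℕ) : dec A k ≤ deg A k := by
  refine Submodule.span_le.2 ?_
  rintro _ ⟨i, j, rfl, x, hx, y, hy, rfl⟩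
  exact mul_mem_deg hx hy

theorem ι_mul_mem_dec {k : ℕ} (a : A) {x : Env A} (hx : x ∈ dec A k) : ι A a * x ∈ dec A k := by
  induction hx using Submodule.span_induction with
  | mem x hx =>
    obtain ⟨i, j, h, x, hx, y, hy, rfl⟩ := hx
    rw [← mul_assoc]
    exact mul_mem_dec h (ι_mul_mem_deg a hx) hy
  | zero => simp
  | add x y _ _ hx hy => rw [mul_add]; exact add_mem hx hy
  | smul c x _ hx => rw [mul_smul_comm]; exact Submodule.smul_mem _ _ hx

/-- By the Leibniz rule the bracket acts on one factor at a time, and both factors keep positive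
degree. -/
theorem pb_dec_mem {i j : ℕ} {x y : Env A} (hx : x ∈ deg A i) (hy : y ∈ dec A j) :
    pb x y ∈ dec A (i + j + 1) := by
  induction hy using Submodule.span_induction with
  | mem y hy =>
    obtain ⟨k, l, rfl, y, hy, z, hz, rfl⟩ := hy
    rw [pb_mul]
    refine add_mem (mul_mem_dec (i := i + k + 1) (j := l) (by omega)
      (pb_mem_deg_of_eq (by omega) hx hy) hz)
      (mul_mem_dec (i := k) (j := i + l + 1) (by omega) hy (pb_mem_deg_of_eq (by omega) hx hz))
  | zero => rw [pb, map_zero]; exact zero_mem _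
  | add y z _ _ hy hz => rw [pb_add]; exact add_mem hy hz
  | smul c y _ hy => rw [pb_smul]; exact Submodule.smul_mem _ _ hy

theorem dec_pb_mem {i j : ℕ} {x y : Env A} (hx : x ∈ dec A i) (hy : y ∈ deg A j) :
    pb x y ∈ dec A (i + j + 1) := by
  rw [pb_antisymm, add_comm i]
  exact neg_mem (pb_dec_mem hy hx)

/-- Right-normed Lie words `{a_0, {a_1, …, {a_{k-1}, a_k}…}}` in the elements of `A`. -/
inductive IsWord : ℕ → Env A → Prop
  | of (a : A) : IsWord 0 (ι A a)
  | pb {k : ℕ} (a : A) {x : Env A} (hx : IsWord k x) : IsWord (k + 1) (pb (ι A a) x)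

theorem IsWord.mem_deg {k : ℕ} {x : Env A} (hx : IsWord k x) : x ∈ deg A k := by
  induction hx with
  | of a => exact ι_mem_deg a
  | pb a _ ih => simpa using pb_mem_deg (ι_mem_deg a) ih

/-- Jacobi, `{{a, x}, y} = {a, {x, y}} - {x, {a, y}}`, unwinds the left word letter by letter into
brackets with single elements of `A`. -/
theorem IsWord.pb_mem_span {i j : ℕ} {x y : Env A} (hx : IsWord i x)
    (hy : y ∈ Submodule.span ℂ {y : Env A | IsWord j y}) :
    NCGeom.pb x y ∈ Submodule.span ℂ {y : Env A | IsWord (i + j + 1) y} := by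
  have key : ∀ (a : A) (k : ℕ) (z : Env A), z ∈ Submodule.span ℂ {y : Env A | IsWord k y} →
      NCGeom.pb (ι A a) z ∈ Submodule.span ℂ {y : Env A | IsWord (k + 1) y} := by
    intro a k z hz
    have h : Submodule.span ℂ {y : Env A | IsWord k y} ≤
        (Submodule.span ℂ {y : Env A | IsWord (k + 1) y}).comap
          (PoissonAlgebra.bracket (ι A a)) :=
      Submodule.span_le.2 fun w hw => Submodule.subset_span (IsWord.pb a hw)
    exact h hz
  induction hx generalizing j y with
  | of a => simpa using key a j y hy
  | @pb i a x hx ih =>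
    have e : NCGeom.pb (NCGeom.pb (ι A a) x) y =
        NCGeom.pb (ι A a) (NCGeom.pb x y) - NCGeom.pb x (NCGeom.pb (ι A a) y) := by
      rw [pb_leibniz_lie (ι A a)]
      ring
    rw [e]
    refine sub_mem ?_ ?_
    · rw [show i + 1 + j + 1 = i + j + 1 + 1 by omega]
      exact key a _ _ (ih hy)
    · rw [show i + 1 + j + 1 = i + (j + 1) + 1 by omega]
      exact ih (key a _ _ hy)

/-- The span of the `A`-multiples of Lie words and of the decomposable elements. -/
def wordDec (A : Type u) [CommRing A] [Algebra ℂ A] (k : ℕ) : Submodule ℂ (Env A) :=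
  Submodule.span ℂ {z | ∃ (a : A) (w : Env A), IsWord k w ∧ ι A a * w = z} ⊔ dec A k

theorem ι_mul_word_mem {k : ℕ} (a : A) {w : Env A}
    (hw : w ∈ Submodule.span ℂ {y : Env A | IsWord k y}) : ι A a * w ∈ wordDec A k := by
  have h : Submodule.span ℂ {y : Env A | IsWord k y} ≤
      (wordDec A k).comap (LinearMap.mul ℂ (Env A) (ι A a)) :=
    Submodule.span_le.2 fun w hw =>
      Submodule.mem_sup_left (Submodule.subset_span ⟨a, w, hw, rfl⟩)
  exact h hw

theorem dec_le_wordDec (k : ℕ) : dec A k ≤ wordDec A k := le_sup_right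

theorem ι_mul_mem_wordDec {k : ℕ} (a : A) {x : Env A} (hx : x ∈ wordDec A k) :
    ι A a * x ∈ wordDec A k := by
  have h : wordDec A k ≤ (wordDec A k).comap (LinearMap.mul ℂ (Env A) (ι A a)) := by
    refine sup_le (Submodule.span_le.2 ?_) fun x hx => dec_le_wordDec k (ι_mul_mem_dec a hx)
    rintro _ ⟨b, w, hw, rfl⟩
    change ι A a * (ι A b * w) ∈ wordDec A k
    rw [← mul_assoc, ← map_mul]
    exact ι_mul_word_mem _ (Submodule.subset_span hw)
  exact h hx

theorem wordDec_le_deg (k : ℕ) : wordDec A k ≤ deg A k := by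
  refine sup_le (Submodule.span_le.2 ?_) (dec_le_deg k)
  rintro _ ⟨a, w, hw, rfl⟩
  exact ι_mul_mem_deg a hw.mem_deg

/-- In `{c, a w} = {c, a} w + a {c, w}` the first term is decomposable if `w` has positive degree.
If `w` lies in `A`, the product `a w` is itself a single letter. -/
theorem pb_ι_mul_word_mem (c a : A) {j : ℕ} {w : Env A} (hw : IsWord j w) :
    pb (ι A c) (ι A a * w) ∈ wordDec A (j + 1) := by
  cases hw with
  | of b =>
    rw [← map_mul, ← one_mul (pb _ _), ← map_one (ι A)]
    exact ι_mul_word_mem _ (Submodule.subset_span (.pb _ (.of _)))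
  | @pb j b w hw =>
    rw [pb_mul]
    refine add_mem (dec_le_wordDec (j + 1 + 1) (mul_mem_dec (i := 0) (j := j) (by omega) ?_
      (IsWord.pb b hw).mem_deg)) (ι_mul_word_mem (k := j + 1 + 1) a
        (Submodule.subset_span (IsWord.pb c (.pb b hw))))
    exact pb_mem_deg_of_eq (by omega) (ι_mem_deg c) (ι_mem_deg a)

/-- When both words have positive degree, the expansion of `{a w, b v}` has only one indecomposable
term, `a b {w, v}`. Words of degree `0` are first absorbed into their coefficients. -/
theorem pb_mem_wordDec {i j : ℕ} {x y : Env A} (hx : x ∈ wordDec A i) (hy : y ∈ wordDec A j) :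
    pb x y ∈ wordDec A (i + j + 1) := by
  obtain ⟨x, hxs, x', hx', rfl⟩ := Submodule.mem_sup.1 hx
  obtain ⟨y, hys, y', hy', rfl⟩ := Submodule.mem_sup.1 hy
  have hyd : y ∈ deg A j := wordDec_le_deg j (Submodule.mem_sup_left hys)
  have hxd : x ∈ deg A i := wordDec_le_deg i (Submodule.mem_sup_left hxs)
  rw [add_pb, pb_add]
  refine add_mem (add_mem ?_ (dec_le_wordDec _ (pb_dec_mem hxd hy')))
    (dec_le_wordDec _ (dec_pb_mem hx' (add_mem hyd (dec_le_deg j hy'))))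
  refine bilin_span PoissonAlgebra.bracket ?_ hxs hys
  rintro _ ⟨a, w, hw, rfl⟩ _ ⟨b, v, hv, rfl⟩
  change pb (ι A a * w) (ι A b * v) ∈ _
  cases hw with
  | of c =>
    rw [← map_mul, Nat.zero_add]
    exact pb_ι_mul_word_mem _ _ hv
  | @pb i c w hw =>
    cases hv with
    | of d =>
      rw [← map_mul, pb_antisymm]
      exact neg_mem (pb_ι_mul_word_mem _ _ (.pb c hw))
    | @pb j d v hv =>
      have hw := IsWord.pb c hw
      have hv := IsWord.pb d hv
      rw [mul_pb, pb_mul, mul_add, pb_mul, add_mul]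
      refine add_mem (add_mem ?_ ?_) (add_mem ?_ ?_)
      · rw [← mul_assoc]
        refine dec_le_wordDec _ (mul_mem_dec (i := i + 1) (j := j) (by omega) ?_ hv.mem_deg)
        exact ι_mul_mem_deg a (pb_mem_deg_of_eq (by omega) hw.mem_deg (ι_mem_deg b))
      · rw [← mul_assoc, ← map_mul]
        exact ι_mul_word_mem _ (hw.pb_mem_span (Submodule.subset_span hv))
      · rw [mul_assoc]
        refine dec_le_wordDec _ (mul_mem_dec (i := 0) (j := i + j + 1) (by omega) ?_ ?_)
        · exact pb_mem_deg_of_eq (by omega) (ι_mem_deg a) (ι_mem_deg b)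
        · exact mul_mem_deg_of_eq (by omega) hv.mem_deg hw.mem_deg
      · refine dec_le_wordDec _ (mul_mem_dec (i := j + 1) (j := i) (by omega) ?_ hw.mem_deg)
        refine ι_mul_mem_deg b ?_
        exact pb_mem_deg_of_eq (by omega) (ι_mem_deg a) hv.mem_deg

/-- This is what makes `Q^i` large enough to cover `P^i`: modulo decomposables, which come from
lower degrees, only multiples of Lie words need to be reached. -/
theorem deg_le_wordDec (k : ℕ) : deg A k ≤ wordDec A k := by
  refine Submodule.span_le.2 fun x hx => ?_
  induction hx with
  | of a =>
    rw [← one_mul (ι A a), ← map_one (ι A)]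
    exact ι_mul_word_mem _ (Submodule.subset_span (.of a))
  | @mul i j x y hx hy ihx ihy =>
    cases i with
    | zero =>
      obtain ⟨a, rfl⟩ := hx.exists_eq_ι
      rw [Nat.zero_add]
      exact ι_mul_mem_wordDec a ihy
    | succ i =>
      cases j with
      | zero =>
        obtain ⟨a, rfl⟩ := hy.exists_eq_ι
        rw [mul_comm]
        exact ι_mul_mem_wordDec a ihx
      | succ j =>
        exact dec_le_wordDec _ (mul_mem_dec rfl (Submodule.subset_span hx)
          (Submodule.subset_span hy))
  | pb hx hy ihx ihy => exact pb_mem_wordDec ihx ihy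

end Env

/-! ### The canonical map from the Poisson envelope onto the associated graded algebra -/

namespace Gr

variable {R : Type u} [Ring R] [Algebra ℂ R]

theorem mem_deg_iff {i : ℕ} {z : Gr R} :
    z ∈ Gr.deg R i ↔ ∃ (x : R) (hx : x ∈ ncFil R i), symb R i ⟨x, hx⟩ = z := by
  constructor
  · rintro ⟨y, rfl⟩
    obtain ⟨⟨x, hx⟩, rfl⟩ : ∃ z, GrPiece.mk R i z = y := Submodule.Quotient.mk_surjective _ y
    exact ⟨x, hx, rfl⟩
  · rintro ⟨x, hx, rfl⟩
    exact ⟨_, rfl⟩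

theorem mem_deg_iff_mem_range {i : ℕ} {z : Gr R} :
    z ∈ Gr.deg R i ↔ z ∈ LinearMap.range (symb R i) := by
  rw [mem_deg_iff]
  exact ⟨fun ⟨x, hx, h⟩ => ⟨⟨x, hx⟩, h⟩, fun ⟨x, h⟩ => ⟨x, x.2, h⟩⟩

theorem pb_symb (i j : ℕ) {x y : R} (hx : x ∈ ncFil R i) (hy : y ∈ ncFil R j) :
    pb (symb R i ⟨x, hx⟩) (symb R j ⟨y, hy⟩) =
      symb R (i + j + 1) ⟨x * y - y * x, comm_mem_ncFil hx hy⟩ :=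
  bracket_symb i j hx hy

theorem incl_injective (i : ℕ) : Function.Injective (incl R i) :=
  DirectSum.of_injective (β := fun i => GrPiece R i) i

theorem symb_eq_zero_iff {i : ℕ} {x : ncFil R i} : symb R i x = 0 ↔ (x : R) ∈ ncFil R (i + 1) := by
  refine ⟨fun h => ?_, symb_eq_zero⟩
  have h' : GrPiece.mk R i x = 0 := incl_injective i (h.trans (map_zero _).symm)
  exact (Submodule.Quotient.mk_eq_zero ((ncFil R (i + 1)).submoduleOf (ncFil R i))).1 h'

theorem mem_ncFil_zero (r : R) : r ∈ ncFil R 0 := by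
  rw [ncFil_zero]
  trivial

theorem ofRab_mk (r : R) :
    ofRab R (Ideal.Quotient.mk _ r) = symb R 0 ⟨r, mem_ncFil_zero r⟩ := rfl

variable (R) in
/-- The canonical homomorphism `P(R_ab) → gr_F(R)`. -/
noncomputable def envHom : Env (Rab R) →ₐ[ℂ] Gr R := Env.lift (ofRab R)

theorem envHom_pb (x y : Env (Rab R)) : envHom R (pb x y) = pb (envHom R x) (envHom R y) :=
  Env.lift_pb _ _ _

theorem envHom_ι (a : Rab R) : envHom R (Env.ι _ a) = ofRab R a := rfl

theorem envHom_mem_deg {i : ℕ} {x : Env (Rab R)} (hx : x ∈ Env.deg (Rab R) i) :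
    envHom R x ∈ Gr.deg R i := by
  rw [mem_deg_iff_mem_range]
  have h : Env.deg (Rab R) i ≤ (LinearMap.range (symb R i)).comap (envHom R).toLinearMap := by
    refine Submodule.span_le.2 fun x hx => ?_
    change envHom R x ∈ LinearMap.range (symb R i)
    -- The outer membership hypothesis mentions the index `i`, and the induction would carry it
    -- along.
    rename_i hx₀
    clear hx₀
    induction hx with
    | of a =>
      obtain ⟨r, rfl⟩ := Ideal.Quotient.mk_surjective a
      exact ⟨_, (ofRab_mk r).symm⟩
    | @mul i j x y hx hy ihx ihy =>
      obtain ⟨x', hx'⟩ := ihx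
      obtain ⟨y', hy'⟩ := ihy
      rw [map_mul, ← hx', ← hy']
      exact ⟨_, (symb_mul i j x'.2 y'.2).symm⟩
    | @pb i j x y hx hy ihx ihy =>
      obtain ⟨x', hx'⟩ := ihx
      obtain ⟨y', hy'⟩ := ihy
      rw [envHom_pb, ← hx', ← hy']
      exact ⟨_, (pb_symb i j x'.2 y'.2).symm⟩
  exact h hx

/-- The elements of `F^i` whose symbol comes from `P^i` form a multiplicative family. It contains
the Lie terms, since commutators with `x` correspond to brackets with the class of `x` in `A`; by
minimality of `F` it is everything. -/
theorem exists_envHom_eq {i : ℕ} {z : Gr R} (hz : z ∈ Gr.deg R i) :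
    ∃ x ∈ Env.deg (Rab R) i, envHom R x = z := by
  let N : ℕ → Submodule ℂ R := fun i =>
    (((Env.deg (Rab R) i).map (envHom R).toLinearMap).comap (symb R i)).map (ncFil R i).subtype
  have hN : ∀ {i : ℕ} {x : R}, x ∈ N i ↔ ∃ hx : x ∈ ncFil R i, ∃ y ∈ Env.deg (Rab R) i,
      envHom R y = symb R i ⟨x, hx⟩ := by
    intro i x
    constructor
    · rintro ⟨x, hx, rfl⟩
      exact ⟨x.2, hx⟩
    · rintro ⟨hx, h⟩
      exact ⟨⟨x, hx⟩, h, rfl⟩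
  have hle : ∀ d, ncFil R d ≤ N d := by
    refine ncFil_le N (fun k => ?_) (fun i j => ?_)
    · induction k with
      | zero =>
        intro x _
        exact hN.2 ⟨mem_ncFil_zero x, Env.ι _ (Ideal.Quotient.mk _ x), Env.ι_mem_deg _, rfl⟩
      | succ k ih =>
        rw [lieTerm_succ, Submodule.span_le]
        rintro _ ⟨x, y, hy, rfl⟩
        obtain ⟨hy', w, hw, h⟩ := hN.1 (ih hy)
        have hc := comm_mem_ncFil (mem_ncFil_zero x) hy'
        rw [Nat.zero_add] at hc
        refine hN.2 ⟨hc, pb (Env.ι _ (Ideal.Quotient.mk _ x)) w, ?_, ?_⟩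
        · simpa using Env.pb_mem_deg (Env.ι_mem_deg _) hw
        · rw [envHom_pb, h, envHom_ι, ofRab_mk, pb_symb]
          exact symb_congr (by omega) _ _ rfl
    · refine Submodule.mul_le.2 fun x hx y hy => ?_
      obtain ⟨hx', v, hv, h⟩ := hN.1 hx
      obtain ⟨hy', w, hw, h'⟩ := hN.1 hy
      exact hN.2 ⟨mul_mem_ncFil hx' hy', v * w, Env.mul_mem_deg hv hw, by
        rw [map_mul, h, h', symb_mul]⟩
  obtain ⟨x, hx, rfl⟩ := mem_deg_iff.1 hz
  obtain ⟨_, h⟩ := hN.1 (hle i hx)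
  exact h

end Gr

end NCGeom

namespace NCGeom

/-! ### The free Lie algebra of a module and its grading -/

namespace FreeLie

section Lift

variable {A M : Type u} [CommRing A] [AddCommGroup M] [Module A M]
variable {L : Type*} [LieRing L] [LieAlgebra A L] (f : M →ₗ[A] L)

theorem freeLieRel_le_ker : freeLieRel A M ≤ (FreeLieAlgebra.lift A f).ker := by
  refine LieSubmodule.lieSpan_le.2 ?_
  rintro z (⟨m, n, rfl⟩ | ⟨a, m, rfl⟩) <;> simp [LieHom.mem_ker]

/-- The homomorphism of Lie algebras `Lie_A(M) → L` which extends an `A`-linear map `M → L`. -/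
noncomputable def lift : FreeLie A M →ₗ⁅A⁆ L where
  toLinearMap := Submodule.liftQ (freeLieRel A M).toSubmodule
    (FreeLieAlgebra.lift A f : FreeLieAlgebra A M →ₗ[A] L)
    fun _ hx => LieHom.mem_ker.1 (freeLieRel_le_ker f hx)
  map_lie' {x y} := by
    obtain ⟨x, rfl⟩ := Quotient.mk_surjective x
    obtain ⟨y, rfl⟩ := Quotient.mk_surjective y
    exact (FreeLieAlgebra.lift A f).map_lie x y

theorem lift_of (m : M) : lift f (of A M m) = f m := FreeLieAlgebra.lift_of_apply f m

theorem of_add (m n : M) : of A M (m + n) = of A M m + of A M n :=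
  (Submodule.Quotient.eq (freeLieRel A M).toSubmodule).2
    (LieSubmodule.subset_lieSpan (Or.inl ⟨m, n, rfl⟩))

theorem of_smul (a : A) (m : M) : of A M (a • m) = a • of A M m :=
  (Submodule.Quotient.eq (freeLieRel A M).toSubmodule).2
    (LieSubmodule.subset_lieSpan (Or.inr ⟨a, m, rfl⟩))

theorem of_mem_deg (m : M) : of A M m ∈ deg A M 0 := Submodule.subset_span ⟨m, rfl⟩

theorem of_lie_mem_deg (m : M) {k : ℕ} {y : FreeLie A M} (hy : y ∈ deg A M k) :
    ⁅of A M m, y⁆ ∈ deg A M (k + 1) := Submodule.subset_span ⟨m, y, hy, rfl⟩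

theorem exists_of_mem_deg_zero {u : FreeLie A M} (hu : u ∈ deg A M 0) : ∃ m, of A M m = u := by
  refine Submodule.span_induction (p := fun u _ => ∃ m, of A M m = u) (fun u hu => hu) ⟨0, ?_⟩ ?_ ?_ hu
  · rw [← zero_smul A (0 : M), of_smul, zero_smul]
  · rintro _ _ _ _ ⟨m, rfl⟩ ⟨n, rfl⟩
    exact ⟨m + n, of_add m n⟩
  · rintro a _ _ ⟨m, rfl⟩
    exact ⟨a • m, of_smul a m⟩

/-- Induction on the elements of the graded components of `Lie_A(M)`. -/
theorem deg_induction {p : ℕ → FreeLie A M → Prop} (of : ∀ m, p 0 (FreeLie.of A M m))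
    (lie : ∀ k m y, y ∈ deg A M k → p k y → p (k + 1) ⁅FreeLie.of A M m, y⁆)
    (zero : ∀ k, p k 0)
    (add : ∀ k x y, x ∈ deg A M k → y ∈ deg A M k → p k x → p k y → p k (x + y))
    (smul : ∀ k (a : A) x, x ∈ deg A M k → p k x → p k (a • x)) {k : ℕ} {u : FreeLie A M}
    (hu : u ∈ deg A M k) : p k u := by
  induction k generalizing u with
  | zero =>
    obtain ⟨m, rfl⟩ := exists_of_mem_deg_zero hu
    exact of m
  | succ k ih =>
    refine Submodule.span_induction (p := fun u _ => p (k + 1) u) ?_ (zero _) ?_ ?_ hu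
    · rintro _ ⟨m, y, hy, rfl⟩
      exact lie k m y hy (ih hy)
    · intro x y hx hy
      exact add _ _ _ hx hy
    · intro a x hx
      exact smul _ _ _ hx

/-- The components are spanned by right-normed brackets only. The general case reduces to these by
`[[m, x], y] = [m, [x, y]] - [x, [m, y]]`. -/
theorem lie_mem_deg {j k n : ℕ} (h : j + k + 1 = n) {x y : FreeLie A M} (hx : x ∈ deg A M j)
    (hy : y ∈ deg A M k) : ⁅x, y⁆ ∈ deg A M n := by
  -- The second argument stays universally quantified, since Jacobi replaces `y` by `[m, y]`.
  refine deg_induction (p := fun j x => ∀ (k n : ℕ) (y : FreeLie A M), j + k + 1 = n →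
    y ∈ deg A M k → ⁅x, y⁆ ∈ deg A M n) ?_ ?_ ?_ ?_ ?_ hx k n y h hy
  · rintro m k n y rfl hy
    rw [Nat.zero_add]
    exact of_lie_mem_deg m hy
  · rintro j m x hx ih k n y rfl hy
    rw [lie_lie]
    refine sub_mem ?_ (ih (k + 1) _ _ (by omega) (of_lie_mem_deg m hy))
    rw [show j + 1 + k + 1 = j + k + 1 + 1 by omega]
    exact of_lie_mem_deg m (ih _ _ _ rfl hy)
  · intro j k n y _ _
    rw [zero_lie]
    exact zero_mem _
  · intro j x x' _ _ ih ih' k n y h hy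
    rw [add_lie]
    exact add_mem (ih k n y h hy) (ih' k n y h hy)
  · intro j a x _ ih k n y h hy
    rw [smul_lie]
    exact Submodule.smul_mem _ _ (ih k n y h hy)

end Lift

/-! ### The tensor algebra acting on `Lie_A(M) ⊕ A`, and the Dynkin–Specht–Wever identity -/

section Rep

variable (A M : Type u) [CommRing A] [AddCommGroup M] [Module A M]

/-- The direct sum of the graded components of `Lie_A(M)`. -/
abbrev Graded : Type u := DirectSum ℕ fun k => deg A M k

/-- The `T_A(M)`-module `Lie_A(M) ⊕ A`, on which `m` acts by `(l, c) ↦ ([m, l] + c m, 0)`. -/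
abbrev Ext : Type u := Graded A M × A

variable {A M}

/-- An element of degree `k`, inside the graded Lie algebra. -/
noncomputable def gof (k : ℕ) (x : FreeLie A M) (hx : x ∈ deg A M k) : Graded A M :=
  DirectSum.lof A ℕ (fun k => deg A M k) k ⟨x, hx⟩

theorem gof_congr {j k : ℕ} (h : j = k) {x y : FreeLie A M} (hx : x ∈ deg A M j)
    (hy : y ∈ deg A M k) (e : x = y) : gof j x hx = gof k y hy := by
  subst h; subst e; rfl

theorem gof_add {k : ℕ} {x y : FreeLie A M} (hx : x ∈ deg A M k) (hy : y ∈ deg A M k)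
    (h : x + y ∈ deg A M k) : gof k (x + y) h = gof k x hx + gof k y hy :=
  map_add (DirectSum.lof A ℕ (fun k => deg A M k) k) ⟨x, hx⟩ ⟨y, hy⟩

theorem gof_sub {k : ℕ} {x y : FreeLie A M} (hx : x ∈ deg A M k) (hy : y ∈ deg A M k)
    (h : x - y ∈ deg A M k) : gof k (x - y) h = gof k x hx - gof k y hy :=
  map_sub (DirectSum.lof A ℕ (fun k => deg A M k) k) ⟨x, hx⟩ ⟨y, hy⟩

theorem gof_smul {k : ℕ} {a : A} {x : FreeLie A M} (hx : x ∈ deg A M k)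
    (h : a • x ∈ deg A M k) : gof k (a • x) h = a • gof k x hx :=
  map_smul (DirectSum.lof A ℕ (fun k => deg A M k) k) a ⟨x, hx⟩

theorem gof_zero {k : ℕ} (h : (0 : FreeLie A M) ∈ deg A M k) : gof k 0 h = 0 :=
  map_zero (DirectSum.lof A ℕ (fun k => deg A M k) k)

theorem graded_ext {N : Type*} [AddCommGroup N] [Module A N] {f g : Graded A M →ₗ[A] N}
    (h : ∀ k x hx, f (gof k x hx) = g (gof k x hx)) : f = g :=
  DirectSum.linearMap_ext A fun k => LinearMap.ext fun x => h k x x.2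

/-- The operator `[m, -]` on the graded Lie algebra. -/
noncomputable def adGraded (m : M) : Graded A M →ₗ[A] Graded A M :=
  DirectSum.toModule A ℕ _ fun k => DirectSum.lof A ℕ (fun k => deg A M k) (k + 1) ∘ₗ
    LinearMap.codRestrict (deg A M (k + 1))
      ((LieAlgebra.ad A (FreeLie A M) (of A M m) : FreeLie A M →ₗ[A] FreeLie A M) ∘ₗ
        (deg A M k).subtype) fun y => of_lie_mem_deg m y.2

theorem adGraded_gof (m : M) {k : ℕ} {y : FreeLie A M} (hy : y ∈ deg A M k) :
    adGraded m (gof k y hy) = gof (k + 1) ⁅of A M m, y⁆ (of_lie_mem_deg m hy) :=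
  DirectSum.toModule_lof ..

variable (A M) in
/-- The action of `M` on `Lie_A(M) ⊕ A`. -/
noncomputable def rep : M →ₗ[A] Module.End A (Ext A M) :=
  LinearMap.mk₂ A (fun m n => (adGraded m n.1 + n.2 • gof 0 (of A M m) (of_mem_deg m), 0))
    (fun m m' n => by
      have h : (adGraded (m + m') : Graded A M →ₗ[A] Graded A M) = adGraded m + adGraded m' := by
        refine graded_ext fun k y hy => ?_
        rw [LinearMap.add_apply, adGraded_gof, adGraded_gof, adGraded_gof, ← gof_add]
        · exact gof_congr rfl _ _ (by rw [of_add, add_lie])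
        · exact add_mem (of_lie_mem_deg m hy) (of_lie_mem_deg m' hy)
      have h' : gof 0 (of A M (m + m')) (of_mem_deg _) =
          gof 0 (of A M m) (of_mem_deg m) + gof 0 (of A M m') (of_mem_deg m') := by
        rw [← gof_add _ _ (add_mem (of_mem_deg m) (of_mem_deg m'))]
        exact gof_congr rfl _ _ (of_add _ _)
      refine Prod.ext ?_ (add_zero _).symm
      simp only [h, h', LinearMap.add_apply, Prod.fst_add, smul_add]
      abel)
    (fun a m n => by
      have h : (adGraded (a • m) : Graded A M →ₗ[A] Graded A M) = a • adGraded m := by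
        refine graded_ext fun k y hy => ?_
        rw [LinearMap.smul_apply, adGraded_gof, adGraded_gof, ← gof_smul]
        · exact gof_congr rfl _ _ (by rw [of_smul, smul_lie])
        · exact Submodule.smul_mem _ _ (of_lie_mem_deg m hy)
      have h' : gof 0 (of A M (a • m)) (of_mem_deg _) = a • gof 0 (of A M m) (of_mem_deg m) := by
        rw [← gof_smul _ (Submodule.smul_mem _ _ (of_mem_deg m))]
        exact gof_congr rfl _ _ (of_smul _ _)
      refine Prod.ext ?_ (smul_zero _).symm
      simp only [h, h', LinearMap.smul_apply, Prod.smul_fst, smul_add]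
      rw [smul_comm])
    (fun m n n' => by
      refine Prod.ext ?_ (add_zero _).symm
      simp only [Prod.fst_add, Prod.snd_add, map_add, add_smul]
      abel)
    (fun a m n => by
      refine Prod.ext ?_ (smul_zero _).symm
      simp only [Prod.smul_fst, Prod.smul_snd, map_smul, smul_add, smul_assoc])

theorem rep_apply (m : M) (n : Ext A M) :
    rep A M m n = (adGraded m n.1 + n.2 • gof 0 (of A M m) (of_mem_deg m), 0) := rfl

section

attribute [local instance] LieRing.ofAssociativeRing

variable (A M) in
/-- The homomorphism from the free Lie algebra to the tensor algebra with the commutator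
bracket. -/
noncomputable def toTensor : FreeLie A M →ₗ[A] TensorAlgebra A M :=
  (lift (TensorAlgebra.ι A) : FreeLie A M →ₗ⁅A⁆ TensorAlgebra A M)

theorem toTensor_of (m : M) : toTensor A M (of A M m) = TensorAlgebra.ι A m := lift_of _ m

theorem toTensor_lie (x y : FreeLie A M) : toTensor A M ⁅x, y⁆ =
    toTensor A M x * toTensor A M y - toTensor A M y * toTensor A M x :=
  (lift (TensorAlgebra.ι A) : FreeLie A M →ₗ⁅A⁆ TensorAlgebra A M).map_lie x y

end

variable (A M) in
/-- The action of the tensor algebra on `Lie_A(M) ⊕ A`. -/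
noncomputable def repTensor : TensorAlgebra A M →ₐ[A] Module.End A (Ext A M) :=
  TensorAlgebra.lift A (rep A M)

theorem repTensor_ι (m : M) : repTensor A M (TensorAlgebra.ι A m) = rep A M m :=
  TensorAlgebra.lift_ι_apply _ _

theorem rep_gof (m : M) {k : ℕ} {y : FreeLie A M} (hy : y ∈ deg A M k) :
    rep A M m (gof k y hy, 0) = (gof (k + 1) ⁅of A M m, y⁆ (of_lie_mem_deg m hy), 0) := by
  rw [rep_apply, adGraded_gof, zero_smul, add_zero]

/-- On the summand `Lie_A(M)` the generators act by `ad`, and `ad` turns brackets into commutators,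
so every homogeneous Lie element acts by its `ad`. -/
theorem repTensor_gof {j k n : ℕ} (h : j + k + 1 = n) {x y : FreeLie A M} (hx : x ∈ deg A M j)
    (hy : y ∈ deg A M k) : repTensor A M (toTensor A M x) (gof k y hy, 0) =
      (gof n ⁅x, y⁆ (lie_mem_deg h hx hy), 0) := by
  refine deg_induction (p := fun j x => ∀ (k n : ℕ) (y : FreeLie A M) (_ : j + k + 1 = n)
    (hy : y ∈ deg A M k) (hxy : ⁅x, y⁆ ∈ deg A M n),
      repTensor A M (toTensor A M x) (gof k y hy, 0) = (gof n ⁅x, y⁆ hxy, 0))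
    ?_ ?_ ?_ ?_ ?_ hx k n y h hy _
  · rintro m k n y rfl hy hxy
    rw [toTensor_of, repTensor_ι, rep_gof]
    exact Prod.ext (gof_congr (by omega) _ _ rfl) rfl
  · rintro j m x hx ih k n y rfl hy hxy
    have h₁ := lie_mem_deg rfl hx hy
    have h₂ := lie_mem_deg (n := j + 1 + k + 1) (by omega) hx (of_lie_mem_deg m hy)
    have h₃ : ⁅of A M m, ⁅x, y⁆⁆ ∈ deg A M (j + 1 + k + 1) :=
      lie_mem_deg (by omega) (of_mem_deg m) h₁
    rw [toTensor_lie, toTensor_of, map_sub, map_mul, map_mul, repTensor_ι, LinearMap.sub_apply,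
      Module.End.mul_apply, Module.End.mul_apply, ih _ _ _ rfl hy h₁, rep_gof, rep_gof,
      ih (k + 1) _ _ (by omega) _ h₂, Prod.mk_sub_mk, sub_zero,
      gof_congr (by omega : j + k + 1 + 1 = j + 1 + k + 1) _ h₃ rfl, ← gof_sub]
    · exact Prod.ext (gof_congr rfl _ _ (lie_lie _ _ _).symm) rfl
    · exact sub_mem h₃ h₂
  · intro j k n y _ hy hxy
    rw [map_zero, map_zero, LinearMap.zero_apply, gof_congr rfl _ (zero_mem _) (zero_lie y),
      gof_zero]
    rfl
  · intro j x x' hx hx' ih ih' k n y h hy hxy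
    have h₁ := lie_mem_deg h hx hy
    have h₂ := lie_mem_deg h hx' hy
    rw [map_add, map_add, LinearMap.add_apply, ih k n y h hy h₁, ih' k n y h hy h₂,
      gof_congr rfl hxy (add_mem h₁ h₂) (add_lie _ _ _), gof_add h₁ h₂, Prod.mk_add_mk, add_zero]
  · intro j a x hx ih k n y h hy hxy
    have h₁ := lie_mem_deg h hx hy
    rw [map_smul, map_smul, LinearMap.smul_apply, ih k n y h hy h₁,
      gof_congr rfl hxy (Submodule.smul_mem _ a h₁) (smul_lie _ _ _), gof_smul h₁, Prod.smul_mk,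
      smul_zero]

/-- The Dynkin–Specht–Wever identity. -/
theorem repTensor_one {k : ℕ} {x : FreeLie A M} (hx : x ∈ deg A M k) :
    repTensor A M (toTensor A M x) (0, 1) = (((k : A) + 1) • gof k x hx, 0) := by
  refine deg_induction (p := fun k x => ∀ hx : x ∈ deg A M k,
    repTensor A M (toTensor A M x) (0, 1) = (((k : A) + 1) • gof k x hx, 0))
    ?_ ?_ ?_ ?_ ?_ hx hx
  · intro m hm
    rw [toTensor_of, repTensor_ι, rep_apply]
    simp
  · intro k m x hx ih hmx
    -- With `1 = (0, 1)`, this computes `m · (x · 1) - x · (m · 1) = (k + 1) [m, x] - [x, m] = (k +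
    -- 2) [m, x]`.
    rw [toTensor_lie, toTensor_of, map_sub, map_mul, map_mul, repTensor_ι, LinearMap.sub_apply,
      Module.End.mul_apply, Module.End.mul_apply, ih hx, rep_apply m (0, 1)]
    have e : ((((k : A) + 1) • gof k x hx, 0) : Ext A M) = ((k : A) + 1) • (gof k x hx, 0) := by
      rw [Prod.smul_mk, smul_zero]
    have h₁ : ⁅x, of A M m⁆ ∈ deg A M (k + 1) := lie_mem_deg (by omega) hx (of_mem_deg m)
    have h₂ : gof (k + 1) ⁅x, of A M m⁆ h₁ = -gof (k + 1) ⁅of A M m, x⁆ hmx := by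
      rw [gof_congr (j := k + 1) rfl h₁ (neg_mem hmx) (lie_skew _ _).symm]
      exact map_neg (DirectSum.lof A ℕ (fun k => deg A M k) (k + 1)) ⟨_, hmx⟩
    rw [e, map_smul, rep_gof, map_zero, zero_add, one_smul,
      repTensor_gof (n := k + 1) (by omega) hx, h₂, Prod.smul_mk, Prod.mk_sub_mk, smul_zero, sub_zero, sub_neg_eq_add]
    refine Prod.ext ?_ rfl
    push_cast
    simp only [add_smul, one_smul]
  · intro k hk
    rw [map_zero, map_zero, LinearMap.zero_apply, gof_zero, smul_zero]
    rfl
  · intro k x y hx hy ihx ihy hxy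
    rw [map_add, map_add, LinearMap.add_apply, ihx hx, ihy hy, gof_add hx hy, Prod.mk_add_mk,
      smul_add, add_zero]
  · intro k a x hx ih h
    rw [map_smul, map_smul, LinearMap.smul_apply, ih hx, gof_smul hx, Prod.smul_mk, smul_zero,
      smul_comm]

end Rep

end FreeLie

end NCGeom

namespace NCGeom

/-! ### Derivations of the symmetric algebra -/

section SymDer

variable {A N : Type u} [CommRing A] [AddCommGroup N] [Module A N]

/-- The derivation of the symmetric algebra which extends a linear map on the generators, as a
homomorphism to the dual numbers. -/
noncomputable def symDual (h : N →ₗ[A] N) :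
    SymmetricAlgebra A N →ₐ[A] DualNumber (SymmetricAlgebra A N) :=
  SymmetricAlgebra.lift
    ((TrivSqZeroExt.inlAlgHom A (SymmetricAlgebra A N) (SymmetricAlgebra A N)).toLinearMap ∘ₗ
        SymmetricAlgebra.ι A N +
      (TrivSqZeroExt.inrHom (SymmetricAlgebra A N) (SymmetricAlgebra A N)).restrictScalars A ∘ₗ
        SymmetricAlgebra.ι A N ∘ₗ h)

theorem fst_symDual (h : N →ₗ[A] N) (x : SymmetricAlgebra A N) : (symDual h x).fst = x := by
  have e : (TrivSqZeroExt.fstHom A (SymmetricAlgebra A N) (SymmetricAlgebra A N)).comp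
      (symDual h) = AlgHom.id A _ := by
    refine SymmetricAlgebra.algHom_ext (LinearMap.ext fun n => ?_)
    simp [symDual]
  exact DFunLike.congr_fun e x

/-- The derivation of the symmetric algebra which extends a linear map on the generators. -/
noncomputable def symDer (h : N →ₗ[A] N) : Module.End A (SymmetricAlgebra A N) where
  toFun x := (symDual h x).snd
  map_add' x y := by simp
  map_smul' a x := by simp

theorem symDer_ι (h : N →ₗ[A] N) (n : N) :
    symDer h (SymmetricAlgebra.ι A N n) = SymmetricAlgebra.ι A N (h n) := by
  simp [symDer, symDual]

/-- The endomorphisms which satisfy the Leibniz rule. -/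
def IsDer {B : Type u} [CommRing B] [Algebra A B] (D : Module.End A B) : Prop :=
  ∀ x y, D (x * y) = x * D y + y * D x

theorem isDer_symDer (h : N →ₗ[A] N) : IsDer (symDer h) := by
  intro x y
  change (symDual h (x * y)).snd = x * (symDual h y).snd + y * (symDual h x).snd
  simp [fst_symDual, mul_comm]

theorem IsDer.map_one {B : Type u} [CommRing B] [Algebra A B] {D : Module.End A B}
    (hD : IsDer D) : D 1 = 0 := by
  have h := hD 1 1
  rw [mul_one, one_mul] at h
  exact left_eq_add.1 h

theorem IsDer.map_algebraMap {B : Type u} [CommRing B] [Algebra A B] {D : Module.End A B}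
    (hD : IsDer D) (a : A) : D (algebraMap A B a) = 0 := by
  rw [Algebra.algebraMap_eq_smul_one, map_smul, hD.map_one, smul_zero]

theorem IsDer.map_pow {B : Type u} [CommRing B] [Algebra A B] {D : Module.End A B}
    (hD : IsDer D) (x : B) (n : ℕ) : D (x ^ (n + 1)) = (n + 1 : B) * x ^ n * D x := by
  induction n with
  | zero => simp
  | succ n ih =>
    rw [pow_succ, hD, ih]
    push_cast
    ring

/-- The inductive step for leading coefficients: one more derivation lowers the order in `x` by one,
multiplies the coefficient by `(n + 1) D x`, and pushes all other terms into the ideal of `x ^ (n +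
1)`. -/
theorem IsDer.map_mul_pow_add {B : Type u} [CommRing B] [Algebra A B] {D : Module.End A B}
    (hD : IsDer D) (m n : ℕ) (q x b : B) :
    D (m * (q * x ^ (n + 1)) + x ^ (n + 1 + 1) * b) =
      ((n + 1) * m : ℕ) * ((D x * q) * x ^ n) +
        x ^ (n + 1) * (m * D q + ((n + 1 + 1 : B) * D x * b + x * D b)) := by
  have hm : D (m : B) = 0 := by
    rw [← map_natCast (algebraMap A B), hD.map_algebraMap]
  rw [map_add, hD _ (q * _), hD q, hD _ b, hm, hD.map_pow, hD.map_pow]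
  push_cast
  ring

theorem IsDer.ext {D E : Module.End A (SymmetricAlgebra A N)} (hD : IsDer D) (hE : IsDer E)
    (h : ∀ n, D (SymmetricAlgebra.ι A N n) = E (SymmetricAlgebra.ι A N n)) : D = E := by
  refine LinearMap.ext fun x => ?_
  induction x using SymmetricAlgebra.induction with
  | algebraMap a => rw [hD.map_algebraMap, hE.map_algebraMap]
  | ι n => exact h n
  | mul x y hx hy => rw [hD, hE, hx, hy]
  | add x y hx hy => rw [map_add, map_add, hx, hy]

theorem IsDer.add {B : Type u} [CommRing B] [Algebra A B] {D E : Module.End A B} (hD : IsDer D)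
    (hE : IsDer E) : IsDer (D + E) := fun x y => by
  simp only [LinearMap.add_apply, hD x y, hE x y]
  ring

theorem IsDer.smul {B : Type u} [CommRing B] [Algebra A B] {D : Module.End A B} (hD : IsDer D)
    (a : A) : IsDer (a • D) := fun x y => by
  simp only [LinearMap.smul_apply, hD x y, smul_add, mul_smul_comm]

theorem IsDer.commutator {B : Type u} [CommRing B] [Algebra A B] {D E : Module.End A B}
    (hD : IsDer D) (hE : IsDer E) : IsDer (D * E - E * D) := fun x y => by
  simp only [LinearMap.sub_apply, Module.End.mul_apply, hD x y, hE x y, map_add, hD x (E y),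
    hD y (E x), hE x (D y), hE y (D x)]
  ring

end SymDer

/-! ### The tensor algebra acting on a symmetric algebra -/

namespace FreeLie

variable (A M : Type u) [CommRing A] [AddCommGroup M] [Module A M]

/-- The action of the tensor algebra on the symmetric algebra of `Lie_A(M) ⊕ A`, in which the
elements of `M` act by derivations. -/
noncomputable def symRep :
    TensorAlgebra A M →ₐ[A] Module.End A (SymmetricAlgebra A (Ext A M)) :=
  TensorAlgebra.lift A
    { toFun := fun m => symDer (rep A M m)
      map_add' := fun m m' => (isDer_symDer _).ext ((isDer_symDer _).add (isDer_symDer _))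
        fun n => by simp only [LinearMap.add_apply, symDer_ι, map_add]
      map_smul' := fun a m => (isDer_symDer _).ext ((isDer_symDer _).smul _)
        fun n => by simp only [LinearMap.smul_apply, symDer_ι, map_smul, RingHom.id_apply] }

variable {A M}

theorem symRep_ι (m : M) : symRep A M (TensorAlgebra.ι A m) = symDer (rep A M m) :=
  TensorAlgebra.lift_ι_apply _ _

/-- The derivations `symDer` preserve the linear part of the symmetric algebra and act there by the
original endomorphisms. -/
theorem symRep_gen (t : TensorAlgebra A M) (n : Ext A M) :
    symRep A M t (SymmetricAlgebra.ι A _ n) = SymmetricAlgebra.ι A _ (repTensor A M t n) := by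
  induction t using TensorAlgebra.induction generalizing n with
  | algebraMap a =>
    rw [AlgHom.commutes, AlgHom.commutes, Module.algebraMap_end_apply,
      Module.algebraMap_end_apply, map_smul]
  | ι m => rw [symRep_ι, symDer_ι, repTensor_ι]
  | mul s t hs ht => rw [map_mul, Module.End.mul_apply, ht, hs, map_mul, Module.End.mul_apply]
  | add s t hs ht =>
    rw [map_add, LinearMap.add_apply, hs, ht, map_add, LinearMap.add_apply, map_add]

/-- Commutators of derivations are derivations. Thus a Lie element acts by a single derivation,
whatever its degree, which is how the number of Lie factors becomes visible. -/
theorem isDer_symRep {k : ℕ} {u : FreeLie A M} (hu : u ∈ deg A M k) :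
    IsDer (symRep A M (toTensor A M u)) := by
  refine deg_induction (p := fun _ u => IsDer (symRep A M (toTensor A M u))) ?_ ?_ ?_ ?_ ?_ hu
  · intro m
    rw [toTensor_of, symRep_ι]
    exact isDer_symDer _
  · intro k m y _ hy
    rw [toTensor_lie, map_sub, map_mul, map_mul, toTensor_of, symRep_ι]
    exact (isDer_symDer _).commutator hy
  · intro k x y
    simp
  · intro k x y _ _ hx hy
    rw [map_add, map_add]
    exact hx.add hy
  · intro k a x _ hx
    rw [map_smul, map_smul]
    exact hx.smul a

/-- The symbol of the operators on the symmetric algebra: the variable of the summand `A`. -/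
noncomputable abbrev xi : SymmetricAlgebra A (Ext A M) := SymmetricAlgebra.ι A (Ext A M) (0, 1)

theorem symRep_xi {k : ℕ} {u : FreeLie A M} (hu : u ∈ deg A M k) :
    symRep A M (toTensor A M u) xi =
      SymmetricAlgebra.ι A (Ext A M) (((k : A) + 1) • gof k u hu, 0) := by
  rw [symRep_gen, repTensor_one hu]

/-- A product of `r` Lie elements lowers the order of vanishing at `xi = 0` by at most `r`. -/
theorem exists_symRep_eq {l : List ℕ} {v : TensorAlgebra A M}
    (hv : v ∈ (l.map fun k => (deg A M k).map (toTensor A M)).prod) (n : ℕ) :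
    ∀ b, ∃ c, symRep A M v (xi ^ (l.length + n) * b) = xi ^ n * c := by
  induction l generalizing v n with
  | nil =>
    intro b
    rw [List.map_nil, List.prod_nil] at hv
    obtain ⟨a, rfl⟩ := Submodule.mem_one.1 hv
    rw [AlgHom.commutes, Module.algebraMap_end_apply, List.length_nil, Nat.zero_add]
    exact ⟨a • b, (mul_smul_comm _ _ _).symm⟩
  | cons k l ih =>
    rw [List.map_cons, List.prod_cons] at hv
    induction hv using Submodule.mul_induction_on' with
    | mem_mul_mem u hu v hv =>
      obtain ⟨u, hu, rfl⟩ := hu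
      intro b
      -- One spare power of `xi` is kept for the remaining derivation.
      obtain ⟨c, hc⟩ := ih hv (n + 1) b
      have hD := isDer_symRep hu
      rw [map_mul (symRep A M), Module.End.mul_apply, List.length_cons,
        show l.length + 1 + n = l.length + (n + 1) by omega, hc, hD, hD.map_pow]
      exact ⟨xi * symRep A M (toTensor A M u) c +
        c * ((n + 1 : SymmetricAlgebra A (Ext A M)) * symRep A M (toTensor A M u) xi), by ring⟩
    | add v _ w _ hv hw =>
      intro b
      obtain ⟨c, hc⟩ := hv b
      obtain ⟨c', hc'⟩ := hw b
      exact ⟨c + c', by rw [map_add, LinearMap.add_apply, hc, hc', mul_add]⟩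

/-! ### Recovering a product of Lie elements from its operator symbol -/

section Detect

variable [Algebra ℂ A]

/-- The inverse of `n + 1` in `A`. -/
noncomputable def invSucc (A : Type u) [CommRing A] [Algebra ℂ A] (n : ℕ) : A :=
  algebraMap ℂ A ((n : ℂ) + 1)⁻¹

theorem invSucc_mul (n : ℕ) : invSucc A n * ((n : A) + 1) = 1 := by
  have h : ((n : A) + 1) = algebraMap ℂ A ((n : ℂ) + 1) := by simp
  rw [h, invSucc, ← map_mul, inv_mul_cancel₀ (Nat.cast_add_one_ne_zero n), map_one]

variable (A M) in
/-- The projection of `Lie_A(M) ⊕ A` onto `Lie_+(M)`, normalized by the degrees. -/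
noncomputable def projPlus : Ext A M →ₗ[A] LiePlus A M :=
  (DirectSum.toModule A ℕ (LiePlus A M) fun k => match k with
    | 0 => 0
    | k + 1 => invSucc A (k + 1) • DirectSum.lof A ℕ (fun k => deg A M (k + 1)) k) ∘ₗ
    LinearMap.fst A (Graded A M) A

variable (A M) in
/-- The evaluation at `xi = 0` and the normalized projection to the symmetric algebra of
`Lie_+(M)`. -/
noncomputable def symProj :
    SymmetricAlgebra A (Ext A M) →ₐ[A] SymmetricAlgebra A (LiePlus A M) :=
  SymmetricAlgebra.lift (SymmetricAlgebra.ι A _ ∘ₗ projPlus A M)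

theorem symProj_xi : symProj A M xi = 0 := by
  rw [symProj, SymmetricAlgebra.lift_ι_apply]
  simp [projPlus]

/-- The generator of the symmetric algebra of `Lie_+(M)` which belongs to an element of degree
`k + 2` of the free Lie algebra. -/
noncomputable def gen (k : ℕ) : deg A M (k + 1) →ₗ[A] SymmetricAlgebra A (LiePlus A M) :=
  SymmetricAlgebra.ι A (LiePlus A M) ∘ₗ DirectSum.lof A ℕ (fun k => deg A M (k + 1)) k

/-- The normalization in `projPlus` cancels the factor `k + 2` of the Dynkin–Specht–Wever identity.
-/
theorem symProj_symRep_xi {k : ℕ} (u : deg A M (k + 1)) :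
    symProj A M (symRep A M (toTensor A M u) xi) = gen k u := by
  have e : projPlus A M ((((k + 1 : ℕ) : A) + 1) • gof (k + 1) u u.2, 0) =
      DirectSum.lof A ℕ (fun k => deg A M (k + 1)) k u := by
    rw [projPlus, LinearMap.comp_apply, LinearMap.fst_apply, map_smul, gof,
      DirectSum.toModule_lof]
    rw [LinearMap.smul_apply, smul_smul, mul_comm, invSucc_mul, one_smul]
  rw [symRep_xi u.2, symProj, SymmetricAlgebra.lift_ι_apply, LinearMap.comp_apply, e]
  rfl

variable (A M) in
/-- The pairs of a Lie element of degree `k + 2` in the tensor algebra and the corresponding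
generator of the symmetric algebra of `Lie_+(M)`. -/
noncomputable def genPair (k : ℕ) :
    Submodule A (TensorAlgebra A M × SymmetricAlgebra A (LiePlus A M)) :=
  LinearMap.range ((toTensor A M ∘ₗ (deg A M (k + 1)).subtype).prod (gen k))

variable (A M) in
/-- The operator symbol of order `s` on the tensor algebra. -/
noncomputable def opSymbol (s : ℕ) :
    TensorAlgebra A M →ₗ[A] SymmetricAlgebra A (LiePlus A M) :=
  (symProj A M).toLinearMap ∘ₗ LinearMap.applyₗ (xi ^ s) ∘ₗ (symRep A M).toLinearMap

theorem opSymbol_apply (s : ℕ) (t : TensorAlgebra A M) :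
    opSymbol A M s t = symProj A M (symRep A M t (xi ^ s)) := rfl

/-- Fewer than `s` derivations cannot use up `xi ^ s`, and `symProj` sets `xi = 0`. -/
theorem opSymbol_eq_zero {l : List ℕ} {v : TensorAlgebra A M}
    (hv : v ∈ (l.map fun k => (deg A M k).map (toTensor A M)).prod) {s : ℕ} (h : l.length < s) :
    opSymbol A M s v = 0 := by
  obtain ⟨n, rfl⟩ := Nat.exists_eq_add_of_lt h
  obtain ⟨c, hc⟩ := exists_symRep_eq hv (n + 1) 1
  rw [mul_one, ← add_assoc] at hc
  rw [opSymbol_apply, hc, map_mul, map_pow, symProj_xi, pow_succ, mul_zero, zero_mul]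

/-- Modulo `xi ^ (n + 1)`, each derivation must hit a fresh copy of `xi`; the number of ways is a
falling factorial. The parameter `n` leaves powers for the outer factors of the induction. Pairs are
used because a tensor need not determine the element of the symmetric algebra that its factors
define. -/
theorem exists_symRep_eq_descFactorial {l : List ℕ}
    {p : TensorAlgebra A M × SymmetricAlgebra A (LiePlus A M)}
    (hp : p ∈ (l.map (genPair A M)).prod) :
    ∃ q, symProj A M q = p.2 ∧ ∀ n, ∃ b, symRep A M p.1 (xi ^ (l.length + n)) =
      ((l.length + n).descFactorial l.length : SymmetricAlgebra A (Ext A M)) * (q * xi ^ n) +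
        xi ^ (n + 1) * b := by
  induction l generalizing p with
  | nil =>
    rw [List.map_nil, List.prod_nil] at hp
    obtain ⟨a, rfl⟩ := Submodule.mem_one.1 hp
    refine ⟨algebraMap A _ a, AlgHom.commutes _ _, fun n => ⟨0, ?_⟩⟩
    change symRep A M (algebraMap A _ a) _ = _
    rw [AlgHom.commutes, Module.algebraMap_end_apply, Algebra.smul_def]
    simp
  | cons k l ih =>
    rw [List.map_cons, List.prod_cons] at hp
    induction hp using Submodule.mul_induction_on' with
    | mem_mul_mem p hp p' hp' =>
      obtain ⟨u, rfl⟩ := hp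
      obtain ⟨q, hq, h⟩ := ih hp'
      have hD := isDer_symRep u.2
      set D := symRep A M (toTensor A M u) with hD'
      refine ⟨D xi * q, ?_, fun n => ?_⟩
      · rw [map_mul, hq, symProj_symRep_xi]
        rfl
      · obtain ⟨b, hb⟩ := h (n + 1)
        have e : symRep A M (toTensor A M u * p'.1) (xi ^ ((k :: l).length + n)) =
            D (symRep A M p'.1 (xi ^ (l.length + (n + 1)))) := by
          rw [map_mul, Module.End.mul_apply, List.length_cons,
            show l.length + 1 + n = l.length + (n + 1) by omega]
        -- The inner factors leave `xi ^ (n + 1)`, so the outermost derivation contributes `n + 1`.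
        have e' : ((k :: l).length + n).descFactorial (k :: l).length =
            (n + 1) * (l.length + (n + 1)).descFactorial l.length := by
          rw [List.length_cons, Nat.descFactorial_succ,
            show l.length + 1 + n = l.length + (n + 1) by omega, Nat.add_sub_cancel_left]
        rw [e']
        exact ⟨_, (e.trans (congrArg D hb)).trans (hD.map_mul_pow_add _ n q xi b)⟩
    | add p _ p' _ h h' =>
      obtain ⟨q, hq, h⟩ := h
      obtain ⟨q', hq', h'⟩ := h'
      refine ⟨q + q', by rw [map_add, hq, hq', Prod.snd_add], fun n => ?_⟩
      obtain ⟨b, hb⟩ := h n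
      obtain ⟨b', hb'⟩ := h' n
      refine ⟨b + b', ?_⟩
      rw [Prod.fst_add, map_add, LinearMap.add_apply, hb, hb']
      ring

/-- The operator symbol of order `s` of a product of `s` Lie elements is `s!` times their product
in the symmetric algebra. -/
theorem opSymbol_genPair {l : List ℕ} {p : TensorAlgebra A M × SymmetricAlgebra A (LiePlus A M)}
    (hp : p ∈ (l.map (genPair A M)).prod) :
    opSymbol A M l.length p.1 = (l.length.factorial : A) • p.2 := by
  obtain ⟨q, hq, h⟩ := exists_symRep_eq_descFactorial hp
  obtain ⟨b, hb⟩ := h 0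
  rw [Nat.add_zero] at hb
  rw [opSymbol_apply, hb, Nat.descFactorial_self, Algebra.smul_def]
  simp [symProj_xi, hq]

end Detect

end FreeLie

end NCGeom

namespace NCGeom

/-! ### Functoriality of the NC-filtration -/

section Functoriality

variable {R S : Type u} [Ring R] [Algebra ℂ R] [Ring S] [Algebra ℂ S] (f : R →ₐ[ℂ] S)

theorem lieTerm_le_comap (k : ℕ) : lieTerm R k ≤ (lieTerm S k).comap f.toLinearMap := by
  induction k with
  | zero =>
    intro x _
    change f x ∈ lieTerm S 0
    rw [lieTerm_zero]
    trivial
  | succ k ih =>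
    rw [lieTerm_succ, Submodule.span_le]
    rintro _ ⟨x, y, hy, rfl⟩
    change f (x * y - y * x) ∈ lieTerm S (k + 1)
    rw [map_sub, map_mul, map_mul]
    have h : f y ∈ lieTerm S k := ih hy
    exact comm_mem_lieTerm_succ k (f x) h

theorem map_mem_ncFil {k : ℕ} {x : R} (hx : x ∈ ncFil R k) : f x ∈ ncFil S k := by
  refine ncFil_le (fun k => (ncFil S k).comap f.toLinearMap) (fun k => ?_) (fun i j => ?_) k hx
  · exact (lieTerm_le_comap f k).trans (Submodule.comap_mono (lieTerm_le_ncFil k))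
  · refine Submodule.mul_le.2 fun x hx y hy => ?_
    change f (x * y) ∈ ncFil S (i + j)
    rw [map_mul]
    exact mul_mem_ncFil hx hy

/-- The images of the `F^k R` form a multiplicative family. It contains the Lie terms of `S` since
commutators lift, so minimality of `F` on `S` applies. -/
theorem exists_mem_ncFil_map_eq (hf : Function.Surjective f) {k : ℕ} {y : S}
    (hy : y ∈ ncFil S k) : ∃ x ∈ ncFil R k, f x = y := by
  refine ncFil_le (fun k => (ncFil R k).map f.toLinearMap) (fun k => ?_) (fun i j => ?_) k hy
  · refine le_trans ?_ (Submodule.map_mono (lieTerm_le_ncFil k))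
    induction k with
    | zero =>
      intro y _
      obtain ⟨x, rfl⟩ := hf y
      exact ⟨x, by rw [lieTerm_zero]; trivial, rfl⟩
    | succ k ih =>
      rw [lieTerm_succ, Submodule.span_le]
      rintro _ ⟨x, y, hy, rfl⟩
      obtain ⟨x, rfl⟩ := hf x
      obtain ⟨z, hz, rfl⟩ := ih hy
      refine ⟨x * z - z * x, comm_mem_lieTerm_succ k x hz, ?_⟩
      simp
  · refine Submodule.mul_le.2 ?_
    rintro _ ⟨x, hx, rfl⟩ _ ⟨y, hy, rfl⟩
    exact ⟨x * y, mul_mem_ncFil hx hy, map_mul f x y⟩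

/-- Minimality of `F` is applied to the family that is everything in degree `0` and zero in positive
degrees. -/
theorem ncFil_eq_bot_of_commute (h : ∀ x y : R, x * y = y * x) (k : ℕ) :
    ncFil R (k + 1) = ⊥ := by
  refine le_bot_iff.1 ((ncFil_le (fun k => if k = 0 then ⊤ else ⊥) (fun k => ?_)
    (fun i j => ?_) (k + 1)).trans (by simp))
  · cases k with
    | zero => simp
    | succ k =>
      rw [lieTerm_succ, Submodule.span_le]
      rintro _ ⟨x, y, -, rfl⟩
      simp [h x y]
  · by_cases hi : i = 0
    · by_cases hj : j = 0 <;> simp [hi, hj]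
    · simp [hi]

end Functoriality

namespace FreeLie

/-! ### Weight, Lie degree and the number of Lie factors in the tensor algebra -/

section Weight

variable (A M : Type u) [CommRing A] [AddCommGroup M] [Module A M]

open Polynomial

/-- The grading of the tensor algebra, as the coaction `m ↦ m X`. -/
noncomputable def weight : TensorAlgebra A M →ₐ[A] (TensorAlgebra A M)[X] :=
  TensorAlgebra.lift A ((Polynomial.monomial 1).restrictScalars A ∘ₗ TensorAlgebra.ι A)

variable {A M}

theorem weight_ι (m : M) :
    weight A M (TensorAlgebra.ι A m) = monomial 1 (TensorAlgebra.ι A m) :=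
  TensorAlgebra.lift_ι_apply _ _

theorem weight_toTensor {k : ℕ} {u : FreeLie A M} (hu : u ∈ deg A M k) :
    weight A M (toTensor A M u) = monomial (k + 1) (toTensor A M u) := by
  refine deg_induction (p := fun k u => weight A M (toTensor A M u) =
    monomial (k + 1) (toTensor A M u)) ?_ ?_ ?_ ?_ ?_ hu
  · intro m
    rw [toTensor_of, weight_ι]
  · intro k m y _ hy
    rw [toTensor_lie, map_sub, map_mul, map_mul, hy, toTensor_of, weight_ι, monomial_mul_monomial,
      monomial_mul_monomial, map_sub, add_comm 1]
  · intro k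
    rw [map_zero, map_zero, map_zero]
  · intro k x y _ _ hx hy
    rw [map_add, map_add, hx, hy, map_add]
  · intro k a x _ hx
    rw [map_smul, map_smul, hx, smul_monomial]

variable (A M) in
/-- The products of Lie elements whose degrees are given by a list. -/
noncomputable def lieProd (l : List ℕ) : Submodule A (TensorAlgebra A M) :=
  (l.map fun k => (deg A M k).map (toTensor A M)).prod

theorem lieProd_cons (k : ℕ) (l : List ℕ) :
    lieProd A M (k :: l) = (deg A M k).map (toTensor A M) * lieProd A M l := by
  rw [lieProd, List.map_cons, List.prod_cons, lieProd]

theorem lieProd_append (l l' : List ℕ) :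
    lieProd A M (l ++ l') = lieProd A M l * lieProd A M l' := by
  rw [lieProd, List.map_append, List.prod_append, lieProd, lieProd]

/-- A Lie element of index `k` has `k + 1` tensor factors. Hence the number of Lie factors is the
weight minus the total NC-degree. -/
theorem weight_lieProd {l : List ℕ} {v : TensorAlgebra A M} (hv : v ∈ lieProd A M l) :
    weight A M v = monomial (l.sum + l.length) v := by
  induction l generalizing v with
  | nil =>
    obtain ⟨a, rfl⟩ := Submodule.mem_one.1 hv
    rw [AlgHom.commutes]
    rfl
  | cons k l ih =>
    rw [lieProd_cons] at hv
    induction hv using Submodule.mul_induction_on' with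
    | mem_mul_mem u hu v hv =>
      obtain ⟨u, hu, rfl⟩ := hu
      rw [map_mul, weight_toTensor hu, ih hv, monomial_mul_monomial, List.sum_cons,
        List.length_cons, show k + 1 + (l.sum + l.length) = k + l.sum + (l.length + 1) by omega]
    | add v _ w _ hv hw => rw [map_add, hv, hw, map_add]

variable (A M) in
/-- The ideal of the elements of weight at least `n` of the tensor algebra. -/
noncomputable def weightIdeal (n : ℕ) : Ideal (TensorAlgebra A M) where
  carrier := {t | ∀ w < n, (weight A M t).coeff w = 0}
  zero_mem' := fun w _ => by rw [map_zero, coeff_zero]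
  add_mem' := fun hx hy w hw => by rw [map_add, coeff_add, hx w hw, hy w hw, add_zero]
  smul_mem' := fun x y hy w hw => by
    rw [smul_eq_mul, map_mul, coeff_mul]
    refine Finset.sum_eq_zero fun p hp => ?_
    rw [hy p.2 (by have := Finset.HasAntidiagonal.mem_antidiagonal.1 hp; omega), mul_zero]

instance (n : ℕ) : (weightIdeal A M n).IsTwoSided where
  mul_mem_of_left {x} y hx := fun w hw => by
    rw [map_mul, coeff_mul]
    refine Finset.sum_eq_zero fun p hp => ?_
    rw [hx p.1 (by have := Finset.HasAntidiagonal.mem_antidiagonal.1 hp; omega), zero_mul]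

theorem mul_mem_weightIdeal {m n : ℕ} {x y : TensorAlgebra A M} (hx : x ∈ weightIdeal A M m)
    (hy : y ∈ weightIdeal A M n) : x * y ∈ weightIdeal A M (m + n) := fun w hw => by
  rw [map_mul, coeff_mul]
  refine Finset.sum_eq_zero fun p hp => ?_
  have hp := Finset.HasAntidiagonal.mem_antidiagonal.1 hp
  by_cases h : p.1 < m
  · rw [hx _ h, zero_mul]
  · rw [hy p.2 (by omega), mul_zero]

theorem coeff_weight_mul {m n : ℕ} {x y : TensorAlgebra A M} (hx : x ∈ weightIdeal A M m)
    (hy : y ∈ weightIdeal A M n) : (weight A M (x * y)).coeff (m + n) =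
      (weight A M x).coeff m * (weight A M y).coeff n := by
  rw [map_mul, coeff_mul, Finset.sum_eq_single (m, n)]
  · intro p hp h
    have hp := Finset.HasAntidiagonal.mem_antidiagonal.1 hp
    by_cases h' : p.1 < m
    · rw [hx _ h', zero_mul]
    · by_cases h'' : p.2 < n
      · rw [hy _ h'', mul_zero]
      · exact absurd (Prod.ext (by omega) (by omega)) h
  · intro h
    exact absurd (by simp) h

theorem weightIdeal_antitone {m n : ℕ} (h : m ≤ n) : weightIdeal A M n ≤ weightIdeal A M m :=
  fun _ hx w hw => hx w (by omega)

theorem ι_mem_weightIdeal (m : M) : TensorAlgebra.ι A m ∈ weightIdeal A M 1 := fun w hw => by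
  rw [weight_ι, coeff_monomial, if_neg (by omega)]

theorem coeff_weight_algebraMap (a : A) (w : ℕ) :
    (weight A M (algebraMap A _ a)).coeff w = if w = 0 then algebraMap A _ a else 0 := by
  rw [AlgHom.commutes]
  exact coeff_C

variable (A M) in
/-- The span of the products of Lie elements of total degree at least `i`. -/
noncomputable def lieFil (i : ℕ) : Submodule A (TensorAlgebra A M) :=
  ⨆ (l : List ℕ) (_ : i ≤ l.sum), lieProd A M l

theorem lieProd_le_lieFil {i : ℕ} {l : List ℕ} (h : i ≤ l.sum) : lieProd A M l ≤ lieFil A M i :=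
  le_iSup₂_of_le (f := fun (l : List ℕ) (_ : i ≤ l.sum) => lieProd A M l) l h le_rfl

theorem lieFil_mul_le (i j : ℕ) : lieFil A M i * lieFil A M j ≤ lieFil A M (i + j) := by
  simp only [lieFil, Submodule.iSup_mul, Submodule.mul_iSup]
  refine iSup₂_le fun l hl => iSup₂_le fun l' hl' => ?_
  rw [← lieProd_append]
  exact lieProd_le_lieFil (by rw [List.sum_append]; omega)

theorem lieFil_zero (t : TensorAlgebra A M) : t ∈ lieFil A M 0 := by
  induction t using TensorAlgebra.induction with
  | algebraMap a => exact lieProd_le_lieFil (l := []) le_rfl (Submodule.mem_one.2 ⟨a, rfl⟩)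
  | ι m =>
    refine lieProd_le_lieFil (l := [0]) le_rfl ?_
    rw [lieProd, List.map_singleton, List.prod_singleton]
    exact ⟨_, of_mem_deg m, toTensor_of m⟩
  | mul x y hx hy => exact lieFil_mul_le 0 0 (Submodule.mul_mem_mul hx hy)
  | add x y hx hy => exact add_mem hx hy

/-- The commutator with `m` is a derivation. On a product of Lie elements it replaces one factor `u`
at a time by `[m, u]`, raising the total degree by `1`. -/
theorem ι_commutator_mem_lieFil (m : M) {l : List ℕ} {v : TensorAlgebra A M}
    (hv : v ∈ lieProd A M l) : TensorAlgebra.ι A m * v - v * TensorAlgebra.ι A m ∈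
      lieFil A M (l.sum + 1) := by
  induction l generalizing v with
  | nil =>
    obtain ⟨a, rfl⟩ := Submodule.mem_one.1 hv
    rw [Algebra.commutes, sub_self]
    exact zero_mem _
  | cons k l ih =>
    rw [lieProd_cons] at hv
    induction hv using Submodule.mul_induction_on' with
    | mem_mul_mem u hu v hv =>
      obtain ⟨u, hu, rfl⟩ := hu
      have e : TensorAlgebra.ι A m * (toTensor A M u * v) - toTensor A M u * v * TensorAlgebra.ι A m
          = toTensor A M ⁅of A M m, u⁆ * v +
            toTensor A M u * (TensorAlgebra.ι A m * v - v * TensorAlgebra.ι A m) := by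
        rw [toTensor_lie, toTensor_of]
        noncomm_ring
      rw [e]
      refine add_mem ?_ ?_
      · refine lieProd_le_lieFil (l := (k + 1) :: l) (by simp only [List.sum_cons]; omega) ?_
        rw [lieProd_cons]
        exact Submodule.mul_mem_mul ⟨_, of_lie_mem_deg m hu, rfl⟩ hv
      · have hu' : toTensor A M u ∈ lieFil A M k := by
          refine lieProd_le_lieFil (l := [k]) (by simp) ?_
          rw [lieProd, List.map_singleton, List.prod_singleton]
          exact ⟨u, hu, rfl⟩
        have h := lieFil_mul_le _ _ (Submodule.mul_mem_mul hu' (ih hv))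
        rwa [List.sum_cons, add_assoc]
    | add v _ w _ hv hw =>
      rw [mul_add, add_mul, add_sub_add_comm]
      exact add_mem hv hw

theorem commutator_mem_lieFil {k : ℕ} (t : TensorAlgebra A M) {v : TensorAlgebra A M}
    (hv : v ∈ lieFil A M k) : t * v - v * t ∈ lieFil A M (k + 1) := by
  induction t using TensorAlgebra.induction with
  | algebraMap a =>
    rw [Algebra.commutes, sub_self]
    exact zero_mem _
  | ι m =>
    have h : lieFil A M k ≤ (lieFil A M (k + 1)).comap
        (LinearMap.mulLeft A (TensorAlgebra.ι A m) - LinearMap.mulRight A (TensorAlgebra.ι A m)) := by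
      refine iSup₂_le fun l hl v hv => ?_
      refine (iSup₂_le fun l' hl' => lieProd_le_lieFil ?_ :
        lieFil A M (l.sum + 1) ≤ lieFil A M (k + 1)) (ι_commutator_mem_lieFil m hv)
      omega
    exact h hv
  | mul x y hx hy =>
    -- Commutators with arbitrary tensors reduce to commutators with generators.
    have e : x * y * v - v * (x * y) = x * (y * v - v * y) + (x * v - v * x) * y := by noncomm_ring
    rw [e]
    have h₁ := lieFil_mul_le _ _ (Submodule.mul_mem_mul (lieFil_zero x) hy)
    have h₂ := lieFil_mul_le _ _ (Submodule.mul_mem_mul hx (lieFil_zero y))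
    rw [Nat.zero_add] at h₁
    exact add_mem h₁ h₂
  | add x y hx hy =>
    rw [add_mul, mul_add, add_sub_add_comm]
    exact add_mem hx hy

variable [Algebra ℂ A] [Module ℂ M] [IsScalarTower ℂ A M]

/-- The Lie filtration is multiplicative and commutators raise it by one, so it contains the Lie
terms; `F` is the smallest such family. -/
theorem ncFil_le_lieFil (i : ℕ) :
    ncFil (TensorAlgebra A M) i ≤ (lieFil A M i).restrictScalars ℂ := by
  refine ncFil_le (fun i => (lieFil A M i).restrictScalars ℂ) (fun k => ?_) (fun i j => ?_) i
  · induction k with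
    | zero => exact fun t _ => lieFil_zero t
    | succ k ih =>
      rw [lieTerm_succ, Submodule.span_le]
      rintro _ ⟨x, y, hy, rfl⟩
      exact commutator_mem_lieFil x (ih hy)
  · exact Submodule.mul_le.2 fun x hx y hy => lieFil_mul_le i j (Submodule.mul_mem_mul hx hy)

/-- In weight `i + s`, a product of Lie elements of total degree at least `i + 1` has at most `s -
1` factors, too few to act on `xi ^ s` nontrivially modulo `xi`. -/
theorem opSymbol_coeff_eq_zero {i : ℕ} {t : TensorAlgebra A M}
    (ht : t ∈ ncFil (TensorAlgebra A M) (i + 1)) (s : ℕ) :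
    opSymbol A M s ((weight A M t).coeff (i + s)) = 0 := by
  have h : lieFil A M (i + 1) ≤ LinearMap.ker (opSymbol A M s ∘ₗ
      (Polynomial.lcoeff (TensorAlgebra A M) (i + s)).restrictScalars A ∘ₗ
        (weight A M).toLinearMap) := by
    refine iSup₂_le fun l hl v hv => ?_
    change opSymbol A M s ((weight A M v).coeff (i + s)) = 0
    rw [weight_lieProd hv, coeff_monomial]
    split_ifs with h
    · exact opSymbol_eq_zero hv (by omega)
    · exact map_zero _
  exact h (ncFil_le_lieFil (i + 1) ht)

variable (A M) in
/-- The ideal which truncates the tensor algebra in weight `n` and NC-degree `d + 1`. -/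
noncomputable def truncIdeal (d n : ℕ) : Ideal (TensorAlgebra A M) :=
  weightIdeal A M n ⊔ ncIdeal (TensorAlgebra A M) (d + 1)

instance (d n : ℕ) : (truncIdeal A M d n).IsTwoSided where
  mul_mem_of_left {x} y hx := by
    obtain ⟨a, ha, b, hb, rfl⟩ := Submodule.mem_sup.1 hx
    rw [add_mul]
    exact Submodule.add_mem_sup (Ideal.mul_mem_right y _ ha) (Ideal.mul_mem_right y _ hb)

/-- Elements of `F^{d+1}` of the quotient lift to `F^{d+1}` of the tensor algebra, which is
contained in `truncIdeal`. -/
theorem isNCNilpotent_trunc (d n : ℕ) :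
    IsNCNilpotent d (TensorAlgebra A M ⧸ truncIdeal A M d n) := by
  refine (Submodule.eq_bot_iff _).2 fun y hy => ?_
  obtain ⟨x, hx, rfl⟩ := exists_mem_ncFil_map_eq (Ideal.Quotient.mkₐ ℂ (truncIdeal A M d n))
    (Ideal.Quotient.mkₐ_surjective ℂ _) hy
  exact Ideal.Quotient.eq_zero_iff_mem.2 (Submodule.mem_sup_right hx)

/-- The truncation does not disturb the symbol: weights `≥ n` do not reach weight `i + s`, and
`F^{d+1} ⊆ F^{i+1}` since `i ≤ d`. -/
theorem opSymbol_coeff_eq_zero_of_mem_ncFil {d n i s : ℕ} (hi : i ≤ d) (hn : i + s < n)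
    {t : TensorAlgebra A M} (ht : Ideal.Quotient.mk (truncIdeal A M d n) t ∈
      ncFil (TensorAlgebra A M ⧸ truncIdeal A M d n) (i + 1)) :
    opSymbol A M s ((weight A M t).coeff (i + s)) = 0 := by
  obtain ⟨x, hx, h⟩ := exists_mem_ncFil_map_eq (Ideal.Quotient.mkₐ ℂ (truncIdeal A M d n))
    (Ideal.Quotient.mkₐ_surjective ℂ _) ht
  have hsub : t - x ∈ truncIdeal A M d n := Ideal.Quotient.eq.1 h.symm
  obtain ⟨a, ha, b, hb, e⟩ := Submodule.mem_sup.1 hsub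
  have ht : t = a + (b + x) := by rw [← add_assoc, e, sub_add_cancel]
  rw [ht, map_add, coeff_add, ha _ hn, zero_add]
  exact opSymbol_coeff_eq_zero (add_mem (ncFil_antitone (by omega) hb) hx) s

end Weight

end FreeLie

end NCGeom

namespace NCGeom

open TensorProduct

theorem bilin_span_mem {A M N P : Type*} [CommRing A] [AddCommGroup M] [Module A M]
    [AddCommGroup N] [Module A N] [AddCommGroup P] [Module A P] {S : Set M} {T : Set N}
    {K : Submodule A P} (f : M →ₗ[A] N →ₗ[A] P) (h : ∀ s ∈ S, ∀ t ∈ T, f s t ∈ K) {x : M} {y : N}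
    (hx : x ∈ Submodule.span A S) (hy : y ∈ Submodule.span A T) : f x y ∈ K := by
  have hle : Submodule.map₂ f (Submodule.span A S) (Submodule.span A T) ≤ K := by
    rw [Submodule.map₂_span_span, Submodule.span_le]
    rintro _ ⟨s, hs, t, ht, rfl⟩
    exact h s hs t ht
  exact hle (Submodule.apply_mem_map₂ f hx hy)

/-! ### Products in the graded symmetric algebra -/

section Q

variable {A M : Type u} [CommRing A] [AddCommGroup M] [Module A M]

theorem prod_symGen_le_Q {l : List ℕ} {d : ℕ} (h : (l.map fun k => k + 1).sum = d) :
    (l.map fun k => symGen A M k).prod ≤ Q A M d :=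
  le_iSup₂_of_le (f := fun (l : List ℕ) (_ : (l.map fun k => k + 1).sum = d) =>
    (l.map fun k => symGen A M k).prod) l h le_rfl

theorem Q_mul_le (i j : ℕ) : Q A M i * Q A M j ≤ Q A M (i + j) := by
  simp only [Q, Submodule.iSup_mul, Submodule.mul_iSup]
  refine iSup₂_le fun l hl => iSup₂_le fun l' hl' => ?_
  rw [← List.prod_append, ← List.map_append]
  exact prod_symGen_le_Q (by rw [List.map_append, List.sum_append]; omega)

theorem algebraMap_mem_Q (a : A) : algebraMap A _ a ∈ Q A M 0 :=
  prod_symGen_le_Q (l := []) rfl (Submodule.mem_one.2 ⟨a, rfl⟩)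

theorem gen_mem_Q (k : ℕ) (u : FreeLie.deg A M (k + 1)) : FreeLie.gen k u ∈ Q A M (k + 1) := by
  refine prod_symGen_le_Q (l := [k]) rfl ?_
  rw [List.map_singleton, List.prod_singleton]
  exact ⟨u, rfl⟩

end Q

/-! ### Extension of scalars of the Poisson envelope, and brackets modulo decomposables -/

namespace Env

variable {A : Type u} [CommRing A] [Algebra ℂ A]

instance : LieRing (Env A) where
  bracket := pb
  add_lie := add_pb
  lie_add := pb_add
  lie_self := pb_self
  leibniz_lie := pb_leibniz_lie

instance : LieAlgebra ℂ (Env A) where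
  lie_smul := pb_smul

theorem lie_eq (x y : Env A) : ⁅x, y⁆ = pb x y := rfl

noncomputable instance algebraBase : Algebra A (Env A) := (ι A).toRingHom.toAlgebra

theorem base_smul_eq (a : A) (x : Env A) : a • x = ι A a * x := rfl

instance : IsScalarTower ℂ A (Env A) := ⟨fun c a x => by
  rw [base_smul_eq, base_smul_eq, map_smul, smul_mul_assoc]⟩

/-- The derivation `b ↦ {b, v}`, as a linear map on the Kähler differentials. -/
noncomputable def adDiff (v : Env A) : Ω[A⁄ℂ] →ₗ[A] Env A :=
  (Derivation.mk' ((PoissonAlgebra.bracket : Env A →ₗ[ℂ] _).flip v ∘ₗ (ι A).toLinearMap)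
    fun a b => by
      change pb (ι A (a * b)) v = ι A a * pb (ι A b) v + ι A b * pb (ι A a) v
      rw [map_mul, mul_pb, mul_comm (pb _ _)]).liftKaehlerDifferential

theorem adDiff_D (v : Env A) (b : A) : adDiff v (KaehlerDifferential.D ℂ A b) = pb (ι A b) v :=
  Derivation.liftKaehlerDifferential_comp_D _ _

variable (A) in
/-- The map `a ⊗ b ↦ a db`. -/
noncomputable def diffMap : A ⊗[ℂ] A →ₗ[A] Ω[A⁄ℂ] :=
  LinearMap.liftBaseChange A (KaehlerDifferential.D ℂ A).toLinearMap

theorem diffMap_tmul (a b : A) : diffMap A (a ⊗ₜ b) = a • KaehlerDifferential.D ℂ A b :=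
  LinearMap.liftBaseChange_tmul ..

theorem diffMap_surjective : Function.Surjective (diffMap A) := by
  rw [← LinearMap.range_eq_top, ← top_le_iff, ← KaehlerDifferential.span_range_derivation,
    Submodule.span_le]
  rintro _ ⟨b, rfl⟩
  exact ⟨1 ⊗ₜ b, by rw [diffMap_tmul, one_smul]⟩

variable (A) in
/-- The scalar extension of `A → P(A)`. -/
noncomputable def ιTensor : A ⊗[ℂ] A →ₗ[A] A ⊗[ℂ] Env A := (ι A).toLinearMap.baseChange A

theorem ιTensor_tmul (a b : A) : ιTensor A (a ⊗ₜ b) = a ⊗ₜ ι A b := rfl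

variable (A) in
/-- The multiplication map `A ⊗ P(A) → P(A)`. -/
noncomputable def contract : A ⊗[ℂ] Env A →ₗ[A] Env A :=
  LinearMap.liftBaseChange A LinearMap.id

theorem contract_tmul (a : A) (x : Env A) : contract A (a ⊗ₜ x) = ι A a * x :=
  LinearMap.liftBaseChange_tmul ..

variable (A) in
/-- The scalar extension of `P^k(A)`, as a submodule. -/
noncomputable def tensorDeg (k : ℕ) : Submodule A (A ⊗[ℂ] Env A) :=
  Submodule.span A {z | ∃ y ∈ deg A k, 1 ⊗ₜ y = z}

theorem ιTensor_mem (w : A ⊗[ℂ] A) : ιTensor A w ∈ tensorDeg A 0 := by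
  induction w with
  | zero => rw [map_zero]; exact zero_mem _
  | tmul a b =>
    rw [ιTensor_tmul, ← mul_one a, ← smul_eq_mul, ← smul_tmul']
    exact Submodule.smul_mem _ _ (Submodule.subset_span ⟨_, ι_mem_deg b, rfl⟩)
  | add x y hx hy => rw [map_add]; exact add_mem hx hy

theorem tensor_lie_add (x y z : A ⊗[ℂ] Env A) : ⁅x, y + z⁆ = ⁅x, y⁆ + ⁅x, z⁆ :=
  LieRing.lie_add x y z

theorem tensor_lie_smul (a : A) (x y : A ⊗[ℂ] Env A) : ⁅x, a • y⁆ = a • ⁅x, y⁆ :=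
  LieAlgebra.lie_smul a x y

theorem tensor_lie_zero (x : A ⊗[ℂ] Env A) : ⁅x, (0 : A ⊗[ℂ] Env A)⁆ = 0 := by
  have h := tensor_lie_smul 0 x 0
  rwa [zero_smul, zero_smul] at h

variable (A) in
/-- The bracket of `A ⊗ P(A)`, as a bilinear map. -/
noncomputable def tensorBracket : A ⊗[ℂ] Env A →ₗ[A] A ⊗[ℂ] Env A →ₗ[A] A ⊗[ℂ] Env A :=
  LinearMap.mk₂ A (fun x y => ⁅x, y⁆) add_lie smul_lie tensor_lie_add tensor_lie_smul

theorem lie_mem_tensorDeg {j k : ℕ} {x y : A ⊗[ℂ] Env A} (hx : x ∈ tensorDeg A j)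
    (hy : y ∈ tensorDeg A k) : ⁅x, y⁆ ∈ tensorDeg A (j + k + 1) := by
  refine bilin_span_mem (tensorBracket A) ?_ hx hy
  rintro _ ⟨x, hx, rfl⟩ _ ⟨y, hy, rfl⟩
  change ⁅(1 : A) ⊗ₜ[ℂ] x, (1 : A) ⊗ₜ[ℂ] y⁆ ∈ _
  rw [LieAlgebra.ExtendScalars.bracket_tmul, mul_one]
  exact Submodule.subset_span ⟨_, pb_mem_deg hx hy, rfl⟩

theorem contract_mem_deg {k : ℕ} {z : A ⊗[ℂ] Env A} (hz : z ∈ tensorDeg A k) :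
    contract A z ∈ deg A k := by
  induction hz using Submodule.span_induction with
  | mem z hz =>
    obtain ⟨y, hy, rfl⟩ := hz
    rw [contract_tmul]
    exact ι_mul_mem_deg _ hy
  | zero => rw [map_zero]; exact zero_mem _
  | add x y _ _ hx hy => rw [map_add]; exact add_mem hx hy
  | smul a x _ hx => rw [map_smul]; exact ι_mul_mem_deg _ hx

/-- The bracket of `P(A)` fails to be `A`-linear in its second argument by `{b, c} y`. This is
decomposable because `y` has positive degree, so modulo `dec` contraction intertwines the bracket
with `w` and the operator defined by the differential of `w`. -/
theorem contract_lie_sub_mem_dec {k : ℕ} (w : A ⊗[ℂ] A) {z : A ⊗[ℂ] Env A}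
    (hz : z ∈ tensorDeg A (k + 1)) :
    contract A ⁅ιTensor A w, z⁆ - adDiff (contract A z) (diffMap A w) ∈ dec A (k + 1 + 1) := by
  induction w with
  | zero => simp
  | add x y hx hy =>
    rw [map_add, add_lie, map_add, map_add, map_add, add_sub_add_comm]
    exact add_mem hx hy
  | tmul a b =>
    rw [diffMap_tmul, map_smul, adDiff_D, ιTensor_tmul, base_smul_eq]
    induction hz using Submodule.span_induction with
    | mem z hz =>
      obtain ⟨y, hy, rfl⟩ := hz
      rw [LieAlgebra.ExtendScalars.bracket_tmul, contract_tmul, contract_tmul, map_one, one_mul,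
        mul_one, lie_eq, sub_self]
      exact zero_mem _
    | zero => simp [pb, tensor_lie_zero]
    | add x y _ _ hx hy =>
      rw [tensor_lie_add, map_add, map_add, pb_add, mul_add, add_sub_add_comm]
      exact add_mem hx hy
    | smul c z hz ih =>
      have e : contract A ⁅a ⊗ₜ[ℂ] ι A b, c • z⁆ - ι A a * pb (ι A b) (contract A (c • z)) =
          ι A c * (contract A ⁅a ⊗ₜ[ℂ] ι A b, z⁆ - ι A a * pb (ι A b) (contract A z)) -
            ι A a * (pb (ι A b) (ι A c) * contract A z) := by
        rw [tensor_lie_smul, map_smul, map_smul, base_smul_eq, base_smul_eq, pb_mul]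
        ring
      rw [e]
      refine sub_mem (ι_mul_mem_dec _ ih) (ι_mul_mem_dec _ (mul_mem_dec (i := 0) (j := k)
        (by omega) ?_ (contract_mem_deg hz)))
      exact pb_mem_deg_of_eq (by omega) (ι_mem_deg b) (ι_mem_deg c)

/-- For two elements of degree `0` the correction terms are not decomposable, so an exact formula is
needed. Contraction turns each argument in turn into a derivation evaluated on a differential, so
only `diffMap w` and `diffMap w'` matter. -/
theorem contract_lie_ιTensor {w w' : A ⊗[ℂ] A} {a a' : A}
    (hw : diffMap A w = KaehlerDifferential.D ℂ A a)
    (hw' : diffMap A w' = KaehlerDifferential.D ℂ A a') :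
    contract A ⁅ιTensor A w, ιTensor A w'⁆ = pb (ι A a) (ι A a') := by
  have h₁ : ∀ (b c : A) (w : A ⊗[ℂ] A), contract A ⁅ιTensor A w, ιTensor A (b ⊗ₜ c)⁆ =
      ι A b * adDiff (ι A c) (diffMap A w) := by
    intro b c w
    induction w with
    | zero => simp
    | tmul x y =>
      rw [ιTensor_tmul, ιTensor_tmul, LieAlgebra.ExtendScalars.bracket_tmul, contract_tmul,
        diffMap_tmul, map_smul, adDiff_D, base_smul_eq, lie_eq, map_mul]
      ring
    | add x y hx hy => rw [map_add, add_lie, map_add, hx, hy, map_add, map_add, mul_add]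
  have h₂ : ∀ w' : A ⊗[ℂ] A, contract A ⁅ιTensor A w, ιTensor A w'⁆ =
      -adDiff (ι A a) (diffMap A w') := by
    intro w'
    induction w' with
    | zero => simp [tensor_lie_zero]
    | tmul b c =>
      rw [h₁, hw, adDiff_D, diffMap_tmul, map_smul, adDiff_D, base_smul_eq, pb_antisymm]
      ring
    | add x y hx hy => rw [map_add, tensor_lie_add, map_add, hx, hy, map_add, map_add, neg_add]
  rw [h₂, hw', adDiff_D, ← pb_antisymm]

/-! ### The map from the symmetric algebra of the free Lie algebra onto the Poisson envelope -/

section Section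

variable (σ : Ω[A⁄ℂ] →ₗ[A] A ⊗[ℂ] A)

/-- The homomorphism from the free Lie algebra of the differentials which is defined by a section
of `a ⊗ b ↦ a db`. -/
noncomputable def lieToTensor : FreeLie A (Ω[A⁄ℂ]) →ₗ[A] A ⊗[ℂ] Env A :=
  (FreeLie.lift (ιTensor A ∘ₗ σ) : FreeLie A (Ω[A⁄ℂ]) →ₗ⁅A⁆ A ⊗[ℂ] Env A)

theorem lieToTensor_of (m : Ω[A⁄ℂ]) : lieToTensor σ (FreeLie.of A _ m) = ιTensor A (σ m) :=
  FreeLie.lift_of _ m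

theorem lieToTensor_lie (x y : FreeLie A (Ω[A⁄ℂ])) :
    lieToTensor σ ⁅x, y⁆ = ⁅lieToTensor σ x, lieToTensor σ y⁆ :=
  (FreeLie.lift (ιTensor A ∘ₗ σ) : FreeLie A (Ω[A⁄ℂ]) →ₗ⁅A⁆ A ⊗[ℂ] Env A).map_lie x y

theorem lieToTensor_mem {k : ℕ} {u : FreeLie A (Ω[A⁄ℂ])} (hu : u ∈ FreeLie.deg A _ k) :
    lieToTensor σ u ∈ tensorDeg A k := by
  refine FreeLie.deg_induction (p := fun k u => lieToTensor σ u ∈ tensorDeg A k)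
    ?_ ?_ ?_ ?_ ?_ hu
  · intro m
    rw [lieToTensor_of]
    exact ιTensor_mem _
  · intro k m y _ hy
    rw [lieToTensor_lie, lieToTensor_of]
    have h := lie_mem_tensorDeg (ιTensor_mem (σ m)) hy
    rwa [Nat.zero_add] at h
  · intro k
    rw [map_zero]
    exact zero_mem _
  · intro k x y _ _ hx hy
    rw [map_add]
    exact add_mem hx hy
  · intro k a x _ hx
    rw [map_smul]
    exact Submodule.smul_mem _ _ hx

/-- The map `Lie_A(Ω) → P(A)` which is defined by a section of `a ⊗ b ↦ a db`. -/
noncomputable def lieToEnv : FreeLie A (Ω[A⁄ℂ]) →ₗ[A] Env A := contract A ∘ₗ lieToTensor σ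

variable {σ}

theorem lieToEnv_lie_sub_mem (hσ : diffMap A ∘ₗ σ = LinearMap.id) (a : A) {k : ℕ} {u : FreeLie A (Ω[A⁄ℂ])}
    (hu : u ∈ FreeLie.deg A _ (k + 1)) :
    lieToEnv σ ⁅FreeLie.of A _ (KaehlerDifferential.D ℂ A a), u⁆ - pb (ι A a) (lieToEnv σ u) ∈
      dec A (k + 1 + 1) := by
  have h := contract_lie_sub_mem_dec (σ (KaehlerDifferential.D ℂ A a)) (lieToTensor_mem σ hu)
  rwa [← LinearMap.comp_apply (diffMap A), hσ, LinearMap.id_apply, adDiff_D, ← lieToTensor_of,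
    ← lieToTensor_lie] at h

theorem lieToEnv_lie_D (hσ : diffMap A ∘ₗ σ = LinearMap.id) (a b : A) :
    lieToEnv σ ⁅FreeLie.of A _ (KaehlerDifferential.D ℂ A a),
      FreeLie.of A _ (KaehlerDifferential.D ℂ A b)⁆ = pb (ι A a) (ι A b) := by
  rw [lieToEnv, LinearMap.comp_apply, lieToTensor_lie, lieToTensor_of, lieToTensor_of]
  exact contract_lie_ιTensor (LinearMap.congr_fun hσ _) (LinearMap.congr_fun hσ _)

/-- The witness is the same right-normed bracket with each letter `a` replaced by `da`. The
innermost bracket is matched exactly; each further one adds a decomposable error. -/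
theorem exists_lieToEnv_sub_mem_dec (hσ : diffMap A ∘ₗ σ = LinearMap.id) {k : ℕ} {x : Env A}
    (hx : IsWord (k + 1) x) :
    ∃ u ∈ FreeLie.deg A (Ω[A⁄ℂ]) (k + 1), x - lieToEnv σ u ∈ dec A (k + 1) := by
  induction k generalizing x with
  | zero =>
    obtain _ | ⟨a, hx⟩ := hx
    obtain ⟨b⟩ := hx
    refine ⟨_, FreeLie.of_lie_mem_deg (KaehlerDifferential.D ℂ A a)
      (FreeLie.of_mem_deg (KaehlerDifferential.D ℂ A b)), ?_⟩
    rw [lieToEnv_lie_D hσ, sub_self]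
    exact zero_mem _
  | succ k ih =>
    obtain _ | @⟨_, a, x, hx⟩ := hx
    obtain ⟨u, hu, h⟩ := ih hx
    refine ⟨_, FreeLie.of_lie_mem_deg (KaehlerDifferential.D ℂ A a) hu, ?_⟩
    have h₁ := lieToEnv_lie_sub_mem hσ a hu
    have h₂ := pb_dec_mem (ι_mem_deg a) h
    have e : pb (ι A a) (x - lieToEnv σ u) = pb (ι A a) x - pb (ι A a) (lieToEnv σ u) :=
      map_sub (PoissonAlgebra.bracket (ι A a)) _ _
    rw [Nat.zero_add, e] at h₂
    have h₃ := sub_mem h₂ h₁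
    rwa [sub_sub_sub_cancel_right] at h₃

variable (σ) in
/-- The map from the symmetric algebra of `Lie_+(Ω)` to `P(A)`. -/
noncomputable def symToEnv : SymmetricAlgebra A (LiePlus A (Ω[A⁄ℂ])) →ₐ[A] Env A :=
  SymmetricAlgebra.lift (DirectSum.toModule A ℕ (Env A) fun k =>
    lieToEnv σ ∘ₗ (FreeLie.deg A (Ω[A⁄ℂ]) (k + 1)).subtype)

theorem symToEnv_gen (k : ℕ) (u : FreeLie.deg A (Ω[A⁄ℂ]) (k + 1)) :
    symToEnv σ (FreeLie.gen k u) = lieToEnv σ u := by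
  rw [symToEnv, FreeLie.gen, LinearMap.comp_apply, SymmetricAlgebra.lift_ι_apply,
    DirectSum.toModule_lof]
  rfl

theorem exists_symToEnv_eq (hσ : diffMap A ∘ₗ σ = LinearMap.id) {i : ℕ} {x : Env A} (hx : x ∈ deg A i) :
    ∃ q ∈ Q A (Ω[A⁄ℂ]) i, symToEnv σ q = x := by
  have key : ∀ i, deg A i ≤ ((Q A (Ω[A⁄ℂ]) i).map (symToEnv σ).toLinearMap).restrictScalars ℂ := by
    intro i
    -- Decomposables of degree `i` are products of elements of smaller degree, so they are covered
    -- by induction; words are covered up to decomposables.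
    induction i using Nat.strong_induction_on with
    | _ i ih =>
      have hdec : dec A i ≤
          ((Q A (Ω[A⁄ℂ]) i).map (symToEnv σ).toLinearMap).restrictScalars ℂ := by
        refine Submodule.span_le.2 ?_
        rintro _ ⟨j, k, rfl, x, hx, y, hy, rfl⟩
        obtain ⟨p, hp, rfl⟩ := ih (j + 1) (by omega) hx
        obtain ⟨q, hq, rfl⟩ := ih (k + 1) (by omega) hy
        exact ⟨p * q, Q_mul_le _ _ (Submodule.mul_mem_mul hp hq), map_mul (symToEnv σ) p q⟩
      refine (deg_le_wordDec i).trans (sup_le (Submodule.span_le.2 ?_) hdec)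
      rintro _ ⟨a, w, hw, rfl⟩
      refine Submodule.smul_mem ((Q A (Ω[A⁄ℂ]) i).map (symToEnv σ).toLinearMap) a ?_
      cases i with
      | zero =>
        obtain ⟨b⟩ := hw
        exact ⟨algebraMap A _ b, algebraMap_mem_Q b, AlgHom.commutes _ _⟩
      | succ i =>
        obtain ⟨u, hu, h⟩ := exists_lieToEnv_sub_mem_dec hσ hw
        have h' := add_mem (hdec h) (⟨_, gen_mem_Q i ⟨u, hu⟩, symToEnv_gen i ⟨u, hu⟩⟩ :
          lieToEnv σ u ∈ (Q A (Ω[A⁄ℂ]) (i + 1)).map (symToEnv σ).toLinearMap)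
        rwa [sub_add_cancel] at h'
  exact key i hx

end Section

end Env

end NCGeom

namespace NCGeom

open TensorProduct

/-! ### Consequences of `d`-smoothness for the commutativization -/

section Smooth

theorem isNCNilpotent_of_commute {S : Type u} [Ring S] [Algebra ℂ S]
    (h : ∀ x y : S, x * y = y * x) (d : ℕ) : IsNCNilpotent d S := ncFil_eq_bot_of_commute h d

variable {R : Type u} [Ring R] [Algebra ℂ R] {d : ℕ}

/-- Commutative algebras belong to every `N_d`, and a homomorphism from `R` to a commutative algebra
factors through `R_ab`. -/
theorem IsDSmooth.formallySmooth_Rab (hR : IsDSmooth d R) :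
    Algebra.FormallySmooth ℂ (Rab R) := by
  refine Algebra.FormallySmooth.of_comp_surjective fun B _ _ I hI f => ?_
  have hnil : IsNilpotent (LinearMap.ker (Ideal.Quotient.mkₐ ℂ I).toLinearMap) := by
    refine ⟨2, le_bot_iff.1 ?_⟩
    rw [pow_two, Submodule.mul_le]
    intro x hx y hy
    have hx : x ∈ I := Ideal.Quotient.eq_zero_iff_mem.1 hx
    have hy : y ∈ I := Ideal.Quotient.eq_zero_iff_mem.1 hy
    have h : x * y ∈ I ^ 2 := by
      rw [pow_two]
      exact Ideal.mul_mem_mul hx hy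
    rw [hI] at h
    exact h
  obtain ⟨g, hg⟩ := hR.formallySmooth B (B ⧸ I) (isNCNilpotent_of_commute mul_comm d)
    (isNCNilpotent_of_commute mul_comm d) (Ideal.Quotient.mkₐ ℂ I)
    (Ideal.Quotient.mkₐ_surjective ℂ I) hnil (f.comp (Ideal.Quotient.mkₐ ℂ (ncIdeal R 1)))
  refine ⟨Ideal.Quotient.liftₐ (ncIdeal R 1) g fun x hx => ?_, ?_⟩
  · have h := map_mem_ncFil g (k := 1) hx
    rw [ncFil_eq_bot_of_commute mul_comm] at h
    exact h
  · refine AlgHom.ext fun a => ?_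
    obtain ⟨r, rfl⟩ := Ideal.Quotient.mk_surjective a
    exact DFunLike.congr_fun hg r

/-- Differentials of a formally smooth algebra form a projective module. -/
theorem IsDSmooth.exists_section (hR : IsDSmooth d R) :
    ∃ σ : Ω[Rab R⁄ℂ] →ₗ[Rab R] Rab R ⊗[ℂ] Rab R, Env.diffMap (Rab R) ∘ₗ σ = LinearMap.id := by
  have := hR.formallySmooth_Rab
  exact Module.projective_lifting_property _ _ Env.diffMap_surjective

end Smooth

namespace FreeLie

/-! ### Nilpotent truncations of the tensor algebra -/

section Trunc

variable {A M : Type u} [CommRing A] [AddCommGroup M] [Module A M]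

/-- Positive total degree forces at least one Lie factor, so the weight exceeds the degree. -/
theorem lieFil_le_weightIdeal (i : ℕ) :
    lieFil A M (i + 1) ≤ (weightIdeal A M (i + 2)).restrictScalars A := by
  refine iSup₂_le fun l hl v hv w hw => ?_
  have hl' : l ≠ [] := by
    rintro rfl
    simp at hl
  have := List.length_pos_iff.2 hl'
  rw [weight_lieProd hv, Polynomial.coeff_monomial, if_neg (by omega)]

theorem quotient_weightIdeal_two_comm (x y : TensorAlgebra A M ⧸ weightIdeal A M 2) :
    x * y = y * x := by
  obtain ⟨x, rfl⟩ := Ideal.Quotient.mk_surjective x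
  obtain ⟨y, rfl⟩ := Ideal.Quotient.mk_surjective y
  rw [← map_mul, ← map_mul]
  exact Ideal.Quotient.eq.2 (lieFil_le_weightIdeal 0 (commutator_mem_lieFil x (lieFil_zero y)))

variable [Algebra ℂ A] [Module ℂ M] [IsScalarTower ℂ A M]

theorem truncIdeal_le_weightIdeal_two (d : ℕ) {n : ℕ} (hn : 2 ≤ n) :
    truncIdeal A M d n ≤ weightIdeal A M 2 := by
  refine sup_le (weightIdeal_antitone hn) fun x hx => ?_
  exact weightIdeal_antitone (by omega) (lieFil_le_weightIdeal d (ncFil_le_lieFil _ hx))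

variable (A M) in
/-- The projection of the truncated tensor algebra onto the truncation in weight `2`. -/
noncomputable def truncProj (d : ℕ) {n : ℕ} (hn : 2 ≤ n) :
    TensorAlgebra A M ⧸ truncIdeal A M d n →ₐ[ℂ] TensorAlgebra A M ⧸ weightIdeal A M 2 :=
  Ideal.Quotient.liftₐ _ (Ideal.Quotient.mkₐ ℂ (weightIdeal A M 2)) fun _ hx =>
    Ideal.Quotient.eq_zero_iff_mem.2 (truncIdeal_le_weightIdeal_two d hn hx)

theorem truncProj_mk (d : ℕ) {n : ℕ} (hn : 2 ≤ n) (t : TensorAlgebra A M) :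
    truncProj A M d hn (Ideal.Quotient.mk _ t) = Ideal.Quotient.mk _ t := rfl

theorem truncProj_surjective (d : ℕ) {n : ℕ} (hn : 2 ≤ n) :
    Function.Surjective (truncProj A M d hn) := fun y => by
  obtain ⟨t, rfl⟩ := Ideal.Quotient.mk_surjective y
  exact ⟨_, truncProj_mk d hn t⟩

/-- The `k`-th power of the kernel lifts to weight at least `2 * k`; the `n`-th power therefore
falls into the truncated part. -/
theorem isNilpotent_ker_truncProj (d : ℕ) {n : ℕ} (hn : 2 ≤ n) :
    IsNilpotent (LinearMap.ker (truncProj A M d hn).toLinearMap) := by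
  have key : ∀ k, LinearMap.ker (truncProj A M d hn).toLinearMap ^ k ≤
      ((weightIdeal A M (2 * k)).restrictScalars ℂ).map
        (Ideal.Quotient.mkₐ ℂ (truncIdeal A M d n)).toLinearMap := by
    intro k
    induction k with
    | zero =>
      intro x _
      obtain ⟨t, rfl⟩ := Ideal.Quotient.mk_surjective x
      exact ⟨t, fun w hw => absurd hw (Nat.not_lt_zero w), rfl⟩
    | succ k ih =>
      rw [pow_succ, Submodule.mul_le]
      intro x hx y hy
      obtain ⟨x, hx', rfl⟩ := ih hx
      obtain ⟨y, rfl⟩ := Ideal.Quotient.mk_surjective y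
      have hy : y ∈ weightIdeal A M 2 := Ideal.Quotient.eq_zero_iff_mem.1 hy
      exact ⟨x * y, mul_mem_weightIdeal hx' hy,
        map_mul (Ideal.Quotient.mkₐ ℂ (truncIdeal A M d n)) x y⟩
  refine ⟨n, le_bot_iff.1 ((key n).trans ?_)⟩
  rintro _ ⟨t, ht, rfl⟩
  exact Ideal.Quotient.eq_zero_iff_mem.2
    (Submodule.mem_sup_left (weightIdeal_antitone (by omega) ht))

end Trunc

/-! ### The first-order jet -/

section Universal

variable (A : Type u) [CommRing A] [Algebra ℂ A]

/-- The homomorphism `a ↦ a + da`. -/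
noncomputable def oneJet :
    A →ₐ[ℂ] TensorAlgebra A (Ω[A⁄ℂ]) ⧸ weightIdeal A (Ω[A⁄ℂ]) 2 where
  toFun a := Ideal.Quotient.mk (weightIdeal A (Ω[A⁄ℂ]) 2)
    (algebraMap A (TensorAlgebra A (Ω[A⁄ℂ])) a +
      TensorAlgebra.ι A (KaehlerDifferential.D ℂ A a))
  map_one' := by simp
  map_zero' := by simp
  map_add' a b := by
    rw [← map_add]
    congr 1
    simp only [map_add]
    abel
  map_mul' a b := by
    rw [← map_mul]
    refine Ideal.Quotient.eq.2 ?_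
    -- Multiplicativity fails exactly by `-da · db`, which has weight `2`.
    have h := mul_mem_weightIdeal (ι_mem_weightIdeal (A := A) (KaehlerDifferential.D ℂ A a))
      (ι_mem_weightIdeal (A := A) (KaehlerDifferential.D ℂ A b))
    convert neg_mem h using 1
    rw [map_mul, Derivation.leibniz, map_add, map_smul, map_smul, Algebra.smul_def,
      Algebra.smul_def, Algebra.commutes b]
    noncomm_ring
  commutes' c := by
    rw [Derivation.map_algebraMap, map_zero, add_zero]
    rfl

end Universal

end FreeLie

open FreeLie

theorem algebraMap_add_commutator {A T : Type*} [CommRing A] [Ring T] [Algebra A T] (a b : A)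
    (t s : T) : (algebraMap A T a + t) * (algebraMap A T b + s) -
      (algebraMap A T b + s) * (algebraMap A T a + t) = t * s - s * t := by
  rw [add_mul, add_mul, mul_add, mul_add, mul_add, mul_add, Algebra.commutes a s,
    Algebra.commutes b t, ← map_mul, ← map_mul, mul_comm b a]
  abel

/-! ### Jets of `R` and their leading components -/

section Jets

variable {R : Type u} [Ring R] [Algebra ℂ R] {d : ℕ}

/-- The projection to weights below `2` is a surjection in `N_d` with nilpotent kernel, so `a ↦ a +
da` lifts along it. -/
theorem IsDSmooth.exists_jet (hR : IsDSmooth d R) {n : ℕ} (hn : 2 ≤ n) :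
    ∃ g : R →ₐ[ℂ] TensorAlgebra (Rab R) (Ω[Rab R⁄ℂ]) ⧸ truncIdeal (Rab R) (Ω[Rab R⁄ℂ]) d n,
      ∀ r, ∃ t, Ideal.Quotient.mk _ t = g r ∧ t - (algebraMap (Rab R) _ (Ideal.Quotient.mk _ r) +
        TensorAlgebra.ι _ (KaehlerDifferential.D ℂ (Rab R) (Ideal.Quotient.mk _ r))) ∈
          weightIdeal (Rab R) (Ω[Rab R⁄ℂ]) 2 := by
  obtain ⟨g, hg⟩ := hR.formallySmooth _ _ (isNCNilpotent_trunc d n)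
    (isNCNilpotent_of_commute quotient_weightIdeal_two_comm d) (truncProj _ _ d hn)
    (truncProj_surjective d hn) (isNilpotent_ker_truncProj d hn)
    ((oneJet (Rab R)).comp (Ideal.Quotient.mkₐ ℂ (ncIdeal R 1)))
  refine ⟨g, fun r => ?_⟩
  obtain ⟨t, ht⟩ := Ideal.Quotient.mk_surjective (g r)
  refine ⟨t, ht, Ideal.Quotient.eq.1 ?_⟩
  have h : truncProj _ _ d hn (g r) = oneJet (Rab R) (Ideal.Quotient.mk _ r) :=
    DFunLike.congr_fun hg r
  rw [← ht, truncProj_mk] at h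
  exact h

variable {n : ℕ}
  (g : R →ₐ[ℂ] TensorAlgebra (Rab R) (Ω[Rab R⁄ℂ]) ⧸ truncIdeal (Rab R) (Ω[Rab R⁄ℂ]) d n)

/-- The element `z` of `gr^i_F(R)` is the symbol of an element of `R` whose image in the truncated
tensor algebra has weight at least `w`, with component `v` in weight `w`. -/
def HasLeading (i w : ℕ) (z : Gr R) (v : TensorAlgebra (Rab R) (Ω[Rab R⁄ℂ])) : Prop :=
  ∃ (x : R) (hx : x ∈ ncFil R i) (t : TensorAlgebra (Rab R) (Ω[Rab R⁄ℂ])),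
    Gr.symb R i ⟨x, hx⟩ = z ∧ Ideal.Quotient.mk _ t = g x ∧
      t ∈ weightIdeal (Rab R) (Ω[Rab R⁄ℂ]) w ∧ (weight _ _ t).coeff w = v

/-- The lift `g` of the identification modulo weight `2`. -/
def IsJet : Prop :=
  ∀ r, ∃ t, Ideal.Quotient.mk _ t = g r ∧ t - (algebraMap (Rab R) _ (Ideal.Quotient.mk _ r) +
    TensorAlgebra.ι _ (KaehlerDifferential.D ℂ (Rab R) (Ideal.Quotient.mk _ r))) ∈
      weightIdeal (Rab R) (Ω[Rab R⁄ℂ]) 2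

variable {g}

theorem HasLeading.zero (i w : ℕ) : HasLeading g i w 0 0 :=
  ⟨0, zero_mem _, 0, map_zero (Gr.symb R i), by rw [map_zero, map_zero], zero_mem _, by simp⟩

theorem HasLeading.add {i w : ℕ} {z z' : Gr R} {v v' : TensorAlgebra (Rab R) (Ω[Rab R⁄ℂ])}
    (h : HasLeading g i w z v) (h' : HasLeading g i w z' v') :
    HasLeading g i w (z + z') (v + v') := by
  obtain ⟨x, hx, t, rfl, ht, hw, rfl⟩ := h
  obtain ⟨x', hx', t', rfl, ht', hw', rfl⟩ := h'
  exact ⟨x + x', add_mem hx hx', t + t', map_add (Gr.symb R i) ⟨x, hx⟩ ⟨x', hx'⟩,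
    by rw [map_add, map_add, ht, ht'], add_mem hw hw', by rw [map_add, Polynomial.coeff_add]⟩

theorem HasLeading.congr {i j w w' : ℕ} (hi : i = j) (hw : w = w') {z z' : Gr R}
    {v v' : TensorAlgebra (Rab R) (Ω[Rab R⁄ℂ])} (hz : z = z') (hv : v = v')
    (h : HasLeading g i w z v) : HasLeading g j w' z' v' := by
  subst hi hw hz hv
  exact h

theorem HasLeading.mul {i j w w' : ℕ} {z z' : Gr R} {v v' : TensorAlgebra (Rab R) (Ω[Rab R⁄ℂ])}
    (h : HasLeading g i w z v) (h' : HasLeading g j w' z' v') :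
    HasLeading g (i + j) (w + w') (z * z') (v * v') := by
  obtain ⟨x, hx, t, rfl, ht, hw, rfl⟩ := h
  obtain ⟨x', hx', t', rfl, ht', hw', rfl⟩ := h'
  exact ⟨x * x', mul_mem_ncFil hx hx', t * t', (Gr.symb_mul i j hx hx').symm,
    by rw [map_mul, map_mul, ht, ht'], mul_mem_weightIdeal hw hw', coeff_weight_mul hw hw'⟩

/-- Used for products with more than `s` factors: their leading weight lies above `i + s`, so they
contribute nothing in weight `i + s`. -/
theorem HasLeading.of_lt {i w w' : ℕ} (hw : w' < w) {z : Gr R}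
    {v : TensorAlgebra (Rab R) (Ω[Rab R⁄ℂ])} (h : HasLeading g i w z v) :
    HasLeading g i w' z 0 := by
  obtain ⟨x, hx, t, rfl, ht, ht', rfl⟩ := h
  exact ⟨x, hx, t, rfl, ht, weightIdeal_antitone hw.le ht', ht' _ hw⟩

theorem IsJet.hasLeading_ofRab (hg : IsJet g) (a : Rab R) :
    HasLeading g 0 0 (Gr.ofRab R a) (algebraMap _ _ a) := by
  obtain ⟨r, rfl⟩ := Ideal.Quotient.mk_surjective a
  obtain ⟨t, ht, ht'⟩ := hg r
  refine ⟨r, Gr.mem_ncFil_zero r, t, (Gr.ofRab_mk r).symm, ht,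
    fun w hw => absurd hw (Nat.not_lt_zero w), ?_⟩
  have h := ht' 0 (by norm_num)
  rwa [map_sub, map_add, Polynomial.coeff_sub, Polynomial.coeff_add, coeff_weight_algebraMap,
    if_pos rfl, ι_mem_weightIdeal _ 0 one_pos, add_zero, sub_eq_zero] at h

/-- An element of degree `0`, up to a constant. -/
theorem IsJet.exists_leading (hg : IsJet g) (a : Rab R) :
    ∃ (x : R) (t : TensorAlgebra (Rab R) (Ω[Rab R⁄ℂ])),
    Gr.symb R 0 ⟨x, Gr.mem_ncFil_zero x⟩ = Gr.ofRab R a ∧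
      Ideal.Quotient.mk (truncIdeal (Rab R) (Ω[Rab R⁄ℂ]) d n) (algebraMap _ _ a + t) = g x ∧
        t ∈ weightIdeal (Rab R) (Ω[Rab R⁄ℂ]) 1 ∧
        (weight _ _ t).coeff 1 = TensorAlgebra.ι _ (KaehlerDifferential.D ℂ _ a) := by
  obtain ⟨r, rfl⟩ := Ideal.Quotient.mk_surjective a
  obtain ⟨t, ht, ht'⟩ := hg r
  refine ⟨r, t - algebraMap _ _ (Ideal.Quotient.mk (ncIdeal R 1) r), (Gr.ofRab_mk r).symm, ?_, ?_, ?_⟩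
  · rw [add_sub_cancel, ht]
  · have h := add_mem (weightIdeal_antitone one_le_two ht')
      (ι_mem_weightIdeal (KaehlerDifferential.D ℂ (Rab R) (Ideal.Quotient.mk _ r)))
    rwa [← sub_sub, sub_add_cancel] at h
  · have h := ht' 1 (by norm_num)
    rwa [← sub_sub, map_sub, Polynomial.coeff_sub, weight_ι, Polynomial.coeff_monomial, if_pos rfl,
      sub_eq_zero] at h

/-- The lift of `a` is `a + da + …`, and the constant `a` is central in `T_A(Ω)`. It drops out of
the commutator, so the weight rises by one and `da` becomes the leading letter. -/
theorem HasLeading.pb_ofRab {i w : ℕ} {z : Gr R} {v : TensorAlgebra (Rab R) (Ω[Rab R⁄ℂ])}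
    (hg : IsJet g) (a : Rab R) (h : HasLeading g i w z v) :
    HasLeading g (i + 1) (w + 1) (pb (Gr.ofRab R a) z)
      (TensorAlgebra.ι _ (KaehlerDifferential.D ℂ _ a) * v -
        v * TensorAlgebra.ι _ (KaehlerDifferential.D ℂ _ a)) := by
  obtain ⟨x, t, hx, ht, hw, hv⟩ := hg.exists_leading a
  obtain ⟨y, hy, s, rfl, hs, hw', rfl⟩ := h
  have hc := comm_mem_ncFil (Gr.mem_ncFil_zero x) hy
  rw [Nat.zero_add] at hc
  refine ⟨_, hc, t * s - s * t, ?_, ?_, ?_, ?_⟩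
  · rw [← hx, Gr.pb_symb]
    exact Gr.symb_congr (by omega) _ _ rfl
  · have h := algebraMap_add_commutator a 0 t s
    rw [map_zero, zero_add] at h
    rw [map_sub g, map_mul g, map_mul g, ← ht, ← hs, ← map_mul, ← map_mul, ← map_sub, h]
  · refine sub_mem ?_ (mul_mem_weightIdeal hw' hw)
    rw [add_comm w]
    exact mul_mem_weightIdeal hw hw'
  · rw [map_sub, Polynomial.coeff_sub, coeff_weight_mul hw' hw, add_comm w,
      coeff_weight_mul hw hw', hv]

/-- Here both constants drop out, so the weight jumps from `0` to `2`; applying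
`HasLeading.pb_ofRab` to `b`, of leading weight `0`, would give only weight `1` with zero component.
-/
theorem IsJet.hasLeading_pb (hg : IsJet g) (a b : Rab R) :
    HasLeading g 1 2 (pb (Gr.ofRab R a) (Gr.ofRab R b))
      (TensorAlgebra.ι _ (KaehlerDifferential.D ℂ _ a) *
          TensorAlgebra.ι _ (KaehlerDifferential.D ℂ _ b) -
        TensorAlgebra.ι _ (KaehlerDifferential.D ℂ _ b) *
          TensorAlgebra.ι _ (KaehlerDifferential.D ℂ _ a)) := by
  obtain ⟨x, t, hx, ht, hw, hv⟩ := hg.exists_leading a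
  obtain ⟨y, s, hy, hs, hw', hv'⟩ := hg.exists_leading b
  suffices h : HasLeading g (0 + 0 + 1) (1 + 1) (pb (Gr.ofRab R a) (Gr.ofRab R b))
      (TensorAlgebra.ι _ (KaehlerDifferential.D ℂ _ a) *
          TensorAlgebra.ι _ (KaehlerDifferential.D ℂ _ b) -
        TensorAlgebra.ι _ (KaehlerDifferential.D ℂ _ b) *
          TensorAlgebra.ι _ (KaehlerDifferential.D ℂ _ a)) from h.congr rfl rfl rfl rfl
  have hc := comm_mem_ncFil (Gr.mem_ncFil_zero x) (Gr.mem_ncFil_zero y)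
  refine ⟨x * y - y * x, hc, t * s - s * t, ?_, ?_, ?_, ?_⟩
  · rw [← hx, ← hy, Gr.pb_symb]
  · rw [map_sub g, map_mul g, map_mul g, ← ht, ← hs, ← map_mul, ← map_mul, ← map_sub,
      algebraMap_add_commutator]
  · exact sub_mem (mul_mem_weightIdeal hw hw') (mul_mem_weightIdeal hw' hw)
  · rw [map_sub, Polynomial.coeff_sub, coeff_weight_mul hw hw', coeff_weight_mul hw' hw, hv, hv']

end Jets

end NCGeom

namespace NCGeom

open TensorProduct

open FreeLie Env

/-! ### Leading components of the images of Lie elements and their products -/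

section Leading

variable {R : Type u} [Ring R] [Algebra ℂ R] {d n : ℕ}
  (g : R →ₐ[ℂ] TensorAlgebra (Rab R) (Ω[Rab R⁄ℂ]) ⧸ truncIdeal (Rab R) (Ω[Rab R⁄ℂ]) d n)

/-- The span of the pairs of an element `y` of the Poisson envelope and the leading component, in
weight `k + 1`, of a lift of the image of `y` in `gr^k_F(R)`. -/
noncomputable def leadPair (k : ℕ) :
    Submodule (Rab R) ((Rab R ⊗[ℂ] Env (Rab R)) × TensorAlgebra (Rab R) (Ω[Rab R⁄ℂ])) :=
  Submodule.span (Rab R)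
    {p | ∃ y v, HasLeading g k (k + 1) (Gr.envHom R y) v ∧ ((1 : Rab R) ⊗ₜ[ℂ] y, v) = p}

/-- The componentwise bracket. -/
noncomputable def pairBracket (A : Type u) [CommRing A] [Algebra ℂ A] :
    ((A ⊗[ℂ] Env A) × TensorAlgebra A (Ω[A⁄ℂ])) →ₗ[A]
      ((A ⊗[ℂ] Env A) × TensorAlgebra A (Ω[A⁄ℂ])) →ₗ[A]
        ((A ⊗[ℂ] Env A) × TensorAlgebra A (Ω[A⁄ℂ])) :=
  LinearMap.mk₂ A (fun p q => (tensorBracket A p.1 q.1, p.2 * q.2 - q.2 * p.2))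
    (fun p p' q => Prod.ext (LinearMap.map_add₂ _ _ _ _) (by
      change (p.2 + p'.2) * q.2 - q.2 * (p.2 + p'.2) =
        (p.2 * q.2 - q.2 * p.2) + (p'.2 * q.2 - q.2 * p'.2)
      noncomm_ring))
    (fun a p q => Prod.ext (LinearMap.map_smul₂ _ _ _ _) (by
      change (a • p.2) * q.2 - q.2 * (a • p.2) = a • (p.2 * q.2 - q.2 * p.2)
      rw [smul_mul_assoc, mul_smul_comm, smul_sub]))
    (fun p q q' => Prod.ext (map_add _ _ _) (by
      change p.2 * (q.2 + q'.2) - (q.2 + q'.2) * p.2 =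
        (p.2 * q.2 - q.2 * p.2) + (p.2 * q'.2 - q'.2 * p.2)
      noncomm_ring))
    (fun a p q => Prod.ext (map_smul _ _ _) (by
      change p.2 * (a • q.2) - (a • q.2) * p.2 = a • (p.2 * q.2 - q.2 * p.2)
      rw [smul_mul_assoc, mul_smul_comm, smul_sub]))

theorem ιTensor_diffMap_mem_span {A : Type u} [CommRing A] [Algebra ℂ A] (w : A ⊗[ℂ] A) :
    (ιTensor A w, TensorAlgebra.ι A (diffMap A w)) ∈ Submodule.span A
      {p | ∃ b, ((1 : A) ⊗ₜ[ℂ] ι A b, TensorAlgebra.ι A (KaehlerDifferential.D ℂ A b)) = p} := by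
  induction w with
  | zero =>
    simp only [map_zero]
    exact zero_mem _
  | tmul a b =>
    have e : (ιTensor A (a ⊗ₜ b), TensorAlgebra.ι A (diffMap A (a ⊗ₜ b))) =
        a • ((1 : A) ⊗ₜ[ℂ] ι A b, TensorAlgebra.ι A (KaehlerDifferential.D ℂ A b)) := by
      rw [ιTensor_tmul, diffMap_tmul, map_smul, Prod.smul_mk, smul_tmul', smul_eq_mul, mul_one]
    rw [e]
    exact Submodule.smul_mem _ _ (Submodule.subset_span ⟨b, rfl⟩)
  | add x y hx hy =>
    simp only [map_add]
    exact add_mem hx hy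

theorem tensorBracket_one_tmul {A : Type u} [CommRing A] [Algebra ℂ A] (x y : Env A) :
    tensorBracket A ((1 : A) ⊗ₜ[ℂ] x) ((1 : A) ⊗ₜ[ℂ] y) = (1 : A) ⊗ₜ[ℂ] pb x y := by
  change ⁅(1 : A) ⊗ₜ[ℂ] x, (1 : A) ⊗ₜ[ℂ] y⁆ = _
  rw [LieAlgebra.ExtendScalars.bracket_tmul, mul_one]
  rfl

variable {g}

theorem IsJet.pairBracket_mem (hg : IsJet g) (w : Rab R ⊗[ℂ] Rab R) {k : ℕ}
    {p : (Rab R ⊗[ℂ] Env (Rab R)) × TensorAlgebra (Rab R) (Ω[Rab R⁄ℂ])} (hp : p ∈ leadPair g k) :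
    pairBracket (Rab R) (ιTensor (Rab R) w, TensorAlgebra.ι (Rab R) (diffMap (Rab R) w)) p ∈
      leadPair g (k + 1) := by
  refine bilin_span_mem (pairBracket (Rab R)) ?_ (ιTensor_diffMap_mem_span w) hp
  rintro _ ⟨b, rfl⟩ _ ⟨y, v, h, rfl⟩
  refine Submodule.subset_span ⟨_, _, ?_, Prod.ext (tensorBracket_one_tmul _ _).symm rfl⟩
  rw [Gr.envHom_pb, Gr.envHom_ι]
  exact h.pb_ofRab hg b

theorem IsJet.pairBracket_mem_one (hg : IsJet g) (w w' : Rab R ⊗[ℂ] Rab R) :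
    pairBracket (Rab R) (ιTensor (Rab R) w, TensorAlgebra.ι (Rab R) (diffMap (Rab R) w))
      (ιTensor (Rab R) w', TensorAlgebra.ι (Rab R) (diffMap (Rab R) w')) ∈ leadPair g 1 := by
  refine bilin_span_mem (pairBracket (Rab R)) ?_ (ιTensor_diffMap_mem_span w)
    (ιTensor_diffMap_mem_span w')
  rintro _ ⟨b, rfl⟩ _ ⟨c, rfl⟩
  refine Submodule.subset_span ⟨_, _, ?_, Prod.ext (tensorBracket_one_tmul _ _).symm rfl⟩
  rw [Gr.envHom_pb, Gr.envHom_ι, Gr.envHom_ι]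
  exact hg.hasLeading_pb b c

theorem HasLeading.smul {i w : ℕ} (hg : IsJet g) (a : Rab R) {x : Env (Rab R)}
    {v : TensorAlgebra (Rab R) (Ω[Rab R⁄ℂ])} (h : HasLeading g i w (Gr.envHom R x) v) :
    HasLeading g i w (Gr.envHom R (a • x)) (a • v) :=
  ((hg.hasLeading_ofRab a).mul h).congr (Nat.zero_add i) (Nat.zero_add w)
    (map_mul (Gr.envHom R) (ι _ a) x).symm (Algebra.smul_def a v).symm

theorem IsJet.hasLeading_of_mem_leadPair (hg : IsJet g) {k : ℕ}
    {p : (Rab R ⊗[ℂ] Env (Rab R)) × TensorAlgebra (Rab R) (Ω[Rab R⁄ℂ])} (hp : p ∈ leadPair g k) :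
    HasLeading g k (k + 1) (Gr.envHom R (contract (Rab R) p.1)) p.2 := by
  induction hp using Submodule.span_induction with
  | mem p hp =>
    obtain ⟨y, v, h, rfl⟩ := hp
    refine h.congr rfl rfl ?_ rfl
    rw [contract_tmul, map_one, one_mul]
  | zero =>
    refine (HasLeading.zero k (k + 1)).congr rfl rfl ?_ rfl
    rw [Prod.fst_zero, map_zero, map_zero]
  | add p q _ _ hp hq =>
    refine (hp.add hq).congr rfl rfl ?_ rfl
    rw [Prod.fst_add, map_add, map_add]
  | smul a p _ hp =>
    refine (hp.smul hg a).congr rfl rfl ?_ rfl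
    rw [Prod.smul_fst, map_smul (contract (Rab R))]

variable {σ : Ω[Rab R⁄ℂ] →ₗ[Rab R] Rab R ⊗[ℂ] Rab R}

/-- `lieToTensor` and `toTensor` are both Lie homomorphisms, so their pair can be followed from the
generators `(σ m, m)` through the componentwise bracket. Carrying out the brackets in `A ⊗ P(A)`
avoids correction terms; contraction comes only afterwards. -/
theorem IsJet.lieToTensor_mem_leadPair (hg : IsJet g)
    (hσ : diffMap (Rab R) ∘ₗ σ = LinearMap.id) {k : ℕ} {u : FreeLie (Rab R) (Ω[Rab R⁄ℂ])}
    (hu : u ∈ FreeLie.deg (Rab R) (Ω[Rab R⁄ℂ]) (k + 1)) :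
    (lieToTensor σ u, toTensor (Rab R) (Ω[Rab R⁄ℂ]) u) ∈ leadPair g (k + 1) := by
  have hm : ∀ m, (lieToTensor σ (FreeLie.of (Rab R) _ m),
      toTensor (Rab R) (Ω[Rab R⁄ℂ]) (FreeLie.of (Rab R) _ m)) =
        (ιTensor (Rab R) (σ m), TensorAlgebra.ι (Rab R) (diffMap (Rab R) (σ m))) := by
    intro m
    rw [lieToTensor_of, toTensor_of, ← LinearMap.comp_apply (diffMap (Rab R)), hσ,
      LinearMap.id_apply]
  have hlie : ∀ m y, (lieToTensor σ ⁅FreeLie.of (Rab R) _ m, y⁆,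
      toTensor (Rab R) (Ω[Rab R⁄ℂ]) ⁅FreeLie.of (Rab R) _ m, y⁆) =
        pairBracket (Rab R)
          (ιTensor (Rab R) (σ m), TensorAlgebra.ι (Rab R) (diffMap (Rab R) (σ m)))
          (lieToTensor σ y, toTensor (Rab R) (Ω[Rab R⁄ℂ]) y) := by
    intro m y
    rw [← hm, lieToTensor_lie, toTensor_lie]
    rfl
  -- Degree `0` is excluded: there the lift of `a` starts with the constant `a` in weight `0`, not
  -- with `da` in weight `1`.
  refine FreeLie.deg_induction (p := fun k u => k ≠ 0 →
    (lieToTensor σ u, toTensor (Rab R) (Ω[Rab R⁄ℂ]) u) ∈ leadPair g k)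
    ?_ ?_ ?_ ?_ ?_ hu k.succ_ne_zero
  · exact fun m h => absurd rfl h
  · intro k m y hy ih _
    rw [hlie]
    cases k with
    | zero =>
      obtain ⟨m', rfl⟩ := exists_of_mem_deg_zero hy
      rw [hm]
      exact hg.pairBracket_mem_one _ _
    | succ k => exact hg.pairBracket_mem _ (ih k.succ_ne_zero)
  · intro k _
    rw [map_zero, map_zero]
    exact zero_mem _
  · intro k x y _ _ hx hy hk
    rw [map_add, map_add]
    exact add_mem (hx hk) (hy hk)
  · intro k a x _ hx hk
    rw [map_smul, map_smul]
    exact Submodule.smul_mem _ a (hx hk)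

theorem IsJet.hasLeading_gen (hg : IsJet g) (hσ : diffMap (Rab R) ∘ₗ σ = LinearMap.id) {k : ℕ}
    (u : FreeLie.deg (Rab R) (Ω[Rab R⁄ℂ]) (k + 1)) :
    HasLeading g (k + 1) (k + 1 + 1) (Gr.envHom R (symToEnv σ (gen k u)))
      (toTensor (Rab R) (Ω[Rab R⁄ℂ]) u) :=
  (hg.hasLeading_of_mem_leadPair (hg.lieToTensor_mem_leadPair hσ u.2)).congr rfl rfl
    (by rw [symToEnv_gen]; rfl) rfl

/-- Leading components multiply. Each factor of degree `k + 1` has leading weight `k + 2`, so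
`l.length` factors put the weight `l.length` above the total degree. -/
theorem IsJet.exists_hasLeading (hg : IsJet g) (hσ : diffMap (Rab R) ∘ₗ σ = LinearMap.id)
    {l : List ℕ} {q : SymmetricAlgebra (Rab R) (LiePlus (Rab R) (Ω[Rab R⁄ℂ]))}
    (hq : q ∈ (l.map fun k => symGen (Rab R) (Ω[Rab R⁄ℂ]) k).prod) :
    ∃ v, (v, q) ∈ (l.map (genPair (Rab R) (Ω[Rab R⁄ℂ]))).prod ∧
      HasLeading g (l.map fun k => k + 1).sum ((l.map fun k => k + 1).sum + l.length)
        (Gr.envHom R (symToEnv σ q)) v := by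
  induction l generalizing q with
  | nil =>
    obtain ⟨a, rfl⟩ := Submodule.mem_one.1 hq
    refine ⟨algebraMap _ _ a, Submodule.mem_one.2 ⟨a, rfl⟩, ?_⟩
    refine (hg.hasLeading_ofRab a).congr rfl rfl ?_ rfl
    rw [AlgHom.commutes]
    rfl
  | cons k l ih =>
    rw [List.map_cons, List.prod_cons] at hq ⊢
    induction hq using Submodule.mul_induction_on' with
    | mem_mul_mem x hx y hy =>
      obtain ⟨u, rfl⟩ := hx
      obtain ⟨v, hv, h⟩ := ih hy
      refine ⟨toTensor _ _ u * v, Submodule.mul_mem_mul (M := genPair _ _ k) ⟨u, rfl⟩ hv, ?_⟩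
      refine ((hg.hasLeading_gen hσ u).mul h).congr ?_ ?_ ?_ rfl
      · rw [List.map_cons, List.sum_cons]
      · rw [List.map_cons, List.sum_cons, List.length_cons]
        omega
      · rw [← map_mul, ← map_mul]
        rfl
    | add x _ y _ hx hy =>
      obtain ⟨v, hv, h⟩ := hx
      obtain ⟨w, hw, h'⟩ := hy
      exact ⟨v + w, add_mem hv hw, (h.add h').congr rfl rfl (by rw [map_add, map_add]) rfl⟩

end Leading

/-! ### The filtration by the number of factors -/

section Injective

variable (A M : Type u) [CommRing A] [AddCommGroup M] [Module A M]

/-- The part of `Q^i_A(M)` which is spanned by the products of at least `s` factors. -/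
noncomputable def QFil (i s : ℕ) : Submodule A (SymmetricAlgebra A (LiePlus A M)) :=
  ⨆ l : {l : List ℕ // (l.map fun k => k + 1).sum = i ∧ s ≤ l.length},
    (l.1.map fun k => symGen A M k).prod

variable {A M}

theorem prod_symGen_le_QFil {i s : ℕ} {l : List ℕ} (hl : (l.map fun k => k + 1).sum = i)
    (hs : s ≤ l.length) : (l.map fun k => symGen A M k).prod ≤ QFil A M i s :=
  le_iSup (fun l : {l : List ℕ // (l.map fun k => k + 1).sum = i ∧ s ≤ l.length} =>
    (l.1.map fun k => symGen A M k).prod) ⟨l, hl, hs⟩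

theorem Q_le_QFil_zero (i : ℕ) : Q A M i ≤ QFil A M i 0 :=
  iSup₂_le fun _ hl => prod_symGen_le_QFil hl (Nat.zero_le _)

theorem length_le_sum_succ (l : List ℕ) : l.length ≤ (l.map fun k => k + 1).sum := by
  induction l with
  | nil => simp
  | cons k l ih =>
    rw [List.map_cons, List.sum_cons, List.length_cons]
    omega

/-- Every factor has degree at least `1`, so there are at most `i` of them. -/
theorem QFil_eq_bot {i s : ℕ} (h : i < s) : QFil A M i s = ⊥ := by
  refine le_bot_iff.1 (iSup_le ?_)
  rintro ⟨l, rfl, hl⟩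
  exact absurd (length_le_sum_succ l) (by omega)

theorem eq_zero_of_factorial_smul [Algebra ℂ A] {N : Type*} [AddCommGroup N] [Module A N] {s : ℕ}
    {x : N} (h : (s.factorial : A) • x = 0) : x = 0 := by
  have e : algebraMap ℂ A (s.factorial : ℂ)⁻¹ * (s.factorial : A) = 1 := by
    rw [← map_natCast (algebraMap ℂ A), ← map_mul,
      inv_mul_cancel₀ (Nat.cast_ne_zero.2 s.factorial_ne_zero), map_one]
  rw [← one_smul A x, ← e, mul_smul, h, smul_zero]

end Injective

/-! ### Injectivity of the map from the symmetric algebra to the associated graded algebra -/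

section Main

variable {R : Type u} [Ring R] [Algebra ℂ R] {d n : ℕ}
  {g : R →ₐ[ℂ] TensorAlgebra (Rab R) (Ω[Rab R⁄ℂ]) ⧸ truncIdeal (Rab R) (Ω[Rab R⁄ℂ]) d n}
  {σ : Ω[Rab R⁄ℂ] →ₗ[Rab R] Rab R ⊗[ℂ] Rab R}

/-- On a product of exactly `s` factors the symbol gives `s!` times that product, with `q' = 0`. On
longer products the component in weight `i + s` is zero, and `q'` is the product itself. -/
theorem IsJet.exists_opSymbol_eq (hg : IsJet g) (hσ : diffMap (Rab R) ∘ₗ σ = LinearMap.id)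
    {i s : ℕ} {q : SymmetricAlgebra (Rab R) (LiePlus (Rab R) (Ω[Rab R⁄ℂ]))}
    (hq : q ∈ QFil (Rab R) (Ω[Rab R⁄ℂ]) i s) :
    ∃ q' ∈ QFil (Rab R) (Ω[Rab R⁄ℂ]) i (s + 1), ∃ v,
      HasLeading g i (i + s) (Gr.envHom R (symToEnv σ q)) v ∧
        opSymbol (Rab R) (Ω[Rab R⁄ℂ]) s v = (s.factorial : Rab R) • (q - q') := by
  refine Submodule.iSup_induction _ (motive := fun q => ∃ q' ∈ QFil (Rab R) (Ω[Rab R⁄ℂ]) i (s + 1),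
    ∃ v, HasLeading g i (i + s) (Gr.envHom R (symToEnv σ q)) v ∧
        opSymbol (Rab R) (Ω[Rab R⁄ℂ]) s v = (s.factorial : Rab R) • (q - q')) hq ?_ ?_ ?_
  · rintro ⟨l, rfl, hl⟩ x hx
    obtain ⟨v, hv, h⟩ := hg.exists_hasLeading hσ hx
    obtain rfl | hlt := hl.eq_or_lt
    · refine ⟨0, zero_mem _, v, h, ?_⟩
      rw [opSymbol_genPair hv, sub_zero]
    · refine ⟨x, prod_symGen_le_QFil rfl hlt hx, 0, h.of_lt (Nat.add_lt_add_left hlt _), ?_⟩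
      rw [map_zero, sub_self, smul_zero]
  · refine ⟨0, zero_mem _, 0, (HasLeading.zero _ _).congr rfl rfl ?_ rfl, ?_⟩
    · rw [map_zero, map_zero]
    · rw [map_zero, sub_zero, smul_zero]
  · rintro x y ⟨x', hx', v, hv, hx⟩ ⟨y', hy', w, hw, hy⟩
    refine ⟨x' + y', add_mem hx' hy', v + w, (hv.add hw).congr rfl rfl ?_ rfl, ?_⟩
    · rw [map_add, map_add]
    · rw [map_add, hx, hy, ← smul_add, add_sub_add_comm]

/-- A representative of zero in `gr^i` lies in `F^{i+1}`, and homomorphisms preserve the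
NC-filtration. -/
theorem HasLeading.opSymbol_eq_zero {i s : ℕ} (hi : i ≤ d) (hn : i + s < n)
    {v : TensorAlgebra (Rab R) (Ω[Rab R⁄ℂ])} (h : HasLeading g i (i + s) 0 v) :
    opSymbol (Rab R) (Ω[Rab R⁄ℂ]) s v = 0 := by
  obtain ⟨x, hx, t, hz, ht, _, rfl⟩ := h
  refine opSymbol_coeff_eq_zero_of_mem_ncFil hi hn ?_
  rw [ht]
  exact map_mem_ncFil g (Gr.symb_eq_zero_iff.1 hz)

theorem IsJet.eq_zero_of_envHom_symToEnv_eq_zero (hg : IsJet g)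
    (hσ : diffMap (Rab R) ∘ₗ σ = LinearMap.id) {i : ℕ} (hi : i ≤ d) (hn : 2 * d < n)
    {q : SymmetricAlgebra (Rab R) (LiePlus (Rab R) (Ω[Rab R⁄ℂ]))}
    (hq : q ∈ Q (Rab R) (Ω[Rab R⁄ℂ]) i) (h : Gr.envHom R (symToEnv σ q) = 0) : q = 0 := by
  -- The symbol of order `s` forces `q = q'`, which has one more factor. Only `s ≤ i` is used, so
  -- the weights `i + s` stay at most `2 * d < n`.
  have key : ∀ s ≤ i + 1, q ∈ QFil (Rab R) (Ω[Rab R⁄ℂ]) i s := by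
    intro s hs
    induction s with
    | zero => exact Q_le_QFil_zero i hq
    | succ s ih =>
      obtain ⟨q', hq', v, hv, e⟩ := hg.exists_opSymbol_eq hσ (ih (by omega))
      rw [h] at hv
      rw [hv.opSymbol_eq_zero hi (by omega)] at e
      rwa [sub_eq_zero.1 (eq_zero_of_factorial_smul e.symm)]
  have h₀ := key (i + 1) le_rfl
  rwa [QFil_eq_bot i.lt_succ_self] at h₀

end Main

end NCGeom

namespace NCGeom

open TensorProduct

open Env

/-! ### The isomorphism from injectivity in low degrees -/

section

variable {R : Type u} [Ring R] [Algebra ℂ R]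

theorem HasLeading.mem_deg {d n : ℕ}
    {g : R →ₐ[ℂ] TensorAlgebra (Rab R) (Ω[Rab R⁄ℂ]) ⧸ FreeLie.truncIdeal (Rab R) (Ω[Rab R⁄ℂ]) d n}
    {i w : ℕ} {z : Gr R} {v : TensorAlgebra (Rab R) (Ω[Rab R⁄ℂ])} (h : HasLeading g i w z v) :
    z ∈ Gr.deg R i := by
  obtain ⟨x, hx, _, hz, _⟩ := h
  exact Gr.mem_deg_iff.2 ⟨x, hx, hz⟩

namespace Gr

variable (R) in
/-- The component of degree `i`. -/
noncomputable def component (i : ℕ) : Gr R →ₗ[ℂ] GrPiece R i :=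
  DirectSum.component ℂ ℕ (fun i => GrPiece R i) i

theorem component_incl (i : ℕ) (y : GrPiece R i) : component R i (incl R i y) = y :=
  DirectSum.component.lof_self ℂ i y

theorem component_incl_of_ne {i j : ℕ} (h : i ≠ j) (y : GrPiece R i) :
    component R j (incl R i y) = 0 := by
  refine (DirectSum.component.of ℂ j i y).trans ?_
  rw [dif_neg h]

theorem component_eq_zero {i j : ℕ} (h : i ≠ j) {z : Gr R} (hz : z ∈ deg R i) :
    component R j z = 0 := by
  obtain ⟨y, rfl⟩ := hz
  exact component_incl_of_ne h y

theorem eq_zero_of_component_eq_zero {i : ℕ} {z : Gr R} (hz : z ∈ deg R i)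
    (h : component R i z = 0) : z = 0 := by
  obtain ⟨y, rfl⟩ := hz
  rw [component_incl] at h
  rw [h, map_zero]

theorem eq_zero_of_mem_deg {d i : ℕ} (hR : IsNCNilpotent d R) (hi : d + 1 ≤ i) {z : Gr R}
    (hz : z ∈ deg R i) : z = 0 := by
  obtain ⟨x, hx, rfl⟩ := mem_deg_iff.1 hz
  refine symb_eq_zero ?_
  have h : x ∈ ncFil R (d + 1) := ncFil_antitone hi hx
  rw [hR] at h
  obtain rfl : x = 0 := h
  exact zero_mem _

theorem envHom_eq_zero_of_mem_ge {d : ℕ} (hR : IsNCNilpotent d R) {x : Env (Rab R)}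
    (hx : x ∈ ge (Rab R) (d + 1)) : envHom R x = 0 := by
  have h : geSpace (Rab R) (d + 1) ≤ LinearMap.ker (envHom R).toLinearMap :=
    iSup₂_le fun i hi y hy => eq_zero_of_mem_deg hR hi (envHom_mem_deg hy)
  exact h hx

/-- It is not assumed that `P(A)` is the direct sum of its components. A decomposition into
components suffices, because the target is a direct sum: each summand of degree `< m` is killed
separately, hence vanishes. -/
theorem mem_ge_of_envHom_eq_zero {m : ℕ}
    (hinj : ∀ i < m, ∀ x ∈ Env.deg (Rab R) i, envHom R x = 0 → x = 0) {x : Env (Rab R)}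
    (hx : envHom R x = 0) : x ∈ ge (Rab R) m := by
  have h₀ := mem_geSpace_zero x
  simp only [geSpace, Nat.zero_le, iSup_pos] at h₀
  obtain ⟨f, hf, rfl⟩ := (Submodule.mem_iSup_iff_exists_finsupp _ _).1 h₀
  refine Ideal.sum_mem _ fun j hj => ?_
  obtain hjm | hjm := le_or_gt m j
  · exact le_iSup₂_of_le (f := fun i (_ : m ≤ i) => Env.deg (Rab R) i) j hjm le_rfl (hf j)
  · rw [hinj j hjm _ (hf j) (eq_zero_of_component_eq_zero (envHom_mem_deg (hf j)) ?_)]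
    · exact zero_mem _
    · rw [Finsupp.sum, map_sum] at hx
      have h := congrArg (component R j) hx
      rw [map_sum, map_zero, Finset.sum_eq_single j] at h
      · exact h
      · exact fun i _ hij => component_eq_zero hij (envHom_mem_deg (hf i))
      · exact fun h' => absurd hj h'

theorem envHom_surjective : Function.Surjective (envHom R) := fun z => by
  refine Gr.induct z (fun i x hx => ?_) ?_
  · obtain ⟨y, _, h⟩ := exists_envHom_eq (mem_deg_iff.2 ⟨x, hx, rfl⟩)
    exact ⟨y, h⟩
  · rintro _ _ ⟨x, rfl⟩ ⟨y, rfl⟩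
    exact ⟨x + y, map_add _ _ _⟩

variable (R) in
/-- The map `envHom` as a linear map over `R_ab`. -/
noncomputable def envLinear : Env (Rab R) →ₗ[Rab R] Gr R :=
  { (envHom R).toLinearMap with map_smul' := fun a x => map_mul (envHom R) (ι (Rab R) a) x }

/-- The isomorphism `P(R_ab)/P^{≥ d+1}(R_ab) → gr_F(R)` if `envHom` is injective in the degrees
`≤ d`. -/
noncomputable def envEquiv {d : ℕ} (hR : IsNCNilpotent d R)
    (hinj : ∀ i < d + 1, ∀ x ∈ Env.deg (Rab R) i, envHom R x = 0 → x = 0) :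
    (Env (Rab R) ⧸ ge (Rab R) (d + 1)) ≃ₐ[ℂ] Gr R :=
  AlgEquiv.ofBijective
    (Ideal.Quotient.liftₐ (ge (Rab R) (d + 1)) (envHom R) fun _ hx => envHom_eq_zero_of_mem_ge hR hx)
    ⟨(injective_iff_map_eq_zero _).2 fun x hx => by
        obtain ⟨x, rfl⟩ := Ideal.Quotient.mk_surjective x
        exact Ideal.Quotient.eq_zero_iff_mem.2 (mem_ge_of_envHom_eq_zero hinj hx),
      fun z => by
        obtain ⟨x, rfl⟩ := envHom_surjective z
        exact ⟨Ideal.Quotient.mk _ x, rfl⟩⟩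

end Gr

end

end NCGeom

/-- For a `d`-smooth algebra `R` with `A = R_ab`, the Poisson algebra `gr_F(R)` is canonically
isomorphic to `P(A)/P^{≥ d+1}(A)`: there is exactly one isomorphism of Poisson algebras which is
compatible with the canonical maps from `A`, and it respects the gradings. Moreover
`gr^i_F(R) ≃ Q^i_A(Ω¹_A)` as `A`-modules for `i ≤ d`. -/
theorem theorem4p2p1 {R : Type u} [Ring R] [Algebra ℂ R] (d : ℕ) (hR : NCGeom.IsDSmooth d R) :
    (∃ e : (NCGeom.Env (NCGeom.Rab R) ⧸ NCGeom.Env.ge (NCGeom.Rab R) (d + 1)) ≃ₐ[ℂ] NCGeom.Gr R,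
      ((∀ x y, e (NCGeom.pb x y) = NCGeom.pb (e x) (e y)) ∧
        (∀ a : NCGeom.Rab R, e (Ideal.Quotient.mk _ (NCGeom.Env.ι (NCGeom.Rab R) a)) =
          NCGeom.Gr.ofRab R a)) ∧
      (∀ i : ℕ, (fun x => e (Ideal.Quotient.mk _ x)) ''
          (NCGeom.Env.deg (NCGeom.Rab R) i : Set (NCGeom.Env (NCGeom.Rab R))) =
        (NCGeom.Gr.deg R i : Set (NCGeom.Gr R))) ∧
      ∀ e' : (NCGeom.Env (NCGeom.Rab R) ⧸ NCGeom.Env.ge (NCGeom.Rab R) (d + 1)) ≃ₐ[ℂ]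
          NCGeom.Gr R,
        (∀ x y, e' (NCGeom.pb x y) = NCGeom.pb (e' x) (e' y)) →
        (∀ a : NCGeom.Rab R, e' (Ideal.Quotient.mk _ (NCGeom.Env.ι (NCGeom.Rab R) a)) =
          NCGeom.Gr.ofRab R a) → e' = e) ∧
    ∀ i : ℕ, i ≤ d →
      Nonempty (NCGeom.Gr.deg R i ≃ₗ[NCGeom.Rab R]
        NCGeom.Q (NCGeom.Rab R) (Ω[NCGeom.Rab R⁄ℂ]) i) := by
  open NCGeom in
  obtain ⟨σ, hσ⟩ := hR.exists_section
  -- The weights that occur are at most `2 * d`, and the truncation must retain weights below `2`;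
  -- `2 * d + 2` meets both needs.
  obtain ⟨g, hg⟩ := hR.exists_jet (n := 2 * d + 2) (by omega)
  replace hg : IsJet g := hg
  have hQ : ∀ i ≤ d, ∀ q ∈ Q (Rab R) (Ω[Rab R⁄ℂ]) i,
      Gr.envHom R (Env.symToEnv σ q) = 0 → q = 0 := fun i hi q hq h =>
    hg.eq_zero_of_envHom_symToEnv_eq_zero hσ hi (by omega) hq h
  have hinj : ∀ i < d + 1, ∀ x ∈ Env.deg (Rab R) i, Gr.envHom R x = 0 → x = 0 := by
    intro i hi x hx h
    obtain ⟨q, hq, rfl⟩ := Env.exists_symToEnv_eq hσ hx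
    rw [hQ i (by omega) q hq h, map_zero]
  refine ⟨⟨Gr.envEquiv hR.ncNilpotent hinj, ⟨fun x y => ?_, fun a => rfl⟩, fun i => ?_,
    fun e' hpb hι => ?_⟩, fun i hi => ?_⟩
  · obtain ⟨x, rfl⟩ := Ideal.Quotient.mk_surjective x
    obtain ⟨y, rfl⟩ := Ideal.Quotient.mk_surjective y
    exact Gr.envHom_pb x y
  · ext z
    constructor
    · rintro ⟨x, hx, rfl⟩
      exact Gr.envHom_mem_deg hx
    · exact fun hz => Gr.exists_envHom_eq hz
  · refine AlgEquiv.ext fun x => ?_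
    obtain ⟨x, rfl⟩ := Ideal.Quotient.mk_surjective x
    exact Env.hom_ext (g := e'.toAlgHom.comp (Ideal.Quotient.mkₐ ℂ (Env.ge (Rab R) (d + 1))))
      (h := Gr.envHom R) (fun x y => hpb (Ideal.Quotient.mk _ x) (Ideal.Quotient.mk _ y)) Gr.envHom_pb hι x
  · obtain ⟨f, hf⟩ : ∃ f : Q (Rab R) (Ω[Rab R⁄ℂ]) i →ₗ[Rab R] Gr R,
        ∀ q, f q = Gr.envHom R (Env.symToEnv σ q) :=
      ⟨Gr.envLinear R ∘ₗ (Env.symToEnv σ).toLinearMap ∘ₗ (Q (Rab R) (Ω[Rab R⁄ℂ]) i).subtype,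
        fun _ => rfl⟩
    have hdeg : ∀ q, f q ∈ Gr.deg R i := fun q => by
      -- The case `s = 0` serves only to exhibit the image of `q` as a symbol of degree `i`.
      obtain ⟨_, _, _, h, _⟩ := hg.exists_opSymbol_eq hσ (Q_le_QFil_zero i q.2)
      rw [hf]
      exact h.mem_deg
    refine ⟨(LinearEquiv.ofBijective (LinearMap.codRestrict (Gr.deg R i) f hdeg) ⟨?_, ?_⟩).symm⟩
    · refine (injective_iff_map_eq_zero _).2 fun q hq => Subtype.ext ?_
      have h : f q = 0 := congrArg Subtype.val hq
      rw [hf] at h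
      exact hQ i hi q q.2 h
    · rintro ⟨z, hz⟩
      obtain ⟨x, hx, rfl⟩ := Gr.exists_envHom_eq hz
      obtain ⟨q, hq, rfl⟩ := Env.exists_symToEnv_eq hσ hx
      exact ⟨⟨q, hq⟩, Subtype.ext (hf ⟨q, hq⟩)⟩
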